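/- **Setting.** Let $(M,\omega)$ be a (Hausdorff, second countable) smooth symplectic manifold of dimension $2n$. For $x\in M$ let $\bar\omega_x$ be the form on $T_x^*M$ corresponding to $\omega_x$ under $v\mapsto\omega_x(v,-)$, and let $\mathcal W_x$ be the formal Weyl algebra: the $\mathbb C[[\hbar]]$-module $\mathbb C[[T_x^*M]][[\hbar]]$ of formal power series on $T_xM$ with coefficients in $\mathbb C[[\hbar]]$, with the Moyal product $$a* b=\sum_{r\ge 0}\frac{1}{r!}\Big(\frac{i\hbar}{2}\Big)^r\sum \pi^{i_1j_1}\cdots\pi^{i_rj_r}\,(\partial_{i_1}\cdots\partial_{i_r}a)(\partial_{j_1}\cdots\partial_{j_r}b),$$ where $\pi^{ij}$ are the coefficients of $\bar\omega_x$; thus $\alpha*\beta-\beta*\alpha=i\hbar\,\bar\omega_x(\alpha,\beta)$ for covectors $\alpha,\beta$. It is graded by $\deg\alpha=1$ for covectors and $\deg\hbar=2$. Let $\mathcal W\to M$ be the resulting bundle of algebras, $\Gamma(\mathcal W)$ the $\mathbb C[[\hbar]]$-algebra of its smooth sections, $\mathcal Z$ the centre of $\Gamma(\mathcal W)$ and $\mathcal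 Z^\times$ the group of invertible central sections. For $U\in\Gamma(\mathcal W)^\times$ write $\mathrm{Ad}\,U(a)=UaU^{-1}$. A connection on $\mathcal W$ is a $\mathbb C[[\hbar]]$-linear connection $\nabla$ with $\nabla(ab)=\nabla(a)b+a\nabla(b)$ and $\nabla f=df$ for $f\in C^\infty(M,\mathbb{C})$. A *Fedosov connection* is a flat connection on $\mathcal W$ of the form $$\nabla=[A_{-1},-]+\nabla_0+[A_1,-]+[A_2,-]+\cdots ,$$ where $\nabla_0$ is induced by an affine connection on $M$ preserving $\omega$, $A_{-1}(X)=\omega(X,-)/(i\hbar)$, and, for $j\ge1$, $A_j$ is a $1$-form on $M$ with values of the form $\Phi/(i\hbar)$, with $\Phi\in\mathcal W$ homogeneous of degree $j+2$ and real modulo $\hbar$. Its algebra of flat sections is $\mathbb A_\hbar=\operatorname{Ker}\nabla\subset\Gamma(\mathcal W)$. Put $$\mathcal G_\nabla=\{U\in\Gamma(\mathcal W)^\times : \nabla(U^{-1})\,U\in\Omega^1(M,\mathcal Z)\},\qquad \overline{\mathcal G_\nabla}=\mathcal G_\nabla/\mathcal Z^\times .$$ Let a group $\Gamma$ act on $M$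 from the left by symplectomorphisms. An *extension* of this action to $\operatorname{Ker}\nabla$ is a homomorphism $A:\Gamma^{op}\to\mathrm{Aut}_{\mathbb C[[\hbar]]}(\operatorname{Ker}\nabla)$, $\gamma\mapsto A_\gamma$ (so $A_\gamma A_\mu=A_{\mu\gamma}$), such that for every $\gamma$ there is $U_\gamma\in\Gamma(\mathcal W)^\times$ with $A_\gamma=\mathrm{Ad}\,U_\gamma\circ\gamma^*$ on $\operatorname{Ker}\nabla$. Two extensions $B,B'$ are *equivalent* if there is $C\in\Gamma(\mathcal W)^\times$ such that $\mathrm{Ad}\,C$ restricts to an automorphism $c$ of $\operatorname{Ker}\nabla$ and $B'_\gamma=c\circ B_\gamma\circ c^{-1}$ for all $\gamma\in\Gamma$. **Theorem.** Let $\nabla$ be a Fedosov connection and let $A$ be an extension of the action of $\Gamma$ to $\operatorname{Ker}\nabla$. 1. There is an action of $\Gamma^{op}$ on the group $\overline{\mathcal G_\nabla}$ by group automorphisms, again written $A_\gamma$, such that whenever $A_\gamma=\mathrm{Ad}\,U\circ\gamma^*$ on $\operatorname{Ker}\nabla$ with $U\in\Gamma(\mathcal{W})^\times$, then for all $g\in\mathcal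 G_\nabla$ the element $\mathrm{Ad}\,U(\gamma^*g)$ lies in $\mathcal G_\nabla$ and $A_\gamma([g])=[\mathrm{Ad}\,U(\gamma^*g)]$. 2. Let a cocycle be a map $S:\Gamma\to\overline{\mathcal G_\nabla}$ with $S_\gamma A_\gamma(S_\mu)=S_{\mu\gamma}$, call $S,S'$ cohomologous if $S'_\gamma=cS_\gamma A_\gamma(c^{-1})$ for some $c\in\overline{\mathcal G_\nabla}$ and all $\gamma$, and let $\mathrm H^1(\Gamma,\overline{\mathcal G_\nabla})$ be the set of cohomology classes, pointed by the class of the trivial cocycle. There is a bijection $S\mapsto B^S$ from cocycles to extensions of the given action, with $B^S_\gamma=\mathrm{Ad}\,s_\gamma\circ A_\gamma$ for all $\gamma$ and every representative $s_\gamma\in\mathcal G_\nabla$ of $S_\gamma$. It sends the trivial cocycle to $A$, and $S,S'$ are cohomologous if and only if $B^S,B^{S'}$ are equivalent. Consequently $[S]\mapsto[B^S]$ is a bijection of pointed sets from $\mathrm H^1(\Gamma,\overline{\mathcal G_\nabla})$ to the set of equivalence classes of extensions of the given action to $\operatorname{Ker}\nabla$, pointed by the class of $A$. -/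

import Mathlib

open scoped TensorProduct ContDiff Manifold PowerSeries

section Generic
variable {S : Type*} [CommRing S] [Algebra ℂ S] {ι : Type*} [Fintype ι]

/-- The operator `∑ᵢⱼ πⁱʲ Dᵢ ⊗ Dⱼ` on `S ⊗ S`. -/
noncomputable def bidiffOp (D : ι → Derivation ℂ S S) (π : ι → ι → ℂ) :
    Module.End ℂ (S ⊗[ℂ] S) :=
  ∑ i, ∑ j, π i j • TensorProduct.map (D i : S →ₗ[ℂ] S) (D j : S →ₗ[ℂ] S)

/-- The `r`-th power of `∑ᵢⱼ πⁱʲ Dᵢ ⊗ Dⱼ` followed by multiplication, as the bilinear map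
`(f, g) ↦ ∑ π^{i₁j₁} ⋯ π^{iᵣjᵣ} (D_{i₁} ⋯ D_{iᵣ} f) (D_{j₁} ⋯ D_{jᵣ} g)`. -/
noncomputable def contraction (D : ι → Derivation ℂ S S) (π : ι → ι → ℂ) (r : ℕ) :
    S →ₗ[ℂ] S →ₗ[ℂ] S :=
  TensorProduct.curry (LinearMap.mul' ℂ S ∘ₗ (bidiffOp D π ^ r))

variable (D : ι → Derivation ℂ S S) (π : ι → ι → ℂ)

theorem contraction_apply (r : ℕ) (f g : S) :
    contraction D π r f g = LinearMap.mul' ℂ S ((bidiffOp D π ^ r) (f ⊗ₜ g)) := rfl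

theorem contraction_zero (f g : S) : contraction D π 0 f g = f * g := by
  simp [contraction_apply]

theorem contraction_succ (r : ℕ) (f g : S) :
    contraction D π (r + 1) f g = ∑ i, ∑ j, π i j • contraction D π r (D i f) (D j g) := by
  simp [contraction_apply, pow_succ, bidiffOp, LinearMap.sum_apply, map_sum]

theorem contraction_algebraMap_left (r : ℕ) (z : ℂ) (g : S) :
    contraction D π (r + 1) (algebraMap ℂ S z) g = 0 := by
  simp [contraction_succ]

theorem contraction_algebraMap_right (r : ℕ) (z : ℂ) (g : S) :
    contraction D π (r + 1) g (algebraMap ℂ S z) = 0 := by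
  simp [contraction_succ]

theorem contraction_assoc (hD : ∀ i j f, D i (D j f) = D j (D i f)) (N : ℕ) (f g h : S) :
    ∑ p ∈ Finset.HasAntidiagonal.antidiagonal N, ((p.1.factorial : ℂ)⁻¹ * (p.2.factorial : ℂ)⁻¹) •
        contraction D π p.1 (contraction D π p.2 f g) h =
      ∑ p ∈ Finset.HasAntidiagonal.antidiagonal N, ((p.1.factorial : ℂ)⁻¹ * (p.2.factorial : ℂ)⁻¹) •
        contraction D π p.1 f (contraction D π p.2 g h) := by
  let d : ι → (S →ₗ[ℂ] S) := fun i => (D i : S →ₗ[ℂ] S)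
  let μ := LinearMap.mul' ℂ S
  let P := bidiffOp D π
  let Q : Module.End ℂ ((S ⊗[ℂ] S) ⊗[ℂ] S) := ∑ i, ∑ j, π i j •
    TensorProduct.map (TensorProduct.map (d i) LinearMap.id + TensorProduct.map LinearMap.id (d i)) (d j)
  let Q' : Module.End ℂ (S ⊗[ℂ] (S ⊗[ℂ] S)) := ∑ i, ∑ j, π i j •
    TensorProduct.map (d i) (TensorProduct.map (d j) LinearMap.id + TensorProduct.map LinearMap.id (d j))
  let R : Module.End ℂ ((S ⊗[ℂ] S) ⊗[ℂ] S) := TensorProduct.map P LinearMap.id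
  let R' : Module.End ℂ (S ⊗[ℂ] (S ⊗[ℂ] S)) := TensorProduct.map LinearMap.id P
  have hQ : P ∘ₗ TensorProduct.map μ LinearMap.id = TensorProduct.map μ LinearMap.id ∘ₗ Q := by
    ext a b c
    simp [P, Q, μ, d, bidiffOp, map_sum, TensorProduct.add_tmul, mul_comm, add_comm]
  have hQ' : P ∘ₗ TensorProduct.map LinearMap.id μ = TensorProduct.map LinearMap.id μ ∘ₗ Q' := by
    ext a b c
    simp [P, Q', μ, d, bidiffOp, map_sum, TensorProduct.tmul_add, mul_comm, add_comm]
  have hc : Commute Q R := by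
    have hR : R = ∑ k, ∑ l, π k l • TensorProduct.map (TensorProduct.map (d k) (d l)) LinearMap.id := by
      ext a b c
      simp [P, R, d, bidiffOp, LinearMap.sum_apply, TensorProduct.sum_tmul, TensorProduct.smul_tmul']
    rw [hR]
    refine Commute.sum_left _ _ _ fun i _ => Commute.sum_left _ _ _ fun j _ =>
      Commute.sum_right _ _ _ fun k _ => Commute.sum_right _ _ _ fun l _ =>
      (Commute.smul_right (Commute.smul_left ?_ _) _)
    change _ ∘ₗ _ = _ ∘ₗ _
    ext a b c
    simp [d, TensorProduct.add_tmul, hD i k, hD i l]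
  have hc' : Commute Q' R' := by
    have hR : R' = ∑ k, ∑ l, π k l • TensorProduct.map LinearMap.id (TensorProduct.map (d k) (d l)) := by
      ext a b c
      simp [P, R', d, bidiffOp, LinearMap.sum_apply, TensorProduct.tmul_sum]
    rw [hR]
    refine Commute.sum_left _ _ _ fun i _ => Commute.sum_left _ _ _ fun j _ =>
      Commute.sum_right _ _ _ fun k _ => Commute.sum_right _ _ _ fun l _ =>
      (Commute.smul_right (Commute.smul_left ?_ _) _)
    change _ ∘ₗ _ = _ ∘ₗ _
    ext a b c
    simp [d, TensorProduct.tmul_add, hD j k, hD j l]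
  let α := (TensorProduct.assoc ℂ S S S : (S ⊗[ℂ] S) ⊗[ℂ] S →ₗ[ℂ] S ⊗[ℂ] (S ⊗[ℂ] S))
  have hα : α ∘ₗ (Q + R) = (Q' + R') ∘ₗ α := by
    ext a b c
    simp [P, Q, R, Q', R', α, d, bidiffOp, LinearMap.sum_apply, map_sum, TensorProduct.add_tmul, TensorProduct.sum_tmul, TensorProduct.tmul_add, TensorProduct.tmul_sum, ← TensorProduct.smul_tmul', TensorProduct.tmul_smul, Finset.sum_add_distrib]
    abel
  have hμ : μ ∘ₗ TensorProduct.map LinearMap.id μ ∘ₗ α = μ ∘ₗ TensorProduct.map μ LinearMap.id := by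
    ext a b c
    simp [μ, α, mul_assoc]
  have hQr : ∀ r x, (P ^ r) (TensorProduct.map μ LinearMap.id x) = TensorProduct.map μ LinearMap.id ((Q ^ r) x) := by
    intro r
    induction r with
    | zero => simp
    | succ r ih => intro x; rw [pow_succ, pow_succ, Module.End.mul_apply, Module.End.mul_apply, ← ih]; congr 1; exact LinearMap.congr_fun hQ x
  have hQr' : ∀ r x, (P ^ r) (TensorProduct.map LinearMap.id μ x) = TensorProduct.map LinearMap.id μ ((Q' ^ r) x) := by
    intro r
    induction r with
    | zero => simp
    | succ r ih => intro x; rw [pow_succ, pow_succ, Module.End.mul_apply, Module.End.mul_apply, ← ih]; congr 1; exact LinearMap.congr_fun hQ' x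
  have hαr : ∀ r x, α (((Q + R) ^ r) x) = ((Q' + R') ^ r) (α x) := by
    intro r
    induction r with
    | zero => simp
    | succ r ih => intro x; rw [pow_succ, pow_succ, Module.End.mul_apply, Module.End.mul_apply, ih]; congr 1; exact LinearMap.congr_fun hα x
  have hRr : ∀ r (x : S ⊗[ℂ] S) c, (R ^ r) (x ⊗ₜ c) = ((P ^ r) x) ⊗ₜ c := by
    intro r
    induction r with
    | zero => simp
    | succ r ih => intro x c; rw [pow_succ, pow_succ, Module.End.mul_apply, Module.End.mul_apply, ← ih]; rfl
  have hRr' : ∀ r (x : S ⊗[ℂ] S) c, (R' ^ r) (c ⊗ₜ x) = c ⊗ₜ ((P ^ r) x) := by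
    intro r
    induction r with
    | zero => simp
    | succ r ih => intro x c; rw [pow_succ, pow_succ, Module.End.mul_apply, Module.End.mul_apply, ← ih]; rfl
  have key : ∀ {V : Type _} [AddCommGroup V] [Module ℂ V] (A B : Module.End ℂ V), Commute A B →
      ∑ p ∈ Finset.HasAntidiagonal.antidiagonal N, ((p.1.factorial : ℂ)⁻¹ * (p.2.factorial : ℂ)⁻¹) •
        (A ^ p.1 * B ^ p.2) = (N.factorial : ℂ)⁻¹ • (A + B) ^ N := by
    intro V _ _ A B hAB
    rw [hAB.add_pow', Finset.smul_sum]
    refine Finset.sum_congr rfl fun p hp => ?_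
    rw [← Nat.cast_smul_eq_nsmul ℂ, smul_smul]
    congr 1
    rw [Finset.HasAntidiagonal.mem_antidiagonal] at hp
    subst hp
    have := Nat.choose_mul_factorial_mul_factorial (Nat.le_add_right p.1 p.2)
    rw [Nat.add_sub_cancel_left] at this
    have h1 : (p.1.factorial : ℂ) ≠ 0 := by exact_mod_cast p.1.factorial_ne_zero
    have h2 : (p.2.factorial : ℂ) ≠ 0 := by exact_mod_cast p.2.factorial_ne_zero
    have h3 : ((p.1 + p.2).factorial : ℂ) ≠ 0 := by exact_mod_cast (p.1 + p.2).factorial_ne_zero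
    have h4 : (((p.1 + p.2).choose p.1 : ℕ) : ℂ) * p.1.factorial * p.2.factorial = (p.1 + p.2).factorial := by
      exact_mod_cast this
    field_simp
    linear_combination - h4
  have hL : ∀ r s, contraction D π r (contraction D π s f g) h =
      (μ ∘ₗ TensorProduct.map μ LinearMap.id) ((Q ^ r * R ^ s) ((f ⊗ₜ g) ⊗ₜ h)) := by
    intro r s
    rw [Module.End.mul_apply, hRr, LinearMap.comp_apply, ← hQr]
    rfl
  have hR : ∀ r s, contraction D π r f (contraction D π s g h) =
      (μ ∘ₗ TensorProduct.map LinearMap.id μ) ((Q' ^ r * R' ^ s) (f ⊗ₜ (g ⊗ₜ h))) := by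
    intro r s
    rw [Module.End.mul_apply, hRr', LinearMap.comp_apply, ← hQr']
    rfl
  have hL' := LinearMap.congr_fun (key Q R hc) ((f ⊗ₜ g) ⊗ₜ h)
  have hR' := LinearMap.congr_fun (key Q' R' hc') (f ⊗ₜ (g ⊗ₜ h))
  simp only [LinearMap.sum_apply, LinearMap.smul_apply, ← map_smul] at hL' hR'
  simp only [hL, hR]
  simp only [← map_smul, ← map_sum]
  rw [hL', hR', ← hμ]
  simp only [LinearMap.comp_apply, map_smul, hαr]
  rfl
end Generic

section FormalFunctions
variable (E : Type*) [NormedAddCommGroup E] [NormedSpace ℝ E]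

/-- Formal power series on `E`: sequences `(f_k)` of smooth functions `E → ℂ` such that `f_k` is
homogeneous of degree `k`. A smooth function which is homogeneous of degree `k` is the same thing as
a homogeneous polynomial of degree `k`, so this is the completed symmetric algebra of the
complexified dual of `E`. The product is the Cauchy product. -/
noncomputable def formalFunctionsSubalgebra : Subalgebra ℂ (PowerSeries (E → ℂ)) where
  carrier := {f | ∀ k, ContDiff ℝ ∞ (PowerSeries.coeff k f) ∧
    ∀ (t : ℝ) (v : E), PowerSeries.coeff k f (t • v) = (t : ℂ) ^ k * PowerSeries.coeff k f v}
  mul_mem' := by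
    intro f g hf hg k
    rw [PowerSeries.coeff_mul]
    refine ⟨?_, fun t v => ?_⟩
    · rw [Finset.sum_fn]
      exact ContDiff.sum fun p _ => (hf p.1).1.mul (hg p.2).1
    · simp only [Finset.sum_apply, Pi.mul_apply, Finset.mul_sum]
      refine Finset.sum_congr rfl fun p hp => ?_
      rw [Finset.HasAntidiagonal.mem_antidiagonal] at hp
      rw [(hf p.1).2, (hg p.2).2, ← hp, pow_add]
      ring
  add_mem' := by
    intro f g hf hg k
    refine ⟨(hf k).1.add (hg k).1, fun t v => ?_⟩
    simp only [map_add, Pi.add_apply, (hf k).2, (hg k).2]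
    ring
  algebraMap_mem' := by
    intro z k
    rw [PowerSeries.algebraMap_apply, PowerSeries.coeff_C]
    split_ifs with hk
    · subst hk
      exact ⟨contDiff_const, fun t v => by simp⟩
    · exact ⟨contDiff_const, fun t v => by simp⟩

/-- The commutative algebra of complex formal power series on `E`. -/
def FormalFunctions : Type _ := formalFunctionsSubalgebra E

noncomputable instance : CommRing (FormalFunctions E) :=
  inferInstanceAs (CommRing (formalFunctionsSubalgebra E))

noncomputable instance : Algebra ℂ (FormalFunctions E) :=
  inferInstanceAs (Algebra ℂ (formalFunctionsSubalgebra E))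

variable {E}

/-- The homogeneous component of degree `k`. -/
noncomputable def hcomp (k : ℕ) (f : FormalFunctions E) : E → ℂ := PowerSeries.coeff k f.1

theorem FormalFunctions.ext {f g : FormalFunctions E} (h : ∀ k v, hcomp k f v = hcomp k g v) :
    f = g :=
  Subtype.ext (PowerSeries.ext fun k => funext (h k))

theorem contDiff_hcomp (k : ℕ) (f : FormalFunctions E) : ContDiff ℝ ∞ (hcomp k f) := (f.2 k).1

theorem differentiableAt_hcomp (k : ℕ) (f : FormalFunctions E) (v : E) :
    DifferentiableAt ℝ (hcomp k f) v := (contDiff_hcomp k f).contDiffAt.differentiableAt (by simp)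

theorem hcomp_smul (k : ℕ) (f : FormalFunctions E) (t : ℝ) (v : E) :
    hcomp k f (t • v) = (t : ℂ) ^ k * hcomp k f v := (f.2 k).2 t v

theorem hcomp_add (k : ℕ) (f g : FormalFunctions E) :
    hcomp k (f + g) = hcomp k f + hcomp k g := rfl

theorem hcomp_zero (k : ℕ) : hcomp k (0 : FormalFunctions E) = 0 := rfl

theorem hcomp_csmul (k : ℕ) (z : ℂ) (f : FormalFunctions E) :
    hcomp k (z • f) = z • hcomp k f := rfl

theorem hcomp_sum {ι : Type*} (s : Finset ι) (k : ℕ) (f : ι → FormalFunctions E) :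
    hcomp k (∑ i ∈ s, f i) = ∑ i ∈ s, hcomp k (f i) := by
  exact map_sum ((PowerSeries.coeff k).toAddMonoidHom.comp
    (formalFunctionsSubalgebra E).val.toAddMonoidHom) f s

theorem hcomp_mul (k : ℕ) (f g : FormalFunctions E) :
    hcomp k (f * g) =
      ∑ p ∈ Finset.HasAntidiagonal.antidiagonal k, hcomp p.1 f * hcomp p.2 g :=
  PowerSeries.coeff_mul _ _ _

theorem hcomp_algebraMap (k : ℕ) (z : ℂ) :
    hcomp k (algebraMap ℂ (FormalFunctions E) z) = fun _ => if k = 0 then z else 0 := by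
  change PowerSeries.coeff k (algebraMap ℂ (PowerSeries (E → ℂ)) z) = _
  rw [PowerSeries.algebraMap_apply, PowerSeries.coeff_C]
  split_ifs <;> rfl

theorem hcomp_degree_zero (f : FormalFunctions E) (v : E) : hcomp 0 f v = hcomp 0 f 0 := by
  simpa using (hcomp_smul 0 f 0 v).symm

theorem fderiv_hcomp_smul (k : ℕ) (f : FormalFunctions E) (t : ℝ) (v w : E) :
    fderiv ℝ (hcomp (k + 1) f) (t • v) w = (t : ℂ) ^ k * fderiv ℝ (hcomp (k + 1) f) v w := by
  have hc : Continuous fun v => fderiv ℝ (hcomp (k + 1) f) v w :=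
    ((contDiff_hcomp (k + 1) f).continuous_fderiv (by simp)).clm_apply continuous_const
  have h : ∀ t : ℝ, t ≠ 0 → fderiv ℝ (hcomp (k + 1) f) (t • v) w =
      (t : ℂ) ^ k * fderiv ℝ (hcomp (k + 1) f) v w := by
    intro t ht
    have h1 : HasFDerivAt (fun v => hcomp (k + 1) f (t • v))
        ((fderiv ℝ (hcomp (k + 1) f) (t • v)).comp (t • ContinuousLinearMap.id ℝ E)) v :=
      (differentiableAt_hcomp (k + 1) f (t • v)).hasFDerivAt.comp v
        ((hasFDerivAt_id v).const_smul t)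
    have h2 : HasFDerivAt (fun v => hcomp (k + 1) f (t • v))
        (((t : ℂ) ^ (k + 1)) • fderiv ℝ (hcomp (k + 1) f) v) v := by
      have := (differentiableAt_hcomp (k + 1) f v).hasFDerivAt.const_mul ((t : ℂ) ^ (k + 1))
      refine this.congr_of_eventuallyEq (Filter.Eventually.of_forall fun u => ?_)
      exact hcomp_smul (k + 1) f t u
    have h3 := DFunLike.congr_fun (h1.unique h2) w
    have ht' : (t : ℂ) ≠ 0 := by exact_mod_cast ht
    simp only [ContinuousLinearMap.comp_apply, smul_apply,
      ContinuousLinearMap.id_apply, map_smul, Complex.real_smul, smul_eq_mul] at h3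
    apply mul_left_cancel₀ ht'
    rw [h3, pow_succ]
    ring
  have := Continuous.ext_on (dense_compl_singleton (0 : ℝ))
    (f := fun t : ℝ => fderiv ℝ (hcomp (k + 1) f) (t • v) w)
    (g := fun t : ℝ => (t : ℂ) ^ k * fderiv ℝ (hcomp (k + 1) f) v w)
    (hc.comp (continuous_id.smul continuous_const)) (by fun_prop) (fun t ht => h t ht)
  exact congrFun this t

/-- The partial derivative in the direction `w`; it lowers the degree by one. -/
noncomputable def pdFun (w : E) (f : FormalFunctions E) : FormalFunctions E :=
  ⟨PowerSeries.mk fun k v => fderiv ℝ (hcomp (k + 1) f) v w, fun k => by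
    rw [PowerSeries.coeff_mk]
    exact ⟨((contDiff_hcomp (k + 1) f).fderiv_right (m := ∞) (by simp)).clm_apply
      contDiff_const, fun t v => fderiv_hcomp_smul k f t v w⟩⟩

theorem hcomp_pdFun (w : E) (k : ℕ) (f : FormalFunctions E) (v : E) :
    hcomp k (pdFun w f) v = fderiv ℝ (hcomp (k + 1) f) v w := by
  simp [pdFun, hcomp]

theorem pdFun_mul (w : E) (f g : FormalFunctions E) :
    pdFun w (f * g) = f * pdFun w g + g * pdFun w f := by
  refine FormalFunctions.ext fun k v => ?_
  have hd := fun j (f : FormalFunctions E) => (differentiableAt_hcomp j f v)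
  have h0 : ∀ f : FormalFunctions E, fderiv ℝ (hcomp 0 f) v = 0 := fun f => by
    rw [show hcomp 0 f = fun _ => hcomp 0 f 0 from funext (hcomp_degree_zero f)]
    simp
  have h1 : fderiv ℝ (hcomp (k + 1) (f * g)) v w =
      ∑ p ∈ Finset.HasAntidiagonal.antidiagonal (k + 1),
        hcomp p.1 f v * fderiv ℝ (hcomp p.2 g) v w +
      ∑ p ∈ Finset.HasAntidiagonal.antidiagonal (k + 1),
        hcomp p.2 g v * fderiv ℝ (hcomp p.1 f) v w := by
    rw [hcomp_mul, fderiv_sum fun p _ => (hd p.1 f).mul (hd p.2 g), sum_apply,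
      ← Finset.sum_add_distrib]
    refine Finset.sum_congr rfl fun p _ => ?_
    rw [fderiv_mul (hd p.1 f) (hd p.2 g)]
    rfl
  rw [hcomp_pdFun, h1, hcomp_add, hcomp_mul, hcomp_mul, Finset.Nat.sum_antidiagonal_succ',
    Finset.Nat.sum_antidiagonal_succ]
  simp only [h0, Pi.add_apply, Finset.sum_apply, Pi.mul_apply, hcomp_pdFun,
    zero_apply, mul_zero, zero_add]
  rw [add_right_inj, ← Finset.Nat.sum_antidiagonal_swap]
  rfl

/-- The partial derivative in the direction `w`, as a derivation. -/
noncomputable def pd (w : E) : Derivation ℂ (FormalFunctions E) (FormalFunctions E) :=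
  Derivation.mk'
    { toFun := pdFun w
      map_add' := fun f g => FormalFunctions.ext fun k v => by
        rw [hcomp_add, Pi.add_apply, hcomp_pdFun, hcomp_pdFun, hcomp_pdFun, hcomp_add,
          fderiv_add (differentiableAt_hcomp (k + 1) f v) (differentiableAt_hcomp (k + 1) g v)]
        rfl
      map_smul' := fun z f => FormalFunctions.ext fun k v => by
        rw [RingHom.id_apply, hcomp_csmul, Pi.smul_apply, hcomp_pdFun, hcomp_pdFun, hcomp_csmul,
          fderiv_const_smul (differentiableAt_hcomp (k + 1) f v) z]
        rfl }
    (pdFun_mul w)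

theorem hcomp_pd (w : E) (k : ℕ) (f : FormalFunctions E) (v : E) :
    hcomp k (pd w f) v = fderiv ℝ (hcomp (k + 1) f) v w :=
  hcomp_pdFun w k f v

theorem pd_comm (w w' : E) (f : FormalFunctions E) : pd w (pd w' f) = pd w' (pd w f) := by
  refine FormalFunctions.ext fun k v => ?_
  have h : ∀ w w', hcomp k (pd w (pd w' f)) v =
      fderiv ℝ (fderiv ℝ (hcomp (k + 2) f)) v w w' := by
    intro w w'
    rw [hcomp_pd, show hcomp (k + 1) (pd w' f) = fun v => fderiv ℝ (hcomp (k + 2) f) v w' from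
      funext fun v => hcomp_pd w' (k + 1) f v]
    rw [fderiv_clm_apply (((contDiff_hcomp (k + 2) f).fderiv_right (m := ∞)
      (by simp)).contDiffAt.differentiableAt (by simp)) (by fun_prop)]
    simp
  rw [h, h]
  exact ((contDiff_hcomp (k + 2) f).contDiffAt.isSymmSndFDerivAt (by simp; exact ENat.LEInfty.out)) w w'

end FormalFunctions

section WeylAlgebra

/-- The model space `ℝᵐ`. -/
abbrev Model (m : ℕ) : Type := EuclideanSpace ℝ (Fin m)

theorem sum_reindex_left {A : Type*} [AddCommMonoid A] (F : ℕ → ℕ → ℕ → ℕ → ℕ → A) (N : ℕ) :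
    ∑ p ∈ Finset.HasAntidiagonal.antidiagonal N, ∑ q ∈ Finset.HasAntidiagonal.antidiagonal p.2,
      ∑ p' ∈ Finset.HasAntidiagonal.antidiagonal q.1,
        ∑ q' ∈ Finset.HasAntidiagonal.antidiagonal p'.2, F p.1 p'.1 q'.1 q'.2 q.2 =
    ∑ t ∈ Finset.HasAntidiagonal.antidiagonal N, ∑ u ∈ Finset.HasAntidiagonal.antidiagonal t.2,
      ∑ w ∈ Finset.HasAntidiagonal.antidiagonal u.2,
        ∑ p ∈ Finset.HasAntidiagonal.antidiagonal t.1, F p.1 p.2 u.1 w.1 w.2 := by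
  simp only [Finset.sum_sigma']
  refine Finset.sum_nbij'
    (fun x => ⟨(x.1.1 + x.2.2.1.1, x.2.2.2.1 + (x.2.2.2.2 + x.2.1.2)),
      (x.2.2.2.1, x.2.2.2.2 + x.2.1.2), (x.2.2.2.2, x.2.1.2), (x.1.1, x.2.2.1.1)⟩)
    (fun y => ⟨(y.2.2.2.1, y.2.2.2.2 + (y.2.1.1 + y.2.2.1.1) + y.2.2.1.2),
      (y.2.2.2.2 + (y.2.1.1 + y.2.2.1.1), y.2.2.1.2), (y.2.2.2.2, y.2.1.1 + y.2.2.1.1),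
      (y.2.1.1, y.2.2.1.1)⟩) ?_ ?_ ?_ ?_ (fun _ _ => rfl)
  all_goals
    rintro ⟨⟨a, b⟩, ⟨c, d⟩, ⟨e, f⟩, ⟨g, h⟩⟩ hx
    simp only [Finset.mem_sigma, Finset.HasAntidiagonal.mem_antidiagonal] at hx
  · simp only [Finset.mem_sigma, Finset.HasAntidiagonal.mem_antidiagonal, and_true]
    omega
  · simp only [Finset.mem_sigma, Finset.HasAntidiagonal.mem_antidiagonal, and_true]
    omega
  · obtain ⟨h1, h2, h3, h4⟩ := hx
    subst h4
    subst h3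
    subst h2
    simp
  · obtain ⟨h1, h2, h3, h4⟩ := hx
    subst h4
    subst h3
    subst h2
    simp

theorem sum_reindex_right {A : Type*} [AddCommMonoid A] (F : ℕ → ℕ → ℕ → ℕ → ℕ → A) (N : ℕ) :
    ∑ p ∈ Finset.HasAntidiagonal.antidiagonal N, ∑ q ∈ Finset.HasAntidiagonal.antidiagonal p.2,
      ∑ p' ∈ Finset.HasAntidiagonal.antidiagonal q.2,
        ∑ q' ∈ Finset.HasAntidiagonal.antidiagonal p'.2, F p.1 p'.1 q.1 q'.1 q'.2 =
    ∑ t ∈ Finset.HasAntidiagonal.antidiagonal N, ∑ u ∈ Finset.HasAntidiagonal.antidiagonal t.2,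
      ∑ w ∈ Finset.HasAntidiagonal.antidiagonal u.2,
        ∑ p ∈ Finset.HasAntidiagonal.antidiagonal t.1, F p.1 p.2 u.1 w.1 w.2 := by
  simp only [Finset.sum_sigma']
  refine Finset.sum_nbij'
    (fun x => ⟨(x.1.1 + x.2.2.1.1, x.2.1.1 + (x.2.2.2.1 + x.2.2.2.2)),
      (x.2.1.1, x.2.2.2.1 + x.2.2.2.2), (x.2.2.2.1, x.2.2.2.2), (x.1.1, x.2.2.1.1)⟩)
    (fun y => ⟨(y.2.2.2.1, y.2.1.1 + (y.2.2.2.2 + (y.2.2.1.1 + y.2.2.1.2))),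
      (y.2.1.1, y.2.2.2.2 + (y.2.2.1.1 + y.2.2.1.2)), (y.2.2.2.2, y.2.2.1.1 + y.2.2.1.2),
      (y.2.2.1.1, y.2.2.1.2)⟩) ?_ ?_ ?_ ?_ (fun _ _ => rfl)
  all_goals
    rintro ⟨⟨a, b⟩, ⟨c, d⟩, ⟨e, f⟩, ⟨g, h⟩⟩ hx
    simp only [Finset.mem_sigma, Finset.HasAntidiagonal.mem_antidiagonal] at hx
  · simp only [Finset.mem_sigma, Finset.HasAntidiagonal.mem_antidiagonal, and_true]
    omega
  · simp only [Finset.mem_sigma, Finset.HasAntidiagonal.mem_antidiagonal, and_true]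
    omega
  · obtain ⟨h1, h2, h3, h4⟩ := hx
    subst h4
    subst h3
    subst h2
    simp
  · obtain ⟨h1, h2, h3, h4⟩ := hx
    subst h4
    subst h3
    subst h2
    simp

variable {m : ℕ}

/-- The standard basis vectors of the model space. -/
noncomputable def stdVec (i : Fin m) : Model m := EuclideanSpace.single i 1

/-- The matrix `σ(eᵢ, eⱼ)` of a bilinear form. -/
noncomputable def gramMatrix (σ : Model m →L[ℝ] Model m →L[ℝ] ℝ) :
    Matrix (Fin m) (Fin m) ℝ := Matrix.of fun i j => σ (stdVec i) (stdVec j)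

/-- The matrix `π` of the form `σ̄` on covectors that corresponds to `σ` under `v ↦ σ(v, -)`: the
covector `σ(v, -)` has coordinates `Gᵀ v`, where `G` is the matrix of `σ`, so
`σ̄(α, β) = ∑ᵢⱼ πⁱʲ αᵢ βⱼ` with `π = (Gᵀ)⁻¹`. -/
noncomputable def poissonMatrix (σ : Model m →L[ℝ] Model m →L[ℝ] ℝ) :
    Matrix (Fin m) (Fin m) ℝ := ((gramMatrix σ).transpose)⁻¹

/-- The bilinear map `(f, g) ↦ ∑ π^{i₁j₁} ⋯ π^{iᵣjᵣ} (∂_{i₁} ⋯ ∂_{iᵣ} f) (∂_{j₁} ⋯ ∂_{jᵣ} g)`. -/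
noncomputable def poissonContraction
    (σ : Model m →L[ℝ] Model m →L[ℝ] ℝ) (r : ℕ) :
    FormalFunctions (Model m) →ₗ[ℂ]
      FormalFunctions (Model m) →ₗ[ℂ]
        FormalFunctions (Model m) :=
  contraction (fun i => pd (stdVec i)) (fun i j => (poissonMatrix σ i j : ℂ)) r

/-- The formal Weyl algebra of a symplectic vector space, as formal power series in `ħ` and in the
linear coordinates, with the Moyal product
`a * b = ∑ᵣ (iħ/2)ʳ / r! ∑ π^{i₁j₁} ⋯ π^{iᵣjᵣ} (∂_{i₁} ⋯ ∂_{iᵣ} a) (∂_{j₁} ⋯ ∂_{jᵣ} b)`.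
Covectors satisfy `α * β - β * α = iħ σ̄(α, β)`. -/
def WeylFiber (_σ : Model m →L[ℝ] Model m →L[ℝ] ℝ) : Type :=
  PowerSeries (FormalFunctions (Model m))

namespace WeylFiber
variable {σ : Model m →L[ℝ] Model m →L[ℝ] ℝ}

noncomputable instance : AddCommGroup (WeylFiber σ) :=
  inferInstanceAs (AddCommGroup (PowerSeries (FormalFunctions (Model m))))

/-- The coefficient of `ħˡ`. -/
noncomputable def hbarCoeff (l : ℕ) :
    WeylFiber σ →+ FormalFunctions (Model m) :=
  (PowerSeries.coeff (R := FormalFunctions (Model m)) l).toAddMonoidHom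

theorem ext {a b : WeylFiber σ} (h : ∀ l, hbarCoeff l a = hbarCoeff l b) : a = b :=
  PowerSeries.ext h

/-- The element with given coefficients of the powers of `ħ`. -/
noncomputable def ofCoeff (f : ℕ → FormalFunctions (Model m)) : WeylFiber σ :=
  PowerSeries.mk f

theorem hbarCoeff_ofCoeff (f : ℕ → FormalFunctions (Model m)) (l : ℕ) :
    hbarCoeff l (ofCoeff f : WeylFiber σ) = f l := PowerSeries.coeff_mk _ _

/-- The Moyal product. -/
noncomputable instance : Mul (WeylFiber σ) where
  mul a b := ofCoeff fun l =>
    ∑ p ∈ Finset.HasAntidiagonal.antidiagonal l, ∑ q ∈ Finset.HasAntidiagonal.antidiagonal p.2,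
      (((Complex.I / 2) ^ p.1 * (p.1.factorial : ℂ)⁻¹)) •
        poissonContraction σ p.1 (hbarCoeff q.1 a) (hbarCoeff q.2 b)

theorem hbarCoeff_mul (a b : WeylFiber σ) (l : ℕ) :
    hbarCoeff l (a * b) =
      ∑ p ∈ Finset.HasAntidiagonal.antidiagonal l, ∑ q ∈ Finset.HasAntidiagonal.antidiagonal p.2,
        (((Complex.I / 2) ^ p.1 * (p.1.factorial : ℂ)⁻¹)) •
          poissonContraction σ p.1 (hbarCoeff q.1 a) (hbarCoeff q.2 b) :=
  hbarCoeff_ofCoeff _ _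

/-- The inclusion of the scalars `ℂ⟦ħ⟧`. -/
noncomputable def scalar (z : PowerSeries ℂ) : WeylFiber σ :=
  ofCoeff fun l => algebraMap ℂ _ (PowerSeries.coeff l z)

noncomputable instance : One (WeylFiber σ) := ⟨scalar 1⟩

theorem hbarCoeff_scalar_mul (z : PowerSeries ℂ) (a : WeylFiber σ) (l : ℕ) :
    hbarCoeff l (scalar z * a) = ∑ q ∈ Finset.HasAntidiagonal.antidiagonal l,
      PowerSeries.coeff q.1 z • hbarCoeff q.2 a := by
  rw [hbarCoeff_mul, Finset.sum_eq_single (0, l)]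
  · simp [poissonContraction, contraction_zero, scalar, hbarCoeff_ofCoeff, Algebra.smul_def]
  · rintro ⟨r, s⟩ hp hne
    obtain _ | r := r
    · simp_all
    · simp [poissonContraction, scalar, hbarCoeff_ofCoeff, contraction_algebraMap_left]
  · simp

theorem hbarCoeff_mul_scalar (z : PowerSeries ℂ) (a : WeylFiber σ) (l : ℕ) :
    hbarCoeff l (a * scalar z) = ∑ q ∈ Finset.HasAntidiagonal.antidiagonal l,
      PowerSeries.coeff q.2 z • hbarCoeff q.1 a := by
  rw [hbarCoeff_mul, Finset.sum_eq_single (0, l)]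
  · simp [poissonContraction, contraction_zero, scalar, hbarCoeff_ofCoeff, Algebra.smul_def, mul_comm]
  · rintro ⟨r, s⟩ hp hne
    obtain _ | r := r
    · simp_all
    · simp [poissonContraction, scalar, hbarCoeff_ofCoeff, contraction_algebraMap_right]
  · simp

theorem scalar_mul_comm (z : PowerSeries ℂ) (a : WeylFiber σ) : scalar z * a = a * scalar z := by
  refine ext fun l => ?_
  rw [hbarCoeff_scalar_mul, hbarCoeff_mul_scalar, ← Finset.Nat.sum_antidiagonal_swap]
  rfl

theorem poissonContraction_assoc (K : ℕ) (f g h : FormalFunctions (Model m)) :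
    ∑ p ∈ Finset.HasAntidiagonal.antidiagonal K,
      (((Complex.I / 2) ^ p.1 * (p.1.factorial : ℂ)⁻¹) *
        ((Complex.I / 2) ^ p.2 * (p.2.factorial : ℂ)⁻¹)) •
        poissonContraction σ p.1 (poissonContraction σ p.2 f g) h =
    ∑ p ∈ Finset.HasAntidiagonal.antidiagonal K,
      (((Complex.I / 2) ^ p.1 * (p.1.factorial : ℂ)⁻¹) *
        ((Complex.I / 2) ^ p.2 * (p.2.factorial : ℂ)⁻¹)) •
        poissonContraction σ p.1 f (poissonContraction σ p.2 g h) := by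
  have h1 := congrArg (fun x => (Complex.I / 2) ^ K • x)
    (contraction_assoc (fun i : Fin m => pd (stdVec i))
      (fun i j => (poissonMatrix σ i j : ℂ)) (fun i j f => pd_comm _ _ f) K f g h)
  simp only [Finset.smul_sum, smul_smul] at h1
  convert h1 using 2 with p hp p hp
  all_goals
    rw [Finset.HasAntidiagonal.mem_antidiagonal] at hp
    rw [← hp, pow_add]
    simp only [poissonContraction]
    congr 1
    ring

protected theorem mul_assoc (a b c : WeylFiber σ) : a * b * c = a * (b * c) := by
  refine ext fun N => ?_
  simp only [hbarCoeff_mul, map_sum, LinearMap.sum_apply, map_smul, LinearMap.smul_apply,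
    Finset.smul_sum, smul_smul]
  rw [sum_reindex_left fun r s i j k => (((Complex.I / 2) ^ r * (r.factorial : ℂ)⁻¹) *
        ((Complex.I / 2) ^ s * (s.factorial : ℂ)⁻¹)) •
        poissonContraction σ r (poissonContraction σ s (hbarCoeff i a) (hbarCoeff j b))
          (hbarCoeff k c),
    sum_reindex_right fun r s i j k => (((Complex.I / 2) ^ r * (r.factorial : ℂ)⁻¹) *
        ((Complex.I / 2) ^ s * (s.factorial : ℂ)⁻¹)) •
        poissonContraction σ r (hbarCoeff i a) (poissonContraction σ s (hbarCoeff j b)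
          (hbarCoeff k c))]
  exact Finset.sum_congr rfl fun t _ => Finset.sum_congr rfl fun u _ =>
    Finset.sum_congr rfl fun w _ => poissonContraction_assoc t.1 _ _ _

noncomputable instance : Ring (WeylFiber σ) where
  left_distrib a b c := ext fun l => by
    simp only [hbarCoeff_mul, map_add, smul_add, Finset.sum_add_distrib]
  right_distrib a b c := ext fun l => by
    simp only [hbarCoeff_mul, map_add, LinearMap.add_apply, smul_add, Finset.sum_add_distrib]
  zero_mul a := ext fun l => by simp [hbarCoeff_mul]
  mul_zero a := ext fun l => by simp [hbarCoeff_mul]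
  mul_assoc := WeylFiber.mul_assoc
  one_mul a := ext fun l => by
    refine (hbarCoeff_scalar_mul 1 a l).trans ?_
    rw [Finset.sum_eq_single (0, l)]
    · simp
    · rintro ⟨r, s⟩ hp hne
      obtain _ | r := r
      · simp_all
      · simp [PowerSeries.coeff_one]
    · simp
  mul_one a := ext fun l => by
    refine (hbarCoeff_mul_scalar 1 a l).trans ?_
    rw [Finset.sum_eq_single (l, 0)]
    · simp
    · rintro ⟨r, s⟩ hp hne
      obtain _ | s := s
      · simp_all
      · simp [PowerSeries.coeff_one]
    · simp
  neg_add_cancel := neg_add_cancel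
  sub_eq_add_neg := sub_eq_add_neg
  zsmul := (inferInstance : AddCommGroup (WeylFiber σ)).zsmul
  zsmul_zero' := (inferInstance : AddCommGroup (WeylFiber σ)).zsmul_zero'
  zsmul_succ' := (inferInstance : AddCommGroup (WeylFiber σ)).zsmul_succ'
  zsmul_neg' := (inferInstance : AddCommGroup (WeylFiber σ)).zsmul_neg'

/-- The inclusion of the scalars as a ring homomorphism. -/
noncomputable def scalarHom : PowerSeries ℂ →+* WeylFiber σ where
  toFun := scalar
  map_one' := rfl
  map_mul' x y := ext fun l => by
    rw [hbarCoeff_scalar_mul]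
    simp only [scalar, hbarCoeff_ofCoeff, PowerSeries.coeff_mul, map_sum, map_mul,
      Algebra.smul_def]
  map_zero' := ext fun l => by simp [scalar, hbarCoeff_ofCoeff]
  map_add' x y := ext fun l => by simp [scalar, hbarCoeff_ofCoeff]

noncomputable instance : Algebra (PowerSeries ℂ) (WeylFiber σ) :=
  scalarHom.toAlgebra' scalar_mul_comm

end WeylFiber
end WeylAlgebra

section Transport
variable {m : ℕ}

/-- Precomposition with a linear map. -/
noncomputable def linPullback (A : Model m →L[ℝ] Model m) (f : FormalFunctions (Model m)) :
    FormalFunctions (Model m) :=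
  ⟨PowerSeries.mk fun k v => hcomp k f (A v), fun k => by
    rw [PowerSeries.coeff_mk]
    exact ⟨(contDiff_hcomp k f).comp A.contDiff, fun t v => by rw [map_smul, hcomp_smul]⟩⟩

theorem hcomp_linPullback (A : Model m →L[ℝ] Model m) (f : FormalFunctions (Model m)) (k : ℕ)
    (v : Model m) : hcomp k (linPullback A f) v = hcomp k f (A v) := by
  simp [linPullback, hcomp]

theorem linPullback_mul (A : Model m →L[ℝ] Model m) (f g : FormalFunctions (Model m)) :
    linPullback A (f * g) = linPullback A f * linPullback A g :=
  FormalFunctions.ext fun k v => by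
    simp [hcomp_linPullback, hcomp_mul]

theorem linPullback_smul (A : Model m →L[ℝ] Model m) (z : ℂ) (f : FormalFunctions (Model m)) :
    linPullback A (z • f) = z • linPullback A f :=
  FormalFunctions.ext fun k v => by
    simp [hcomp_linPullback, hcomp_csmul]

theorem linPullback_sum {ι : Type*} (s : Finset ι) (A : Model m →L[ℝ] Model m)
    (f : ι → FormalFunctions (Model m)) :
    linPullback A (∑ i ∈ s, f i) = ∑ i ∈ s, linPullback A (f i) :=
  FormalFunctions.ext fun k v => by
    simp [hcomp_linPullback, hcomp_sum]

theorem pd_linPullback (A : Model m →L[ℝ] Model m) (w : Model m)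
    (f : FormalFunctions (Model m)) :
    pd w (linPullback A f) = linPullback A (pd (A w) f) :=
  FormalFunctions.ext fun k v => by
    rw [hcomp_pd, hcomp_linPullback, hcomp_pd,
      show hcomp (k + 1) (linPullback A f) = hcomp (k + 1) f ∘ A from
        funext fun v => hcomp_linPullback A f (k + 1) v,
      fderiv_comp v (differentiableAt_hcomp (k + 1) f (A v)) A.differentiableAt]
    simp

theorem pd_sum {ι : Type*} (s : Finset ι) (c : ι → ℝ) (w : ι → Model m)
    (f : FormalFunctions (Model m)) :
    pd (∑ i ∈ s, c i • w i) f = ∑ i ∈ s, (c i : ℂ) • pd (w i) f :=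
  FormalFunctions.ext fun k v => by
    rw [hcomp_pd, map_sum, hcomp_sum, Finset.sum_apply]
    refine Finset.sum_congr rfl fun i _ => ?_
    rw [hcomp_csmul, Pi.smul_apply, hcomp_pd, map_smul, Complex.coe_smul]

theorem sum_stdVec (v : Model m) : ∑ i, v i • stdVec i = v := by
  ext j
  simp [stdVec, Pi.single_apply]

/-- The matrix of a linear map in the standard basis. -/
noncomputable def stdMatrix (A : Model m →L[ℝ] Model m) : Matrix (Fin m) (Fin m) ℝ :=
  Matrix.of fun a i => A (stdVec i) a

theorem bilinear_change_of_basis {V : Type*} [AddCommGroup V] [Module ℂ V]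
    (b : V →ₗ[ℂ] V →ₗ[ℂ] V) (T P P' : Matrix (Fin m) (Fin m) ℝ) (hP : T * P * T.transpose = P')
    (x y : Fin m → V) :
    ∑ i, ∑ j, (P i j : ℂ) • b (∑ k, (T k i : ℂ) • x k) (∑ l, (T l j : ℂ) • y l) =
      ∑ k, ∑ l, (P' k l : ℂ) • b (x k) (y l) := by
  have h1 : ∀ k l, (P' k l : ℂ) = ∑ j, ∑ i, (T k i : ℂ) * (P i j : ℂ) * (T l j : ℂ) := by
    intro k l
    rw [← hP, Matrix.mul_apply]
    simp only [Matrix.mul_apply, Matrix.transpose_apply]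
    push_cast
    simp only [Finset.sum_mul]
  simp only [h1, map_sum, map_smul, LinearMap.sum_apply, LinearMap.smul_apply, Finset.smul_sum,
    Finset.sum_smul, smul_smul]
  have e1 : ∀ F : Fin m → Fin m → Fin m → Fin m → V,
      ∑ i, ∑ j, ∑ k, ∑ l, F i j k l = ∑ k, ∑ l, ∑ j, ∑ i, F i j k l := by
    intro F
    calc _ = ∑ i, ∑ k, ∑ j, ∑ l, F i j k l := by
            exact Finset.sum_congr rfl fun i _ => Finset.sum_comm
      _ = ∑ i, ∑ k, ∑ l, ∑ j, F i j k l := by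
            exact Finset.sum_congr rfl fun i _ => Finset.sum_congr rfl fun k _ => Finset.sum_comm
      _ = ∑ k, ∑ i, ∑ l, ∑ j, F i j k l := Finset.sum_comm
      _ = ∑ k, ∑ l, ∑ i, ∑ j, F i j k l := by
            exact Finset.sum_congr rfl fun i _ => Finset.sum_comm
      _ = _ := by
            exact Finset.sum_congr rfl fun k _ => Finset.sum_congr rfl fun l _ => Finset.sum_comm
  rw [← e1]
  refine Finset.sum_congr rfl fun i _ => Finset.sum_congr rfl fun j _ => ?_
  rw [Finset.sum_comm]
  refine Finset.sum_congr rfl fun k _ => Finset.sum_congr rfl fun l _ => ?_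
  congr 1
  ring

theorem pd_stdVec_linPullback (A : Model m →L[ℝ] Model m) (i : Fin m)
    (f : FormalFunctions (Model m)) :
    pd (stdVec i) (linPullback A f) =
      linPullback A (∑ k, (stdMatrix A k i : ℂ) • pd (stdVec k) f) := by
  rw [pd_linPullback, ← pd_sum]
  exact congrArg (fun w => linPullback A (pd w f)) (sum_stdVec (A (stdVec i))).symm

theorem contraction_linPullback (A : Model m →L[ℝ] Model m) (P P' : Matrix (Fin m) (Fin m) ℝ)
    (hP : stdMatrix A * P * (stdMatrix A).transpose = P') (r : ℕ)
    (f g : FormalFunctions (Model m)) :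
    contraction (fun i => pd (stdVec i)) (fun i j => (P i j : ℂ)) r
        (linPullback A f) (linPullback A g) =
      linPullback A (contraction (fun i => pd (stdVec i)) (fun i j => (P' i j : ℂ)) r f g) := by
  induction r generalizing f g with
  | zero => rw [contraction_zero, contraction_zero, linPullback_mul]
  | succ r ih =>
    rw [contraction_succ, contraction_succ]
    simp only [pd_stdVec_linPullback, ih]
    rw [← bilinear_change_of_basis _ (stdMatrix A) P P' hP, linPullback_sum]
    refine Finset.sum_congr rfl fun i _ => ?_
    rw [linPullback_sum]
    exact Finset.sum_congr rfl fun j _ => (linPullback_smul _ _ _).symm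

theorem gramMatrix_comp (σ : Model m →L[ℝ] Model m →L[ℝ] ℝ) (A : Model m →L[ℝ] Model m) :
    gramMatrix (σ.bilinearComp A A) =
      (stdMatrix A).transpose * gramMatrix σ * stdMatrix A := by
  ext i j
  conv_lhs => rw [gramMatrix, Matrix.of_apply, ContinuousLinearMap.bilinearComp_apply,
    ← sum_stdVec (A (stdVec i)), ← sum_stdVec (A (stdVec j))]
  simp only [Matrix.mul_apply, Matrix.transpose_apply, gramMatrix, stdMatrix, Matrix.of_apply,
    map_sum, map_smul, sum_apply, smul_apply, smul_eq_mul, Finset.sum_mul]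
  refine Finset.sum_congr rfl fun k _ => ?_
  rw [Finset.mul_sum]
  exact Finset.sum_congr rfl fun l _ => by ring

theorem stdMatrix_comp (A B : Model m →L[ℝ] Model m) :
    stdMatrix (A.comp B) = stdMatrix A * stdMatrix B := by
  ext a i
  rw [stdMatrix, Matrix.of_apply, ContinuousLinearMap.comp_apply, ← sum_stdVec (B (stdVec i))]
  simp [Matrix.mul_apply, stdMatrix, mul_comm]

theorem stdMatrix_id : stdMatrix (ContinuousLinearMap.id ℝ (Model m)) = 1 := by
  ext a i
  simp [stdMatrix, stdVec, Matrix.one_apply]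

theorem poissonMatrix_comp (σ : Model m →L[ℝ] Model m →L[ℝ] ℝ) (A B : Model m →L[ℝ] Model m)
    (h : A.comp B = ContinuousLinearMap.id ℝ (Model m)) :
    stdMatrix A * poissonMatrix (σ.bilinearComp A A) * (stdMatrix A).transpose =
      poissonMatrix σ := by
  have h1 : stdMatrix A * stdMatrix B = 1 := by rw [← stdMatrix_comp, h, stdMatrix_id]
  have h2 : stdMatrix A * (stdMatrix A)⁻¹ = 1 := by
    rw [Matrix.inv_eq_right_inv h1, h1]
  have h3 : ((stdMatrix A).transpose)⁻¹ * (stdMatrix A).transpose = 1 := by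
    rw [← Matrix.transpose_nonsing_inv, ← Matrix.transpose_mul, h2, Matrix.transpose_one]
  rw [poissonMatrix, poissonMatrix, gramMatrix_comp]
  simp only [Matrix.transpose_mul, Matrix.transpose_transpose, Matrix.mul_inv_rev]
  calc _ = (stdMatrix A * (stdMatrix A)⁻¹) * (gramMatrix σ).transpose⁻¹ *
      (((stdMatrix A).transpose)⁻¹ * (stdMatrix A).transpose) := by
        simp only [Matrix.mul_assoc]
    _ = _ := by rw [h2, h3, Matrix.one_mul, Matrix.mul_one]

theorem poissonContraction_linPullback (σ : Model m →L[ℝ] Model m →L[ℝ] ℝ)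
    (A B : Model m →L[ℝ] Model m) (h : A.comp B = ContinuousLinearMap.id ℝ (Model m)) (r : ℕ)
    (f g : FormalFunctions (Model m)) :
    linPullback A (poissonContraction σ r f g) =
      poissonContraction (σ.bilinearComp A A) r (linPullback A f) (linPullback A g) :=
  (contraction_linPullback A _ _ (poissonMatrix_comp σ A B h) r f g).symm

end Transport

section Families
variable {m : ℕ} {M : Type*} [TopologicalSpace M] [ChartedSpace (Model m) M]

/-- A family of formal functions, parametrised by `M`, is smooth at `x`. -/
def SmoothFamilyAt (s : M → FormalFunctions (Model m)) (x : M) : Prop :=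
  ∀ (k : ℕ) (v : Model m), ContMDiffAt (𝓘(ℝ, Model m).prod 𝓘(ℝ, Model m)) 𝓘(ℝ, ℂ) ∞
    (fun q : M × Model m => hcomp k (s q.1) q.2) (x, v)

variable {s t : M → FormalFunctions (Model m)} {x : M}

theorem contMDiffAt_mul_complex {N : Type*} {E H : Type*} [NormedAddCommGroup E] [NormedSpace ℝ E]
    [TopologicalSpace H] {J : ModelWithCorners ℝ E H} [TopologicalSpace N] [ChartedSpace H N]
    {f g : N → ℂ} {y : N} (hf : ContMDiffAt J 𝓘(ℝ, ℂ) ∞ f y) (hg : ContMDiffAt J 𝓘(ℝ, ℂ) ∞ g y) :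
    ContMDiffAt J 𝓘(ℝ, ℂ) ∞ (fun z => f z * g z) y :=
  (contDiff_mul (𝕜 := ℝ) (𝔸 := ℂ) (n := ∞)).contDiffAt.contMDiffAt.comp y (hf.prodMk_space hg)

theorem SmoothFamilyAt.mul (hs : SmoothFamilyAt s x) (ht : SmoothFamilyAt t x) :
    SmoothFamilyAt (fun y => s y * t y) x := fun k v => by
  simp only [hcomp_mul, Finset.sum_apply, Pi.mul_apply]
  exact contMDiffAt_finsetSum fun p _ => contMDiffAt_mul_complex (hs p.1 v) (ht p.2 v)

theorem SmoothFamilyAt.sum {ι : Type*} (u : Finset ι) {s : ι → M → FormalFunctions (Model m)}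
    (hs : ∀ i, SmoothFamilyAt (s i) x) : SmoothFamilyAt (fun y => ∑ i ∈ u, s i y) x :=
  fun k v => by
  simp only [hcomp_sum, Finset.sum_apply]
  exact contMDiffAt_finsetSum fun i _ => hs i k v

theorem SmoothFamilyAt.smul {c : M → ℂ} (hc : ContMDiffAt 𝓘(ℝ, Model m) 𝓘(ℝ, ℂ) ∞ c x)
    (hs : SmoothFamilyAt s x) : SmoothFamilyAt (fun y => c y • s y) x := fun k v => by
  simp only [hcomp_csmul, Pi.smul_apply, smul_eq_mul]
  exact contMDiffAt_mul_complex (hc.comp (x, v) contMDiffAt_fst) (hs k v)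

theorem SmoothFamilyAt.pd [IsManifold 𝓘(ℝ, Model m) ∞ M] (hs : SmoothFamilyAt s x) (w : Model m) :
    SmoothFamilyAt (fun y => pd w (s y)) x := fun k v => by
  simp only [hcomp_pd]
  have h1 := ContMDiffAt.mfderiv (I := 𝓘(ℝ, Model m)) (I' := 𝓘(ℝ, ℂ))
    (J := 𝓘(ℝ, Model m).prod 𝓘(ℝ, Model m)) (m := ∞) (n := ∞) (x₀ := (x, v))
    (fun (q : M × Model m) (u : Model m) => hcomp (k + 1) (s q.1) u) (fun q => q.2)
    (ContMDiffAt.comp ((x, v), v) (hs (k + 1) v)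
      ((contMDiffAt_fst.fst).prodMk contMDiffAt_snd)) contMDiffAt_snd (by simp)
  erw [inTangentCoordinates_model_space] at h1
  simp only [mfderiv_eq_fderiv] at h1
  exact h1.clm_apply contMDiffAt_const

theorem SmoothFamilyAt.contraction [IsManifold 𝓘(ℝ, Model m) ∞ M] {P : M → Matrix (Fin m) (Fin m) ℝ}
    (hP : ∀ i j, ContMDiffAt 𝓘(ℝ, Model m) 𝓘(ℝ, ℝ) ∞ (fun y => P y i j) x) (r : ℕ)
    (hs : SmoothFamilyAt s x) (ht : SmoothFamilyAt t x) :
    SmoothFamilyAt (fun y => contraction (fun i => _root_.pd (stdVec i))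
      (fun i j => (P y i j : ℂ)) r (s y) (t y)) x := by
  induction r generalizing s t with
  | zero => simpa only [contraction_zero] using hs.mul ht
  | succ r ih =>
    simp only [contraction_succ]
    refine SmoothFamilyAt.sum _ fun i => SmoothFamilyAt.sum _ fun j => SmoothFamilyAt.smul ?_
      (ih (hs.pd _) (ht.pd _))
    exact ContMDiffAt.comp x (Complex.ofRealCLM.contMDiff.contMDiffAt) (hP i j)

theorem SmoothFamilyAt.congr {s t : M → FormalFunctions (Model m)} {x : M}
    (hs : SmoothFamilyAt s x) (h : ∀ᶠ y in nhds x, t y = s y) : SmoothFamilyAt t x := fun k v =>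
  (hs k v).congr_of_eventuallyEq (by
    filter_upwards [continuous_fst.continuousAt.eventually h] with q hq
    rw [hq])

theorem contMDiffAt_det {N : ℕ} {P : M → Matrix (Fin N) (Fin N) ℝ}
    (hP : ∀ i j, ContMDiffAt 𝓘(ℝ, Model m) 𝓘(ℝ, ℝ) ∞ (fun y => P y i j) x) :
    ContMDiffAt 𝓘(ℝ, Model m) 𝓘(ℝ, ℝ) ∞ (fun y => (P y).det) x := by
  simp only [Matrix.det_apply, Units.smul_def, zsmul_eq_mul]
  exact contMDiffAt_finsetSum fun p _ => contMDiffAt_const.mul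
    (contMDiffAt_finsetProd fun i _ => hP _ _)

theorem contMDiffAt_inv {P : M → Matrix (Fin m) (Fin m) ℝ}
    (hP : ∀ i j, ContMDiffAt 𝓘(ℝ, Model m) 𝓘(ℝ, ℝ) ∞ (fun y => P y i j) x)
    (h0 : (P x).det ≠ 0) (i j : Fin m) :
    ContMDiffAt 𝓘(ℝ, Model m) 𝓘(ℝ, ℝ) ∞ (fun y => (P y)⁻¹ i j) x := by
  simp only [Matrix.inv_def, Ring.inverse_eq_inv', Matrix.smul_apply, smul_eq_mul,
    Matrix.adjugate_apply]
  refine ((contMDiffAt_det hP).inv₀ h0).mul (contMDiffAt_det fun a b => ?_)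
  by_cases h : a = j
  · subst h
    simp only [Matrix.updateRow_self]
    exact contMDiffAt_const
  · simp only [Matrix.updateRow_ne h]
    exact hP a b

theorem gramMatrix_det_ne_zero (σ : Model m →L[ℝ] Model m →L[ℝ] ℝ)
    (h : ∀ v, (∀ w, σ v w = 0) → v = 0) : (gramMatrix σ).det ≠ 0 := by
  intro h0
  obtain ⟨v, hv, hv0⟩ := Matrix.exists_vecMul_eq_zero_iff.2 h0
  apply hv
  have h1 : (∑ i, v i • stdVec i : Model m) = 0 := by
    refine h _ fun w => ?_
    rw [← sum_stdVec w]
    simp only [map_sum, map_smul, sum_apply, smul_apply]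
    refine Finset.sum_eq_zero fun j _ => ?_
    have := congrFun hv0 j
    simp only [Matrix.vecMul, dotProduct, gramMatrix, Matrix.of_apply, Pi.zero_apply] at this
    simp [this]
  have h2 := sum_stdVec (WithLp.toLp 2 v : Model m)
  have h3 : (WithLp.toLp 2 v : Model m) = 0 := h2.symm.trans h1
  funext i
  exact congrArg (fun u : Model m => u i) h3

end Families

section LocalSmoothness
variable {m : ℕ} {M : Type*} [TopologicalSpace M] [ChartedSpace (Model m) M]
  [IsManifold 𝓘(ℝ, Model m) ∞ M]

/-- A family of formal functions on the tangent spaces of `M` is smooth if each of its homogeneous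
components is a smooth function on the total space `TM`. -/
def IsSmoothFamily (s : M → FormalFunctions (Model m)) : Prop :=
  ∀ k, ContMDiff (𝓘(ℝ, Model m).tangent) 𝓘(ℝ, ℂ) ∞
    (fun p : TangentBundle 𝓘(ℝ, Model m) M => hcomp k (s p.1) p.2)

/-- The inverse of the local trivialization of `TM` around `x₀`, on the fibre over `x`. -/
noncomputable def frameMap (x₀ x : M) : Model m →L[ℝ] Model m :=
  (trivializationAt (Model m) (TangentSpace 𝓘(ℝ, Model m)) x₀).symmL ℝ x

/-- The local trivialization of `TM` around `x₀`, on the fibre over `x`. -/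
noncomputable def coframeMap (x₀ x : M) : Model m →L[ℝ] Model m :=
  (trivializationAt (Model m) (TangentSpace 𝓘(ℝ, Model m)) x₀).continuousLinearMapAt ℝ x

theorem frameMap_comp_coframeMap {x₀ x : M}
    (hx : x ∈ (trivializationAt (Model m) (TangentSpace 𝓘(ℝ, Model m)) x₀).baseSet) :
    (frameMap x₀ x).comp (coframeMap x₀ x) = ContinuousLinearMap.id ℝ (Model m) :=
  ContinuousLinearMap.ext fun v =>
    (trivializationAt (Model m) (TangentSpace 𝓘(ℝ, Model m)) x₀).symmL_continuousLinearMapAt hx v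

theorem baseSet_mem_nhds (x₀ : M) :
    (trivializationAt (Model m) (TangentSpace 𝓘(ℝ, Model m)) x₀).baseSet ∈ nhds x₀ :=
  (trivializationAt (Model m) (TangentSpace 𝓘(ℝ, Model m)) x₀).open_baseSet.mem_nhds
    (FiberBundle.mem_baseSet_trivializationAt' x₀)

theorem contMDiffAt_frameMap (x₀ : M) (v : Model m) :
    ContMDiffAt (𝓘(ℝ, Model m).prod 𝓘(ℝ, Model m)) (𝓘(ℝ, Model m).tangent) ∞
      (fun q : M × Model m => (⟨q.1, frameMap x₀ q.1 q.2⟩ : TangentBundle 𝓘(ℝ, Model m) M))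
      (x₀, v) := by
  let e := trivializationAt (Model m) (TangentSpace 𝓘(ℝ, Model m)) x₀
  have h0 : x₀ ∈ e.baseSet := FiberBundle.mem_baseSet_trivializationAt' x₀
  have h1 : (x₀, v) ∈ e.target := e.mem_target.2 h0
  have h2 := ((e.contMDiffOn_symm (IB := 𝓘(ℝ, Model m)) (n := ∞)).contMDiffAt
    (e.open_target.mem_nhds h1))
  refine h2.congr_of_eventuallyEq ?_
  filter_upwards [e.open_target.mem_nhds h1] with q hq
  have hq' : q.1 ∈ e.baseSet := e.mem_target.1 hq
  have := e.mk_symm hq' q.2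
  rw [← e.symmL_apply (R := ℝ) hq'] at this
  exact this

theorem isSmoothFamily_iff (s : M → FormalFunctions (Model m)) :
    IsSmoothFamily s ↔ ∀ x₀, SmoothFamilyAt (fun x => linPullback (frameMap x₀ x) (s x)) x₀ := by
  constructor
  · intro h x₀ k v
    simp only [hcomp_linPullback]
    exact ContMDiffAt.comp (x₀, v) (h k _) (contMDiffAt_frameMap x₀ v)
  · intro h k p
    let e := trivializationAt (Model m) (TangentSpace 𝓘(ℝ, Model m)) p.1
    have h0 : p ∈ e.source := e.mem_source.2 (FiberBundle.mem_baseSet_trivializationAt' p.1)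
    have h1 : ContMDiffAt (𝓘(ℝ, Model m).tangent) (𝓘(ℝ, Model m).prod 𝓘(ℝ, Model m)) ∞ e p :=
      (e.contMDiffOn (IB := 𝓘(ℝ, Model m)) (n := ∞)).contMDiffAt (e.open_source.mem_nhds h0)
    have h2 := h p.1 k (e p).2
    have h3 : (p.1, (e p).2) = e p := Prod.ext (e.coe_fst h0).symm rfl
    rw [h3] at h2
    refine (ContMDiffAt.comp p h2 h1).congr_of_eventuallyEq ?_
    filter_upwards [e.open_source.mem_nhds h0] with q hq
    have hq' : q.1 ∈ e.baseSet := e.mem_source.1 hq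
    have h4 : (e q).1 = q.1 := e.coe_fst hq
    have h5 : (e q).2 = coframeMap p.1 q.1 q.2 :=
      (e.continuousLinearMapAt_apply_of_mem (R := ℝ) hq' q.2).symm
    simp only [Function.comp_apply, hcomp_linPullback]
    rw [h4, h5]
    exact congrArg (hcomp k (s q.1))
      (DFunLike.congr_fun (frameMap_comp_coframeMap hq') q.2).symm

variable (m M) in
/-- A symplectic form on a manifold `M` of dimension `m`: a smooth, alternating, nondegenerate and
closed `2`-form. Closedness is `dσ(X, Y, Z) = 0` for all smooth vector fields, where `dσ` is
expanded through directional derivatives and Lie brackets. -/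
structure SymplecticForm where
  /-- The bilinear form on each tangent space. -/
  toFun : ∀ x : M, TangentSpace 𝓘(ℝ, Model m) x →L[ℝ] TangentSpace 𝓘(ℝ, Model m) x →L[ℝ] ℝ
  contMDiff : ContMDiff 𝓘(ℝ, Model m)
    (𝓘(ℝ, Model m).prod 𝓘(ℝ, Model m →L[ℝ] Model m →L[ℝ] ℝ)) ∞
    (fun x => Bundle.TotalSpace.mk' (Model m →L[ℝ] Model m →L[ℝ] ℝ)
      (E := fun x => TangentSpace 𝓘(ℝ, Model m) x →L[ℝ] TangentSpace 𝓘(ℝ, Model m) x →L[ℝ] ℝ)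
      x (toFun x))
  alternating : ∀ (x : M) (v : TangentSpace 𝓘(ℝ, Model m) x), toFun x v v = 0
  nondegenerate : ∀ (x : M) (v : TangentSpace 𝓘(ℝ, Model m) x), (∀ w, toFun x v w = 0) → v = 0
  closed : ∀ (X Y Z : Cₛ^∞⟮𝓘(ℝ, Model m); Model m, (TangentSpace 𝓘(ℝ, Model m) : M → Type _)⟯)
      (x : M),
    mvfderiv 𝓘(ℝ, Model m) (fun y => toFun y (Y y) (Z y)) x (X x)
      + mvfderiv 𝓘(ℝ, Model m) (fun y => toFun y (Z y) (X y)) x (Y x)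
      + mvfderiv 𝓘(ℝ, Model m) (fun y => toFun y (X y) (Y y)) x (Z x)
      - toFun x (VectorField.mlieBracket 𝓘(ℝ, Model m) X Y x) (Z x)
      - toFun x (VectorField.mlieBracket 𝓘(ℝ, Model m) Y Z x) (X x)
      - toFun x (VectorField.mlieBracket 𝓘(ℝ, Model m) Z X x) (Y x) = 0

/-- The symplectic form at a point, as a bilinear form on the model space. -/
def SymplecticForm.at (σ : SymplecticForm m M) (x : M) : Model m →L[ℝ] Model m →L[ℝ] ℝ :=
  σ.toFun x

theorem SymplecticForm.contMDiffAt_gram (σ : SymplecticForm m M) (x₀ : M) (i j : Fin m) :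
    ContMDiffAt 𝓘(ℝ, Model m) 𝓘(ℝ, ℝ) ∞
      (fun x => gramMatrix ((σ.at x).bilinearComp (frameMap x₀ x) (frameMap x₀ x)) i j) x₀ := by
  have hf : ∀ v, ContMDiffAt 𝓘(ℝ, Model m) (𝓘(ℝ, Model m).tangent) ∞
      (fun x => (⟨x, frameMap x₀ x v⟩ : TangentBundle 𝓘(ℝ, Model m) M)) x₀ := fun v =>
    ContMDiffAt.comp (g := fun q : M × Model m =>
      (⟨q.1, frameMap x₀ q.1 q.2⟩ : TangentBundle 𝓘(ℝ, Model m) M)) x₀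
      (contMDiffAt_frameMap x₀ v) (contMDiffAt_id.prodMk contMDiffAt_const)
  have h := ContMDiffAt.clm_bundle_apply₂ (F₃ := ℝ) (E₃ := Bundle.Trivial M ℝ)
    (σ.contMDiff x₀) (hf (stdVec i)) (hf (stdVec j))
  rw [Bundle.contMDiffAt_section] at h
  exact h

theorem IsSmoothFamily.poissonContraction (σ : SymplecticForm m M)
    {s t : M → FormalFunctions (Model m)} (hs : IsSmoothFamily s) (ht : IsSmoothFamily t) (r : ℕ) :
    IsSmoothFamily (fun x => poissonContraction (σ.at x) r (s x) (t x)) := by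
  rw [isSmoothFamily_iff] at hs ht ⊢
  intro x₀
  have hdet : (gramMatrix ((σ.at x₀).bilinearComp (frameMap x₀ x₀)
      (frameMap x₀ x₀))).transpose.det ≠ 0 := by
    rw [Matrix.det_transpose, gramMatrix_comp, Matrix.det_mul, Matrix.det_mul,
      Matrix.det_transpose]
    have h1 : (stdMatrix (frameMap (m := m) x₀ x₀)).det ≠ 0 := by
      have h2 := congrArg (fun A => (stdMatrix A).det) (frameMap_comp_coframeMap (m := m) (mem_of_mem_nhds
        (baseSet_mem_nhds (m := m) x₀)))
      simp only [stdMatrix_comp, stdMatrix_id, Matrix.det_mul, Matrix.det_one] at h2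
      intro h3
      rw [h3, zero_mul] at h2
      exact zero_ne_one h2
    exact mul_ne_zero (mul_ne_zero h1
      (gramMatrix_det_ne_zero (σ.at x₀) fun v hv => σ.nondegenerate x₀ v hv)) h1
  have hP := fun i j => contMDiffAt_inv (x := x₀)
    (P := fun x => (gramMatrix ((σ.at x).bilinearComp (frameMap x₀ x)
      (frameMap x₀ x))).transpose) (fun i j => σ.contMDiffAt_gram x₀ j i) hdet i j
  refine (SmoothFamilyAt.contraction (m := m) hP r (hs x₀) (ht x₀)).congr ?_
  filter_upwards [baseSet_mem_nhds (m := m) x₀] with x hx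
  exact poissonContraction_linPullback (σ.at x) (frameMap x₀ x) (coframeMap x₀ x)
    (frameMap_comp_coframeMap hx) r (s x) (t x)

theorem IsSmoothFamily.add {s t : M → FormalFunctions (Model m)} (hs : IsSmoothFamily s)
    (ht : IsSmoothFamily t) : IsSmoothFamily (fun x => s x + t x) := fun k =>
  (hs k).add (ht k)

theorem IsSmoothFamily.const_smul {s : M → FormalFunctions (Model m)} (hs : IsSmoothFamily s)
    (z : ℂ) : IsSmoothFamily (fun x => z • s x) := fun k p =>
  contMDiffAt_mul_complex contMDiffAt_const (hs k p)

theorem isSmoothFamily_algebraMap (z : ℂ) :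
    IsSmoothFamily (fun _ : M => algebraMap ℂ (FormalFunctions (Model m)) z) := fun k => by
  simp only [hcomp_algebraMap]
  exact contMDiff_const

theorem IsSmoothFamily.sum {ι : Type*} {s : ι → M → FormalFunctions (Model m)} (u : Finset ι)
    (hs : ∀ i, IsSmoothFamily (s i)) : IsSmoothFamily (fun x => ∑ i ∈ u, s i x) := fun k => by
  have h : ∀ p : TangentBundle 𝓘(ℝ, Model m) M, hcomp k (∑ i ∈ u, s i p.1) p.2 =
      ∑ i ∈ u, hcomp k (s i p.1) p.2 := fun p => by rw [hcomp_sum]; exact Finset.sum_apply _ _ _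
  simp only [h]
  exact contMDiff_finsetSum fun i _ => hs i k

end LocalSmoothness

section WeylBundle
variable {m : ℕ} {M : Type*} [TopologicalSpace M] [ChartedSpace (Model m) M]
  [IsManifold 𝓘(ℝ, Model m) ∞ M]

variable (m M) in
/-- Smooth vector fields on `M`. -/
abbrev VField := Cₛ^∞⟮𝓘(ℝ, Model m); Model m, (TangentSpace 𝓘(ℝ, Model m) : M → Type _)⟯

/-- The product of a smooth function and a smooth vector field. -/
noncomputable def smulField (f : C^∞⟮𝓘(ℝ, Model m), M; ℝ⟯) (X : VField m M) : VField m M :=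
  ⟨fun x => f x • X x, f.contMDiff.smul_section X.contMDiff⟩

/-- The Lie bracket of two smooth vector fields. -/
noncomputable def bracketField (X Y : VField m M) : VField m M :=
  ⟨VectorField.mlieBracket 𝓘(ℝ, Model m) X Y, fun x => by
    have _ : IsManifold 𝓘(ℝ, Model m) (minSmoothness ℝ 2) M := by
      rw [minSmoothness_of_isRCLikeNormedField]
      exact IsManifold.of_le (n := ∞) (by norm_cast)
    have _ : IsManifold 𝓘(ℝ, Model m) (((⊤ : ℕ∞) : WithTop ℕ∞) + 1) M :=
      inferInstanceAs (IsManifold 𝓘(ℝ, Model m) ∞ M)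
    exact ContMDiffAt.mlieBracket_vectorField (m := ⊤) (n := ⊤) (X.contMDiff x) (Y.contMDiff x)
      (by simp)⟩

/-- The algebra of smooth sections of the Weyl bundle, inside the product of all the fibres. -/
noncomputable def weylSectionsSubalgebra (σ : SymplecticForm m M) :
    Subalgebra (PowerSeries ℂ) (∀ x, WeylFiber (σ.at x)) where
  carrier := {a | ∀ l, IsSmoothFamily fun x => WeylFiber.hbarCoeff l (a x)}
  mul_mem' := by
    intro a b ha hb l
    have h : (fun x => WeylFiber.hbarCoeff l ((a * b) x)) = fun x =>
        ∑ p ∈ Finset.HasAntidiagonal.antidiagonal l,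
          ∑ q ∈ Finset.HasAntidiagonal.antidiagonal p.2,
            (((Complex.I / 2) ^ p.1 * (p.1.factorial : ℂ)⁻¹)) •
              poissonContraction (σ.at x) p.1 (WeylFiber.hbarCoeff q.1 (a x))
                (WeylFiber.hbarCoeff q.2 (b x)) :=
      funext fun x => WeylFiber.hbarCoeff_mul (a x) (b x) l
    rw [h]
    exact IsSmoothFamily.sum _ fun p => IsSmoothFamily.sum _ fun q =>
      ((ha q.1).poissonContraction σ (hb q.2) p.1).const_smul _
  add_mem' := by
    intro a b ha hb l
    have h : (fun x => WeylFiber.hbarCoeff l ((a + b) x)) = fun x =>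
        WeylFiber.hbarCoeff l (a x) + WeylFiber.hbarCoeff l (b x) :=
      funext fun x => map_add _ _ _
    rw [h]
    exact (ha l).add (hb l)
  algebraMap_mem' := by
    intro z l
    have h : (fun x => WeylFiber.hbarCoeff l
        ((algebraMap (PowerSeries ℂ) (∀ x, WeylFiber (σ.at x)) z) x)) = fun _ =>
        algebraMap ℂ (FormalFunctions (Model m)) (PowerSeries.coeff l z) :=
      funext fun x => by
        change WeylFiber.hbarCoeff l (WeylFiber.scalar z : WeylFiber (σ.at x)) = _
        exact WeylFiber.hbarCoeff_ofCoeff _ _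
    rw [h]
    exact isSmoothFamily_algebraMap _

/-- The `ℂ⟦ħ⟧`-algebra `Γ(𝒲)` of smooth sections of the Weyl bundle of `(M, σ)`, with the
fibrewise product. -/
def WeylSections (σ : SymplecticForm m M) : Type _ := weylSectionsSubalgebra σ

namespace WeylSections
variable {σ : SymplecticForm m M}

noncomputable instance : Ring (WeylSections σ) :=
  inferInstanceAs (Ring (weylSectionsSubalgebra σ))

noncomputable instance : Algebra (PowerSeries ℂ) (WeylSections σ) :=
  inferInstanceAs (Algebra (PowerSeries ℂ) (weylSectionsSubalgebra σ))

/-- The value of a section at a point. -/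
def eval (a : WeylSections σ) (x : M) : WeylFiber (σ.at x) := a.1 x

/-- The component of a section which is homogeneous of degree `k` on the tangent spaces and of
order `l` in `ħ`, evaluated on a tangent vector. -/
noncomputable def component (a : WeylSections σ) (k l : ℕ) (x : M)
    (v : TangentSpace 𝓘(ℝ, Model m) x) : ℂ :=
  hcomp k (WeylFiber.hbarCoeff l (a.eval x)) v

theorem contMDiff_component (a : WeylSections σ) (k l : ℕ) :
    ContMDiff (𝓘(ℝ, Model m).tangent) 𝓘(ℝ, ℂ) ∞
      (fun p : TangentBundle 𝓘(ℝ, Model m) M => a.component k l p.1 p.2) := a.2 l k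

theorem ext_component {a b : WeylSections σ}
    (h : ∀ k l x v, a.component k l x v = b.component k l x v) : a = b :=
  Subtype.ext (funext fun x => WeylFiber.ext fun l => FormalFunctions.ext fun k v => h k l x v)

/-- The section with prescribed coefficients of the powers of `ħ`. -/
noncomputable def ofCoeff (s : ℕ → M → FormalFunctions (Model m)) (hs : ∀ l, IsSmoothFamily (s l)) :
    WeylSections σ :=
  ⟨fun x => WeylFiber.ofCoeff fun l => s l x, fun l => by
    simp only [WeylFiber.hbarCoeff_ofCoeff]
    exact hs l⟩

/-- A smooth function, as a section of the Weyl bundle. -/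
noncomputable def ofFunction (f : C^∞⟮𝓘(ℝ, Model m), M; 𝓘(ℝ, ℂ), ℂ⟯) : WeylSections σ :=
  ofCoeff (fun l x => algebraMap ℂ (FormalFunctions (Model m)) (if l = 0 then f x else 0))
    fun l k => by
      simp only [hcomp_algebraMap]
      split_ifs
      · exact f.contMDiff.comp (Bundle.contMDiff_proj (TangentSpace 𝓘(ℝ, Model m)))
      all_goals exact contMDiff_const

/-- A real valued smooth function, as a section of the Weyl bundle. -/
noncomputable def ofRealFunction (f : C^∞⟮𝓘(ℝ, Model m), M; ℝ⟯) : WeylSections σ :=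
  ofFunction ⟨fun x => (f x : ℂ), Complex.ofRealCLM.contMDiff.comp f.contMDiff⟩

/-- The pull-back of sections along a smooth map `φ : M → M`. -/
noncomputable def pullback (φ : M → M) (hφ : ContMDiff 𝓘(ℝ, Model m) 𝓘(ℝ, Model m) ∞ φ)
    (a : WeylSections σ) : WeylSections σ :=
  ofCoeff (fun l x => linPullback (mfderiv 𝓘(ℝ, Model m) 𝓘(ℝ, Model m) φ x)
    (WeylFiber.hbarCoeff l (a.eval (φ x)))) fun l k => by
      have h := (a.contMDiff_component k l).comp (hφ.contMDiff_tangentMap (m := ∞) (by simp))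
      refine h.congr fun p => ?_
      exact hcomp_linPullback _ _ _ _

end WeylSections
end WeylBundle

section Connections
variable {m : ℕ} {M : Type*} [TopologicalSpace M] [ChartedSpace (Model m) M]
  [IsManifold 𝓘(ℝ, Model m) ∞ M]

/-- A `1`-form with values in the Weyl bundle: a `C^∞(M)`-linear map from vector fields to
sections. -/
structure WeylOneForm (σ : SymplecticForm m M) where
  toFun : VField m M → WeylSections σ
  map_add : ∀ X Y, toFun (X + Y) = toFun X + toFun Y
  map_smul : ∀ f X, toFun (smulField f X) = WeylSections.ofRealFunction f * toFun X

/-- A connection on the Weyl bundle, given by its covariant derivatives `∇_X`: it is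
`ℂ⟦ħ⟧`-linear, `C^∞(M)`-linear in `X`, a derivation of the product of sections, and agrees with the
de Rham differential on functions. -/
structure WeylConnection (σ : SymplecticForm m M) where
  /-- The covariant derivative `∇_X a`. -/
  toFun : VField m M → WeylSections σ →ₗ[PowerSeries ℂ] WeylSections σ
  map_add : ∀ X Y a, toFun (X + Y) a = toFun X a + toFun Y a
  map_smul : ∀ f X a, toFun (smulField f X) a = WeylSections.ofRealFunction f * toFun X a
  leibniz : ∀ X a b, toFun X (a * b) = toFun X a * b + a * toFun X b
  apply_function : ∀ (X : VField m M) (f : C^∞⟮𝓘(ℝ, Model m), M; 𝓘(ℝ, ℂ), ℂ⟯) (k l : ℕ) (x : M)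
    (v : TangentSpace 𝓘(ℝ, Model m) x),
    (toFun X (WeylSections.ofFunction f)).component k l x v =
      if k = 0 ∧ l = 0 then mvfderiv 𝓘(ℝ, Model m) f x (X x) else 0

/-- A smooth affine connection for which the symplectic form is parallel. -/
def IsSymplecticConnection (σ : SymplecticForm m M)
    (D : CovariantDerivative 𝓘(ℝ, Model m) (Model m)
      (TangentSpace 𝓘(ℝ, Model m) : M → Type _)) : Prop :=
  CovariantDerivative.ContMDiffCovariantDerivative D ∞ ∧
    ∀ (X Y Z : VField m M) (x : M),
      mvfderiv 𝓘(ℝ, Model m) (fun y => σ.toFun y (Y y) (Z y)) x (X x) =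
        σ.toFun x (D Y x (X x)) (Z x) + σ.toFun x (Y x) (D Z x (X x))

/-- `D₀` is the connection on the Weyl bundle induced by the affine connection `D`. Each component
`a_{k,l}` is a field of homogeneous polynomials of degree `k` on the tangent spaces, and
`(∇_X a)(Y, …, Y) = X (a (Y, …, Y)) - k a (∇_X Y, Y, …, Y)`, where the last term is the derivative
of the polynomial `a_{k,l}` at `Y` in the direction `∇_X Y`. -/
def IsInducedConnection (σ : SymplecticForm m M)
    (D : CovariantDerivative 𝓘(ℝ, Model m) (Model m)
      (TangentSpace 𝓘(ℝ, Model m) : M → Type _))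
    (D₀ : VField m M → WeylSections σ → WeylSections σ) : Prop :=
  ∀ (X Y : VField m M) (a : WeylSections σ) (k l : ℕ) (x : M),
    (D₀ X a).component k l x (Y x) =
      mvfderiv 𝓘(ℝ, Model m) (fun y => a.component k l y (Y y)) x (X x) -
        fderiv ℝ (E := Model m) (a.component k l x) (Y x) (D Y x (X x))

variable {σ : SymplecticForm m M}

namespace WeylConnection

/-- The connection has curvature zero. -/
def IsFlat (D : WeylConnection σ) : Prop :=
  ∀ X Y a, D.toFun X (D.toFun Y a) - D.toFun Y (D.toFun X a) = D.toFun (bracketField X Y) a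

/-- A Fedosov connection: a flat connection of the form `∇ = ∇₀ + [A, -]` with `∇₀` induced by a
symplectic connection and `A = A₋₁ + A₁ + A₂ + …`. Here `B` stands for the `1`-form `iħ A`, with
values in the Weyl bundle. For the grading in which covectors have degree `1` and `ħ` has
degree `2`, the part of `B` of degree `1` is `X ↦ σ(X, -)`, that is `A₋₁ = σ(X, -) / (iħ)`, its parts
of degree `0` and `2` vanish, and `B` is real modulo `ħ`. -/
def IsFedosov (D : WeylConnection σ) : Prop :=
  D.IsFlat ∧
    ∃ (D₁ : CovariantDerivative 𝓘(ℝ, Model m) (Model m)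
        (TangentSpace 𝓘(ℝ, Model m) : M → Type _))
      (D₀ : VField m M → WeylSections σ → WeylSections σ) (B : WeylOneForm σ),
      IsSymplecticConnection σ D₁ ∧ IsInducedConnection σ D₁ D₀ ∧
      (∀ (X : VField m M) (x : M) (v : TangentSpace 𝓘(ℝ, Model m) x),
        (B.toFun X).component 1 0 x v = (σ.toFun x (X x) v : ℂ)) ∧
      (∀ (X : VField m M) (k l : ℕ) (x : M) (v : TangentSpace 𝓘(ℝ, Model m) x),
        k + 2 * l = 0 ∨ k + 2 * l = 2 → (B.toFun X).component k l x v = 0) ∧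
      (∀ (X : VField m M) (k : ℕ) (x : M) (v : TangentSpace 𝓘(ℝ, Model m) x),
        ((B.toFun X).component k 0 x v).im = 0) ∧
      ∀ (X : VField m M) (a : WeylSections σ),
        (PowerSeries.C Complex.I * PowerSeries.X : PowerSeries ℂ) • (D.toFun X a - D₀ X a) =
          B.toFun X * a - a * B.toFun X

theorem map_one (D : WeylConnection σ) (X : VField m M) : D.toFun X 1 = 0 := by
  have h := D.leibniz X 1 1
  simpa using h

/-- The algebra of flat sections of a connection. -/
def ker (D : WeylConnection σ) : Subalgebra (PowerSeries ℂ) (WeylSections σ) where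
  carrier := {a | ∀ X, D.toFun X a = 0}
  mul_mem' := by
    intro a b ha hb X
    rw [D.leibniz, ha X, hb X, zero_mul, mul_zero, add_zero]
  add_mem' := by
    intro a b ha hb X
    rw [LinearMap.map_add, ha X, hb X, add_zero]
  algebraMap_mem' := by
    intro z X
    rw [Algebra.algebraMap_eq_smul_one, LinearMap.map_smul, D.map_one, smul_zero]

theorem leibniz_inv (D : WeylConnection σ) (U : (WeylSections σ)ˣ) (X : VField m M) :
    D.toFun X (U⁻¹ : (WeylSections σ)ˣ) * U + (U⁻¹ : (WeylSections σ)ˣ) * D.toFun X U = 0 := by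
  rw [← D.leibniz, Units.inv_mul, D.map_one]

/-- The Fedosov equivariance group: the invertible sections `U` of the Weyl bundle for which the
`1`-form `∇(U⁻¹) U` takes values in the centre. -/
def equivarianceGroup (D : WeylConnection σ) : Subgroup (WeylSections σ)ˣ where
  carrier := {U | ∀ X, D.toFun X (U⁻¹ : (WeylSections σ)ˣ) * U ∈ Subring.center (WeylSections σ)}
  one_mem' := by
    intro X
    simp only [inv_one, Units.val_one, D.map_one, zero_mul]
    exact zero_mem _
  mul_mem' := by
    intro U V hU hV X
    have h : D.toFun X ((U * V)⁻¹ : (WeylSections σ)ˣ) * (U * V : (WeylSections σ)ˣ) =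
        D.toFun X (V⁻¹ : (WeylSections σ)ˣ) * V + D.toFun X (U⁻¹ : (WeylSections σ)ˣ) * U := by
      have hc := Subring.mem_center_iff.1 (hU X) (V⁻¹ : (WeylSections σ)ˣ)
      rw [mul_inv_rev, Units.val_mul, Units.val_mul, D.leibniz, add_mul]
      congr 1
      · rw [mul_assoc, ← mul_assoc _ (U : WeylSections σ) (V : WeylSections σ), Units.inv_mul,
          one_mul]
      · calc _ = (V⁻¹ : (WeylSections σ)ˣ) * (D.toFun X (U⁻¹ : (WeylSections σ)ˣ) * U) * V := by
              simp only [mul_assoc]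
          _ = _ := by rw [hc, mul_assoc, Units.inv_mul, mul_one]
    rw [h]
    exact add_mem (hV X) (hU X)
  inv_mem' := by
    intro U hU X
    have h1 := D.leibniz_inv U X
    have h2 : D.toFun X U = -(U * (D.toFun X (U⁻¹ : (WeylSections σ)ˣ) * U)) := by
      have h3 := congrArg (fun a => (U : WeylSections σ) * a) (eq_neg_of_add_eq_zero_right h1)
      simp only [mul_neg] at h3
      rw [← mul_assoc, Units.mul_inv, one_mul] at h3
      exact h3
    have hc := Subring.mem_center_iff.1 (hU X) U
    have h4 : D.toFun X U * (U⁻¹ : (WeylSections σ)ˣ) =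
        -(D.toFun X (U⁻¹ : (WeylSections σ)ˣ) * U) := by
      rw [h2, hc, neg_mul, mul_assoc, Units.mul_inv, mul_one]
    rw [inv_inv, h4]
    exact neg_mem (hU X)

end WeylConnection

/-- The group `𝒵^×` of invertible sections of the Weyl bundle that are central. -/
def centralUnits (σ : SymplecticForm m M) : Subgroup (WeylSections σ)ˣ where
  carrier := {U | (U : WeylSections σ) ∈ Subring.center (WeylSections σ)}
  one_mem' := one_mem (Subring.center (WeylSections σ))
  mul_mem' := fun hU hV => (Subring.center (WeylSections σ)).mul_mem hU hV
  inv_mem' := by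
    intro U hU
    refine Subring.mem_center_iff.2 fun a => ?_
    have h : Commute a (U : WeylSections σ) := Subring.mem_center_iff.1 hU a
    exact h.units_inv_right

namespace WeylConnection

/-- The central units, as a subgroup of the Fedosov equivariance group. -/
noncomputable def centralSubgroup (D : WeylConnection σ) : Subgroup D.equivarianceGroup :=
  (centralUnits σ).subgroupOf D.equivarianceGroup

instance (D : WeylConnection σ) : D.centralSubgroup.Normal where
  conj_mem := by
    intro U hU V
    have hU' : ((U : (WeylSections σ)ˣ) : WeylSections σ) ∈ Subring.center (WeylSections σ) := hU
    have h : V * U = U * V :=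
      Subtype.ext (Units.ext (Subring.mem_center_iff.1 hU' (V.1 : WeylSections σ)))
    rw [h, mul_assoc, mul_inv_cancel, mul_one]
    exact hU

/-- The quotient of the Fedosov equivariance group by the central units. -/
abbrev reducedEquivarianceGroup (D : WeylConnection σ) : Type _ :=
  D.equivarianceGroup ⧸ D.centralSubgroup

end WeylConnection
end Connections

section GroupCohomology
variable {G N : Type*} [Group G] [Group N] (φ : G →* MulAut N)

/-- Nonabelian `1`-cocycles (crossed homomorphisms) of `G` in the `G`-group `N`. -/
def Cocycle₁ : Type _ := {s : G → N // ∀ g h, s (g * h) = s g * φ g (s h)}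

/-- Two cocycles are cohomologous if `t g = c * s g * (g • c⁻¹)` for some `c`. -/
def Cohomologous (s t : Cocycle₁ φ) : Prop := ∃ c : N, ∀ g, t.1 g = c * s.1 g * φ g c⁻¹

/-- The relation of being cohomologous, as an equivalence relation. -/
instance cocycleSetoid : Setoid (Cocycle₁ φ) where
  r := Cohomologous φ
  iseqv :=
    { refl := fun s => ⟨1, fun g => by simp⟩
      symm := by
        rintro s t ⟨c, hc⟩
        exact ⟨c⁻¹, fun g => by rw [hc]; simp [mul_assoc]⟩
      trans := by
        rintro s t u ⟨c, hc⟩ ⟨d, hd⟩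
        exact ⟨d * c, fun g => by rw [hd, hc]; simp [mul_assoc, map_mul]⟩ }

/-- The first nonabelian group cohomology of `G` in `N`. -/
def GroupH1 : Type _ := Quotient (cocycleSetoid φ)

/-- The trivial cocycle; its class is the base point of the first cohomology. -/
def trivialCocycle : Cocycle₁ φ := ⟨fun _ => 1, fun g h => by simp⟩

/-- The class of a cocycle. -/
def cocycleClass (s : Cocycle₁ φ) : GroupH1 φ := Quotient.mk (cocycleSetoid φ) s

end GroupCohomology

section Extensions
variable {m : ℕ} {M : Type*} [TopologicalSpace M] [ChartedSpace (Model m) M]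
  [IsManifold 𝓘(ℝ, Model m) ∞ M]

/-- An action of a group on `M` by symplectomorphisms. -/
structure IsSymplecticAction (Γ : Type*) [Group Γ] [MulAction Γ M] (σ : SymplecticForm m M) :
    Prop where
  contMDiff : ∀ γ : Γ, ContMDiff 𝓘(ℝ, Model m) 𝓘(ℝ, Model m) ∞ (fun x : M => γ • x)
  preserves : ∀ (γ : Γ) (x : M) (v w : TangentSpace 𝓘(ℝ, Model m) x),
    σ.toFun (γ • x) (mfderiv 𝓘(ℝ, Model m) 𝓘(ℝ, Model m) (fun y : M => γ • y) x v)
      (mfderiv 𝓘(ℝ, Model m) 𝓘(ℝ, Model m) (fun y : M => γ • y) x w) = σ.toFun x v w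

variable {Γ : Type*} [Group Γ] [MulAction Γ M] {σ : SymplecticForm m M}

/-- `Ad U ∘ γ^*` as a transformation of the sections of the Weyl bundle. -/
noncomputable def twistedPullback (hΓ : IsSymplecticAction Γ σ) (γ : Γ) (U : (WeylSections σ)ˣ)
    (a : WeylSections σ) : WeylSections σ :=
  U * WeylSections.pullback (fun x : M => γ • x) (hΓ.contMDiff γ) a * (U⁻¹ : (WeylSections σ)ˣ)

/-- The automorphism `f` of the algebra of flat sections is the restriction of `Ad U ∘ γ^*`. -/
def Represents (D : WeylConnection σ) (hΓ : IsSymplecticAction Γ σ) (γ : Γ)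
    (f : D.ker ≃ₐ[PowerSeries ℂ] D.ker) (U : (WeylSections σ)ˣ) : Prop :=
  ∀ k : D.ker, (f k : WeylSections σ) = twistedPullback hΓ γ U k

/-- An extension of the action of `Γ` on `M` to the algebra of flat sections: a right action by
automorphisms `A_γ` of the form `Ad U_γ ∘ γ^*`. -/
def ExtendedAction (D : WeylConnection σ) (hΓ : IsSymplecticAction Γ σ) : Type _ :=
  {A : Γᵐᵒᵖ →* (D.ker ≃ₐ[PowerSeries ℂ] D.ker) //
    ∀ γ : Γ, ∃ U : (WeylSections σ)ˣ, Represents D hΓ γ (A (MulOpposite.op γ)) U}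

/-- The automorphism of the algebra of flat sections given by an extended action. -/
noncomputable def ExtendedAction.aut {D : WeylConnection σ} {hΓ : IsSymplecticAction Γ σ}
    (A : ExtendedAction D hΓ) (γ : Γ) : D.ker ≃ₐ[PowerSeries ℂ] D.ker := A.1 (MulOpposite.op γ)

/-- An automorphism of the algebra of flat sections which is the restriction of an inner
automorphism `Ad C` of the algebra of sections of the Weyl bundle. -/
def IsInnerForSections (D : WeylConnection σ) (c : D.ker ≃ₐ[PowerSeries ℂ] D.ker) : Prop :=
  ∃ C : (WeylSections σ)ˣ, ∀ k : D.ker,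
    (c k : WeylSections σ) = C * (k : WeylSections σ) * (C⁻¹ : (WeylSections σ)ˣ)

/-- Two extended actions are equivalent if they are conjugate by a fixed automorphism that is inner
for the algebra of sections of the Weyl bundle. -/
def ExtendedAction.Equivalent {D : WeylConnection σ} {hΓ : IsSymplecticAction Γ σ}
    (A B : ExtendedAction D hΓ) : Prop :=
  ∃ c : D.ker ≃ₐ[PowerSeries ℂ] D.ker, IsInnerForSections D c ∧ ∀ γ, B.aut γ = c * A.aut γ * c⁻¹

/-- Equivalence of extended actions, as an equivalence relation. -/
instance extendedActionSetoid (D : WeylConnection σ) (hΓ : IsSymplecticAction Γ σ) :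
    Setoid (ExtendedAction D hΓ) where
  r := ExtendedAction.Equivalent
  iseqv :=
    { refl := fun A => ⟨1, ⟨1, fun k => by simp⟩, fun γ => by simp⟩
      symm := by
        rintro A B ⟨c, ⟨C, hC⟩, hc⟩
        refine ⟨c⁻¹, ⟨C⁻¹, fun k => ?_⟩, fun γ => by rw [hc]; group⟩
        have h : c (c⁻¹ k) = k := AlgEquiv.apply_symm_apply c k
        have h2 := hC (c⁻¹ k)
        rw [h] at h2
        rw [h2, inv_inv]
        simp only [mul_assoc, Units.inv_mul, mul_one]
        rw [← mul_assoc, Units.inv_mul, one_mul]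
      trans := by
        rintro A B B' ⟨c, ⟨C, hC⟩, hc⟩ ⟨d, ⟨E, hE⟩, hd⟩
        refine ⟨d * c, ⟨E * C, fun k => ?_⟩, fun γ => by rw [hd, hc]; group⟩
        rw [AlgEquiv.mul_apply, hE, hC, mul_inv_rev, Units.val_mul, Units.val_mul]
        simp only [mul_assoc] }

end Extensions

/-!
The proof reduces to group theory once the following is known: a section of the Weyl bundle that
commutes with all flat sections is central (`WeylConnection.IsFedosov.mem_center_of_commute`).
Differentiating `Ad U a` for flat `a` shows that `Ad U` preserves the flat sections exactly when the
form `∇(U⁻¹) U` commutes with all of them. Granting the fact above, this means that `U` lies in the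
Fedosov equivariance group, and that this group modulo the central units is the group of those
automorphisms of the algebra of flat sections which are inner for the algebra of all sections
(`IsFedosov.mem_equivarianceGroup`, `reducedInnerAut_injective`, `isInnerForSections_iff`).

Conjugation by `A_γ` preserves this group of automorphisms, because pull-back along a
symplectomorphism is multiplicative; this is the action. Two lifts of the same `γ` differ by an
element of the group (`exists_represents_iff`). Hence the extensions are the homomorphisms
`γ ↦ ι(S_γ) A_γ`, with `ι` the inclusion of the group; multiplicativity is the cocycle identity and
conjugation by the group is the cohomology relation.

The fact about centralizers rests on the existence of many flat sections, obtained by Fedosov's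
iteration. Give covectors degree `1` and `ħ` degree `2`. The commutator with the covector `σ(w, -)`
is `-iħ ∂_w`, so a Fedosov connection lowers the degree by at most one, with leading term `-∂_X`
along the fibres (`component_toFun`). If `∇a` starts in degree `N`, flatness of `∇` makes its
leading term closed along the fibres, and the Poincaré lemma for polynomial forms provides a
correction of `a` in degree `N + 1` which removes it (`exists_correction`). Starting from a
function `f`, the limit is a flat section `f + df + ⋯`. If `u` commutes with it, then the leading
nonconstant term of `u` at a point is annihilated by `∂_w`, where `df = σ(w, -)` at that point; as
`w` is arbitrary, `u` is constant along the fibres, that is central.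
-/

/-! ### The degree filtration of the formal Weyl algebra -/

section FormalFunctionLemmas
variable {E : Type*} [NormedAddCommGroup E] [NormedSpace ℝ E]

/-- Euler's identity for a homogeneous component. -/
theorem fderiv_hcomp_self (k : ℕ) (f : FormalFunctions E) (v : E) :
    fderiv ℝ (hcomp k f) v v = (k : ℂ) * hcomp k f v := by
  have h1 : HasDerivAt (fun t : ℝ => hcomp k f (t • v)) (fderiv ℝ (hcomp k f) v v) 1 := by
    have h := (differentiableAt_hcomp k f ((1 : ℝ) • v)).hasFDerivAt.comp_hasDerivAt (1 : ℝ)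
      ((hasDerivAt_id (1 : ℝ)).smul_const v)
    simpa [Function.comp_def] using h
  have h2 : HasDerivAt (fun t : ℝ => hcomp k f (t • v)) ((k : ℂ) * hcomp k f v) 1 := by
    have h := (((hasDerivAt_id (1 : ℝ)).ofReal_comp.pow k).mul_const (hcomp k f v))
    have h' : (fun t : ℝ => hcomp k f (t • v)) = fun t : ℝ => (t : ℂ) ^ k * hcomp k f v :=
      funext fun t => hcomp_smul k f t v
    rw [h']
    simpa using h
  exact h1.unique h2

theorem hcomp_pd_eq_zero {f : FormalFunctions E} {k : ℕ} (h : hcomp (k + 1) f = 0) (w : E) :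
    hcomp k (pd w f) = 0 := by
  funext v
  rw [hcomp_pd, h]
  simp

theorem hcomp_mul_eq_zero {f g : FormalFunctions E} {s t k : ℕ} (hf : ∀ j < s, hcomp j f = 0)
    (hg : ∀ j < t, hcomp j g = 0) (hk : k < s + t) : hcomp k (f * g) = 0 := by
  rw [hcomp_mul]
  refine Finset.sum_eq_zero fun p hp => ?_
  rw [Finset.HasAntidiagonal.mem_antidiagonal] at hp
  by_cases h : p.1 < s
  · rw [hf _ h, zero_mul]
  · rw [hg _ (by omega), mul_zero]

/-- Every application of the bidifferential operator lowers the sum of the orders by two. -/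
theorem hcomp_contraction_eq_zero {ι : Type*} [Fintype ι] (w : ι → E) (π : ι → ι → ℂ) (r : ℕ)
    {f g : FormalFunctions E} {s t k : ℕ} (hf : ∀ j < s, hcomp j f = 0)
    (hg : ∀ j < t, hcomp j g = 0) (hk : k + 2 * r < s + t) :
    hcomp k (contraction (fun i => pd (w i)) π r f g) = 0 := by
  induction r generalizing f g s t with
  | zero =>
    rw [contraction_zero]
    exact hcomp_mul_eq_zero hf hg (by omega)
  | succ r ih =>
    rw [contraction_succ, hcomp_sum]
    refine Finset.sum_eq_zero fun i _ => ?_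
    rw [hcomp_sum]
    refine Finset.sum_eq_zero fun j _ => ?_
    rw [hcomp_csmul, ih (s := s - 1) (t := t - 1) (fun a ha => hcomp_pd_eq_zero (hf _ (by omega)) _)
      (fun a ha => hcomp_pd_eq_zero (hg _ (by omega)) _) (by omega), smul_zero]

/-- The formal function with prescribed homogeneous components. -/
noncomputable def FormalFunctions.ofComponents (F : ℕ → E → ℂ) (hF : ∀ k, ContDiff ℝ ∞ (F k))
    (hF' : ∀ k (t : ℝ) v, F k (t • v) = (t : ℂ) ^ k * F k v) : FormalFunctions E :=
  ⟨PowerSeries.mk F, fun k => by rw [PowerSeries.coeff_mk]; exact ⟨hF k, hF' k⟩⟩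

theorem FormalFunctions.hcomp_ofComponents (F : ℕ → E → ℂ) (hF : ∀ k, ContDiff ℝ ∞ (F k))
    (hF' : ∀ k (t : ℝ) v, F k (t • v) = (t : ℂ) ^ k * F k v) (k : ℕ) :
    hcomp k (FormalFunctions.ofComponents F hF hF') = F k := by
  simp [FormalFunctions.ofComponents, hcomp]

/-- A linear form, as a formal function of degree one. -/
noncomputable def FormalFunctions.ofLinear (φ : E →L[ℝ] ℝ) : FormalFunctions E :=
  FormalFunctions.ofComponents (fun k v => if k = 1 then (φ v : ℂ) else 0)
    (fun k => by
      split_ifs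
      · exact Complex.ofRealCLM.contDiff.comp φ.contDiff
      · exact contDiff_const)
    (fun k t v => by
      split_ifs with h
      · simp [h]
      · simp)

theorem FormalFunctions.hcomp_ofLinear (φ : E →L[ℝ] ℝ) (k : ℕ) (v : E) :
    hcomp k (FormalFunctions.ofLinear φ) v = if k = 1 then (φ v : ℂ) else 0 := by
  rw [FormalFunctions.ofLinear, FormalFunctions.hcomp_ofComponents]

theorem pd_ofLinear (φ : E →L[ℝ] ℝ) (w : E) :
    pd w (FormalFunctions.ofLinear φ) = algebraMap ℂ _ (φ w : ℂ) := by
  refine FormalFunctions.ext fun k v => ?_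
  rw [hcomp_pd, hcomp_algebraMap]
  have h : hcomp (k + 1) (FormalFunctions.ofLinear φ) =
      fun v => if k = 0 then (φ v : ℂ) else 0 := by
    funext v
    rw [FormalFunctions.hcomp_ofLinear]
    simp
  rw [h]
  by_cases hk : k = 0
  · simp only [hk, if_true]
    have : HasFDerivAt (fun v => (φ v : ℂ)) (Complex.ofRealCLM.comp φ) v :=
      (Complex.ofRealCLM.comp φ).hasFDerivAt
    rw [this.fderiv]
    rfl
  · simp [hk]

end FormalFunctionLemmas

namespace WeylFiber
variable {m : ℕ} {σ : Model m →L[ℝ] Model m →L[ℝ] ℝ}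

/-- The elements of the formal Weyl algebra all of whose terms have degree at least `N`, where
covectors have degree `1` and `ħ` has degree `2`. -/
noncomputable def filtration (σ : Model m →L[ℝ] Model m →L[ℝ] ℝ) (N : ℕ) :
    AddSubgroup (WeylFiber σ) where
  carrier := {a | ∀ k l, k + 2 * l < N → hcomp k (hbarCoeff l a) = 0}
  zero_mem' := fun k l _ => by rw [map_zero, hcomp_zero]
  add_mem' := fun ha hb k l h => by
    rw [map_add, hcomp_add, ha k l h, hb k l h, add_zero]
  neg_mem' := fun {a} ha k l h => by
    have h1 : hcomp k (hbarCoeff l (-a)) = -hcomp k (hbarCoeff l a) := by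
      rw [map_neg]
      rfl
    rw [h1, ha k l h, neg_zero]

theorem mul_mem_filtration {a b : WeylFiber σ} {M N : ℕ} (ha : a ∈ filtration σ M)
    (hb : b ∈ filtration σ N) : a * b ∈ filtration σ (M + N) := by
  intro k l h
  rw [hbarCoeff_mul, hcomp_sum]
  refine Finset.sum_eq_zero fun p hp => ?_
  rw [hcomp_sum]
  refine Finset.sum_eq_zero fun q hq => ?_
  rw [Finset.HasAntidiagonal.mem_antidiagonal] at hp hq
  rw [hcomp_csmul, poissonContraction, hcomp_contraction_eq_zero (fun i => stdVec i) _ p.1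
    (s := M - 2 * q.1) (t := N - 2 * q.2) (fun j hj => ha _ _ (by omega))
    (fun j hj => hb _ _ (by omega)) (by omega), smul_zero]

/-- The covector `σ(w, -)`, as an element of the Weyl algebra. -/
noncomputable def covector (σ : Model m →L[ℝ] Model m →L[ℝ] ℝ) (w : Model m) : WeylFiber σ :=
  ofCoeff fun l => if l = 0 then FormalFunctions.ofLinear (σ w) else 0

theorem poissonContraction_ofLinear_left (φ : Model m →L[ℝ] ℝ) (r : ℕ)
    (g : FormalFunctions (Model m)) :
    poissonContraction σ (r + 2) (FormalFunctions.ofLinear φ) g = 0 := by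
  rw [poissonContraction, contraction_succ]
  simp only [pd_ofLinear, contraction_algebraMap_left, smul_zero, Finset.sum_const_zero]

theorem poissonContraction_ofLinear_right (φ : Model m →L[ℝ] ℝ) (r : ℕ)
    (g : FormalFunctions (Model m)) :
    poissonContraction σ (r + 2) g (FormalFunctions.ofLinear φ) = 0 := by
  rw [poissonContraction, contraction_succ]
  simp only [pd_ofLinear, contraction_algebraMap_right, smul_zero, Finset.sum_const_zero]

theorem hbarCoeff_ofLinear_mul (φ : Model m →L[ℝ] ℝ) (a : WeylFiber σ) (l : ℕ) :
    hbarCoeff (l + 1) ((ofCoeff fun l => if l = 0 then FormalFunctions.ofLinear φ else 0) * a) =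
      FormalFunctions.ofLinear φ * hbarCoeff (l + 1) a + (Complex.I / 2) •
        poissonContraction σ 1 (FormalFunctions.ofLinear φ) (hbarCoeff l a) := by
  rw [hbarCoeff_mul, Finset.Nat.sum_antidiagonal_succ]
  have hin : ∀ (r j : ℕ), ∑ q ∈ Finset.HasAntidiagonal.antidiagonal j,
      ((Complex.I / 2) ^ r * (r.factorial : ℂ)⁻¹) • poissonContraction σ r
        (hbarCoeff q.1 (ofCoeff fun l => if l = 0 then FormalFunctions.ofLinear φ else 0 :
          WeylFiber σ)) (hbarCoeff q.2 a) = ((Complex.I / 2) ^ r * (r.factorial : ℂ)⁻¹) •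
          poissonContraction σ r (FormalFunctions.ofLinear φ) (hbarCoeff j a) := by
    intro r j
    rw [Finset.sum_eq_single (0, j)]
    · simp [hbarCoeff_ofCoeff]
    · rintro ⟨s, t⟩ hp hne
      obtain _ | s := s
      · simp_all
      · simp [hbarCoeff_ofCoeff]
    · simp
  simp only [hin]
  congr 1
  · simp [poissonContraction, contraction_zero]
  · rw [Finset.sum_eq_single (0, l)]
    · simp
    · rintro ⟨s, t⟩ hp hne
      obtain _ | s := s
      · simp_all
      · simp only [poissonContraction_ofLinear_left, smul_zero]
    · simp

theorem hbarCoeff_mul_ofLinear (φ : Model m →L[ℝ] ℝ) (a : WeylFiber σ) (l : ℕ) :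
    hbarCoeff (l + 1) (a * (ofCoeff fun l => if l = 0 then FormalFunctions.ofLinear φ else 0)) =
      hbarCoeff (l + 1) a * FormalFunctions.ofLinear φ + (Complex.I / 2) •
        poissonContraction σ 1 (hbarCoeff l a) (FormalFunctions.ofLinear φ) := by
  rw [hbarCoeff_mul, Finset.Nat.sum_antidiagonal_succ]
  have hin : ∀ (r j : ℕ), ∑ q ∈ Finset.HasAntidiagonal.antidiagonal j,
      ((Complex.I / 2) ^ r * (r.factorial : ℂ)⁻¹) • poissonContraction σ r (hbarCoeff q.1 a)
        (hbarCoeff q.2 (ofCoeff fun l => if l = 0 then FormalFunctions.ofLinear φ else 0 :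
          WeylFiber σ)) = ((Complex.I / 2) ^ r * (r.factorial : ℂ)⁻¹) •
          poissonContraction σ r (hbarCoeff j a) (FormalFunctions.ofLinear φ) := by
    intro r j
    rw [Finset.sum_eq_single (j, 0)]
    · simp [hbarCoeff_ofCoeff]
    · rintro ⟨s, t⟩ hp hne
      obtain _ | t := t
      · simp_all
      · simp [hbarCoeff_ofCoeff]
    · simp
  simp only [hin]
  congr 1
  · simp [poissonContraction, contraction_zero]
  · rw [Finset.sum_eq_single (0, l)]
    · simp
    · rintro ⟨s, t⟩ hp hne
      obtain _ | s := s
      · simp_all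
      · simp only [poissonContraction_ofLinear_right, smul_zero]
    · simp

/-! ### The commutator with a covector -/

/-- A nondegenerate alternating form on the model space. -/
structure IsSymplectic (σ : Model m →L[ℝ] Model m →L[ℝ] ℝ) : Prop where
  alternating : ∀ v, σ v v = 0
  nondegenerate : ∀ v, (∀ w, σ v w = 0) → v = 0

theorem IsSymplectic.apply_swap (hσ : IsSymplectic σ) (v w : Model m) : σ v w = -σ w v := by
  have h := hσ.alternating (v + w)
  simp only [map_add, add_apply, hσ.alternating, zero_add, add_zero] at h
  linarith

theorem IsSymplectic.gramMatrix_transpose (hσ : IsSymplectic σ) :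
    (gramMatrix σ).transpose = -gramMatrix σ := by
  ext i j
  simp [gramMatrix, hσ.apply_swap (stdVec j) (stdVec i)]

theorem IsSymplectic.isUnit_det (hσ : IsSymplectic σ) : IsUnit (gramMatrix σ).det :=
  isUnit_iff_ne_zero.2 (gramMatrix_det_ne_zero σ hσ.nondegenerate)

theorem IsSymplectic.gramMatrix_mul_poissonMatrix (hσ : IsSymplectic σ) :
    gramMatrix σ * poissonMatrix σ = -1 := by
  have h : gramMatrix σ = -(gramMatrix σ).transpose := by
    rw [hσ.gramMatrix_transpose, neg_neg]
  have hdet : IsUnit (gramMatrix σ).transpose.det := by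
    rw [Matrix.det_transpose]; exact hσ.isUnit_det
  calc gramMatrix σ * poissonMatrix σ = -(gramMatrix σ).transpose * poissonMatrix σ :=
        congrArg (· * poissonMatrix σ) h
    _ = -1 := by rw [poissonMatrix, neg_mul, Matrix.mul_nonsing_inv _ hdet]

theorem IsSymplectic.poissonMatrix_swap (hσ : IsSymplectic σ) (i j : Fin m) :
    poissonMatrix σ i j = -poissonMatrix σ j i := by
  have hdet : IsUnit (gramMatrix σ).transpose.det := by
    rw [Matrix.det_transpose]; exact hσ.isUnit_det
  have h : (poissonMatrix σ).transpose = -poissonMatrix σ := by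
    rw [poissonMatrix, Matrix.transpose_nonsing_inv, Matrix.transpose_transpose]
    refine Matrix.inv_eq_right_inv ?_
    rw [mul_neg]
    exact neg_eq_iff_eq_neg.2 hσ.gramMatrix_mul_poissonMatrix
  exact congrFun (congrFun h j) i

theorem IsSymplectic.sum_apply_mul_poissonMatrix (hσ : IsSymplectic σ) (w : Model m) (j : Fin m) :
    ∑ i, σ w (stdVec i) * poissonMatrix σ i j = -w j := by
  have h1 : ∀ i, σ w (stdVec i) = ∑ k, w k * gramMatrix σ k i := by
    intro i
    conv_lhs => rw [← sum_stdVec w]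
    simp [gramMatrix, sum_apply]
  simp only [h1, Finset.sum_mul]
  rw [Finset.sum_comm]
  have h2 : ∀ k, ∑ i, w k * gramMatrix σ k i * poissonMatrix σ i j = if k = j then -w k else 0 := by
    intro k
    have h3 := congrFun (congrFun hσ.gramMatrix_mul_poissonMatrix k) j
    rw [Matrix.mul_apply] at h3
    simp only [mul_assoc, ← Finset.mul_sum]
    rw [h3]
    by_cases hk : k = j <;> simp [hk]
  simp only [h2]
  simp

theorem IsSymplectic.poissonContraction_covector_left (hσ : IsSymplectic σ) (w : Model m)
    (g : FormalFunctions (Model m)) :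
    poissonContraction σ 1 (FormalFunctions.ofLinear (σ w)) g = -pd w g := by
  have h : pd w g = ∑ j, (w j : ℂ) • pd (stdVec j) g := by
    rw [← pd_sum, sum_stdVec]
  rw [poissonContraction, contraction_succ, Finset.sum_comm, h, ← Finset.sum_neg_distrib]
  refine Finset.sum_congr rfl fun j _ => ?_
  simp only [contraction_zero, pd_ofLinear, ← Algebra.smul_def, smul_smul]
  rw [← Finset.sum_smul, ← neg_smul]
  congr 1
  have := hσ.sum_apply_mul_poissonMatrix w j
  rw [← Complex.ofReal_neg, ← this]
  push_cast
  exact Finset.sum_congr rfl fun i _ => mul_comm _ _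

theorem IsSymplectic.poissonContraction_covector_right (hσ : IsSymplectic σ) (w : Model m)
    (g : FormalFunctions (Model m)) :
    poissonContraction σ 1 g (FormalFunctions.ofLinear (σ w)) = pd w g := by
  rw [← neg_neg (pd w g), ← hσ.poissonContraction_covector_left]
  rw [poissonContraction, contraction_succ, contraction_succ, Finset.sum_comm,
    ← Finset.sum_neg_distrib]
  refine Finset.sum_congr rfl fun j _ => ?_
  rw [← Finset.sum_neg_distrib]
  refine Finset.sum_congr rfl fun i _ => ?_
  rw [contraction_zero, contraction_zero, hσ.poissonMatrix_swap i j, mul_comm, Complex.ofReal_neg,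
    neg_smul]

/-- The commutator with the covector `σ(w, -)` is `-iħ ∂_w`. -/
theorem IsSymplectic.hbarCoeff_commutator_covector (hσ : IsSymplectic σ) (w : Model m)
    (a : WeylFiber σ) (l : ℕ) :
    hbarCoeff (l + 1) (covector σ w * a - a * covector σ w) =
      -(Complex.I • pd w (hbarCoeff l a)) := by
  rw [map_sub, covector, hbarCoeff_ofLinear_mul, hbarCoeff_mul_ofLinear,
    hσ.poissonContraction_covector_left, hσ.poissonContraction_covector_right,
    mul_comm (hbarCoeff (l + 1) a)]
  have : Complex.I = Complex.I / 2 + Complex.I / 2 := by ring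
  conv_rhs => rw [this, add_smul]
  rw [smul_neg]
  abel

theorem sub_covector_mem_filtration {b : WeylFiber σ} {w : Model m}
    (hb : b ∈ filtration σ 1) (h1 : ∀ v, hcomp 1 (hbarCoeff 0 b) v = (σ w v : ℂ)) :
    b - covector σ w ∈ filtration σ 2 := by
  intro k l h
  obtain rfl : l = 0 := by omega
  funext v
  have h2 : hcomp k (hbarCoeff 0 (b - covector σ w)) v =
      hcomp k (hbarCoeff 0 b) v - hcomp k (hbarCoeff 0 (covector σ w)) v := by
    rw [map_sub]
    rfl
  rw [h2, covector, hbarCoeff_ofCoeff, if_pos rfl, FormalFunctions.hcomp_ofLinear]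
  by_cases hk : k = 1
  · subst hk
    simp [h1]
  · obtain rfl : k = 0 := by omega
    rw [hb 0 0 (by omega)]
    simp

theorem commutator_mem_filtration {a b : WeylFiber σ} {M N : ℕ} (ha : a ∈ filtration σ M)
    (hb : b ∈ filtration σ N) : a * b - b * a ∈ filtration σ (M + N) :=
  sub_mem (mul_mem_filtration ha hb) (by rw [add_comm]; exact mul_mem_filtration hb ha)

/-- If the part of degree one of `b` is the covector `σ(w, -)`, then the leading term of `[b, a]` is
`-iħ` times the derivative of the leading term of `a` in the direction `w`. -/
theorem IsSymplectic.hcomp_commutator (hσ : IsSymplectic σ) {a b : WeylFiber σ} {w : Model m}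
    (hb : b ∈ filtration σ 1) (h1 : ∀ v, hcomp 1 (hbarCoeff 0 b) v = (σ w v : ℂ))
    {k l : ℕ} (ha : a ∈ filtration σ (k + 2 * l + 1)) :
    hcomp k (hbarCoeff (l + 1) (b * a - a * b)) =
      -(Complex.I • hcomp k (pd w (hbarCoeff l a))) := by
  -- `b` minus its covector part has degree at least two and cannot contribute in this degree.
  have h2 : b * a - a * b = (covector σ w * a - a * covector σ w) +
      ((b - covector σ w) * a - a * (b - covector σ w)) := by
    noncomm_ring
  have h3 := commutator_mem_filtration (sub_covector_mem_filtration hb h1) ha k (l + 1) (by omega)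
  rw [h2, map_add, hcomp_add, h3, add_zero, hσ.hbarCoeff_commutator_covector]
  rfl

theorem hbarCoeff_succ_smul (a : WeylFiber σ) (l : ℕ) :
    hbarCoeff (l + 1) ((PowerSeries.C Complex.I * PowerSeries.X : PowerSeries ℂ) • a) =
      Complex.I • hbarCoeff l a := by
  rw [Algebra.smul_def]
  refine (hbarCoeff_scalar_mul _ a (l + 1)).trans ?_
  rw [Finset.sum_eq_single (1, l)]
  · simp
  · rintro ⟨s, t⟩ hp hne
    rw [PowerSeries.coeff_C_mul, PowerSeries.coeff_X, if_neg, mul_zero, zero_smul]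
    rintro rfl
    simp only [Finset.HasAntidiagonal.mem_antidiagonal] at hp
    exact hne (by congr 1; omega)
  · intro h
    exact absurd (Finset.HasAntidiagonal.mem_antidiagonal.2 (by simp [add_comm])) h

end WeylFiber

/-! ### Components of sections of the Weyl bundle -/

theorem FormalFunctions.hcomp_ofLinear_mul_succ {E : Type*} [NormedAddCommGroup E]
    [NormedSpace ℝ E] (φ : E →L[ℝ] ℝ) (f : FormalFunctions E) (k : ℕ) (v : E) :
    hcomp (k + 1) (FormalFunctions.ofLinear φ * f) v = (φ v : ℂ) * hcomp k f v := by
  rw [hcomp_mul, Finset.sum_apply, Finset.sum_eq_single (1, k)]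
  · simp [FormalFunctions.hcomp_ofLinear]
  · rintro ⟨s, t⟩ hp hne
    simp only [Finset.HasAntidiagonal.mem_antidiagonal] at hp
    rw [Pi.mul_apply, FormalFunctions.hcomp_ofLinear, if_neg, zero_mul]
    rintro rfl
    exact hne (by congr 1; omega)
  · intro h
    exact absurd (Finset.HasAntidiagonal.mem_antidiagonal.2 (by simp [add_comm])) h

theorem FormalFunctions.hcomp_ofLinear_mul_zero {E : Type*} [NormedAddCommGroup E]
    [NormedSpace ℝ E] (φ : E →L[ℝ] ℝ) (f : FormalFunctions E) (v : E) :
    hcomp 0 (FormalFunctions.ofLinear φ * f) v = 0 := by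
  rw [hcomp_mul]
  simp [FormalFunctions.hcomp_ofLinear]

theorem FormalFunctions.hcomp_sum_ofLinear_mul_succ {m : ℕ} (A : Model m →L[ℝ] Model m)
    (f : Fin m → FormalFunctions (Model m)) (k : ℕ) (v : Model m) :
    hcomp (k + 1)
        (∑ i, FormalFunctions.ofLinear ((EuclideanSpace.proj (𝕜 := ℝ) i).comp A) * f i) v =
      ∑ i, (A v i : ℂ) * hcomp k (f i) v := by
  rw [hcomp_sum, Finset.sum_apply]
  exact Finset.sum_congr rfl fun i _ => FormalFunctions.hcomp_ofLinear_mul_succ _ _ _ _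

theorem FormalFunctions.hcomp_sum_ofLinear_mul_zero {m : ℕ} (A : Model m →L[ℝ] Model m)
    (f : Fin m → FormalFunctions (Model m)) (v : Model m) :
    hcomp 0 (∑ i, FormalFunctions.ofLinear ((EuclideanSpace.proj (𝕜 := ℝ) i).comp A) * f i) v =
      0 := by
  rw [hcomp_sum, Finset.sum_apply]
  exact Finset.sum_eq_zero fun i _ => FormalFunctions.hcomp_ofLinear_mul_zero _ _ _

theorem WeylFiber.hbarCoeff_scalar_C_mul {m : ℕ} {σ : Model m →L[ℝ] Model m →L[ℝ] ℝ} (z : ℂ)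
    (a : WeylFiber σ) (l : ℕ) :
    WeylFiber.hbarCoeff l (WeylFiber.scalar (PowerSeries.C z) * a) =
      z • WeylFiber.hbarCoeff l a := by
  rw [WeylFiber.hbarCoeff_scalar_mul, Finset.sum_eq_single (0, l)]
  · simp
  · rintro ⟨s, t⟩ hp hne
    obtain _ | s := s
    · simp_all
    · simp
  · simp

theorem WeylFiber.hbarCoeff_C_smul {m : ℕ} {σ : Model m →L[ℝ] Model m →L[ℝ] ℝ} (z : ℂ)
    (a : WeylFiber σ) (l : ℕ) :
    WeylFiber.hbarCoeff l ((PowerSeries.C z : PowerSeries ℂ) • a) =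
      z • WeylFiber.hbarCoeff l a := by
  rw [Algebra.smul_def]
  exact WeylFiber.hbarCoeff_scalar_C_mul z a l

theorem mul_self_smul_eq_sum_of_comp_eq_id {m : ℕ} {A B : Model m →L[ℝ] Model m}
    (h : A.comp B = ContinuousLinearMap.id ℝ (Model m)) (c : ℝ) (v : Model m) :
    (c * c) • v = ∑ i, (c * B v i) • (c • A (stdVec i)) := by
  have h1 : A (B v) = v := DFunLike.congr_fun h v
  have h2 := congrArg A (sum_stdVec (B v))
  rw [h1, map_sum] at h2
  conv_lhs => rw [← h2]
  rw [Finset.smul_sum]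
  refine Finset.sum_congr rfl fun i _ => ?_
  rw [map_smul, smul_smul, smul_smul]
  congr 1
  ring

section Components
variable {m : ℕ} {M : Type*} [TopologicalSpace M] [ChartedSpace (Model m) M]
  [IsManifold 𝓘(ℝ, Model m) ∞ M] {σ : SymplecticForm m M}

theorem SymplecticForm.isSymplectic_at (σ : SymplecticForm m M) (x : M) :
    WeylFiber.IsSymplectic (σ.at x) :=
  ⟨fun v => σ.alternating x v, fun v h => σ.nondegenerate x v h⟩

namespace WeylSections

theorem component_add (a b : WeylSections σ) (k l : ℕ) (x : M)
    (v : TangentSpace 𝓘(ℝ, Model m) x) :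
    (a + b).component k l x v = a.component k l x v + b.component k l x v := by
  have h : (a + b).eval x = a.eval x + b.eval x := rfl
  rw [component, h, map_add, hcomp_add]
  rfl

/-- Taking a component, as an additive map. -/
noncomputable def componentHom (k l : ℕ) (x : M) (v : TangentSpace 𝓘(ℝ, Model m) x) :
    WeylSections σ →+ ℂ :=
  AddMonoidHom.mk' (fun a => a.component k l x v) fun a b => component_add a b k l x v

theorem component_sub (a b : WeylSections σ) (k l : ℕ) (x : M)
    (v : TangentSpace 𝓘(ℝ, Model m) x) :
    (a - b).component k l x v = a.component k l x v - b.component k l x v :=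
  map_sub (componentHom k l x v) a b

theorem component_zero (k l : ℕ) (x : M) (v : TangentSpace 𝓘(ℝ, Model m) x) :
    (0 : WeylSections σ).component k l x v = 0 :=
  map_zero (componentHom (σ := σ) k l x v)

theorem component_sum {ι : Type*} (s : Finset ι) (a : ι → WeylSections σ) (k l : ℕ) (x : M)
    (v : TangentSpace 𝓘(ℝ, Model m) x) :
    (∑ i ∈ s, a i).component k l x v = ∑ i ∈ s, (a i).component k l x v :=
  map_sum (componentHom k l x v) a s

theorem hbarCoeff_eval_ofCoeff (s : ℕ → M → FormalFunctions (Model m))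
    (hs : ∀ l, IsSmoothFamily (s l)) (l : ℕ) (x : M) :
    WeylFiber.hbarCoeff l ((ofCoeff s hs : WeylSections σ).eval x) = s l x :=
  WeylFiber.hbarCoeff_ofCoeff (σ := σ.at x) (fun l => s l x) l

theorem component_ofFunction (f : C^∞⟮𝓘(ℝ, Model m), M; 𝓘(ℝ, ℂ), ℂ⟯) (k l : ℕ) (x : M)
    (v : TangentSpace 𝓘(ℝ, Model m) x) :
    (ofFunction f : WeylSections σ).component k l x v = if k = 0 ∧ l = 0 then f x else 0 := by
  have h : WeylFiber.hbarCoeff l ((ofFunction f : WeylSections σ).eval x) =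
      algebraMap ℂ (FormalFunctions (Model m)) (if l = 0 then f x else 0) :=
    hbarCoeff_eval_ofCoeff (σ := σ)
      (fun l x => algebraMap ℂ (FormalFunctions (Model m)) (if l = 0 then f x else 0)) _ l x
  rw [component, h, hcomp_algebraMap]
  by_cases hk : k = 0 <;> by_cases hl : l = 0 <;> simp [hk, hl]

theorem eval_ofFunction (f : C^∞⟮𝓘(ℝ, Model m), M; 𝓘(ℝ, ℂ), ℂ⟯) (x : M) :
    (ofFunction f : WeylSections σ).eval x = WeylFiber.scalar (PowerSeries.C (f x)) :=
  WeylFiber.ext fun l => by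
    rw [WeylFiber.scalar, WeylFiber.hbarCoeff_ofCoeff, PowerSeries.coeff_C]
    exact hbarCoeff_eval_ofCoeff (σ := σ)
      (fun l x => algebraMap ℂ (FormalFunctions (Model m)) (if l = 0 then f x else 0)) _ l x

theorem component_ofRealFunction_mul (f : C^∞⟮𝓘(ℝ, Model m), M; ℝ⟯) (a : WeylSections σ) (k l : ℕ)
    (x : M) (v : TangentSpace 𝓘(ℝ, Model m) x) :
    (ofRealFunction f * a).component k l x v = (f x : ℂ) * a.component k l x v := by
  have h : (ofRealFunction f * a).eval x =
      WeylFiber.scalar (PowerSeries.C (f x : ℂ)) * a.eval x := by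
    have h1 := eval_ofFunction (σ := σ)
      ⟨fun x => (f x : ℂ), Complex.ofRealCLM.contMDiff.comp f.contMDiff⟩ x
    have h2 : (ofRealFunction f * a).eval x = (ofRealFunction f).eval x * a.eval x := rfl
    rw [h2]
    exact congrArg (· * a.eval x) h1
  rw [component, h, WeylFiber.hbarCoeff_scalar_C_mul, hcomp_csmul]
  rfl

/-- The section whose component of degree `k` and order `l` in `ħ` is that of `F k l`. -/
noncomputable def assemble (F : ℕ → ℕ → WeylSections σ) : WeylSections σ :=
  ofCoeff (fun l x => FormalFunctions.ofComponents
      (fun k => hcomp k (WeylFiber.hbarCoeff l ((F k l).eval x)))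
      (fun _ => contDiff_hcomp _ _) fun _ _ _ => hcomp_smul _ _ _ _)
    fun l k => by
      simp only [FormalFunctions.hcomp_ofComponents]
      exact (F k l).contMDiff_component k l

theorem component_assemble (F : ℕ → ℕ → WeylSections σ) (k l : ℕ) (x : M)
    (v : TangentSpace 𝓘(ℝ, Model m) x) :
    (assemble F).component k l x v = (F k l).component k l x v := by
  have h : WeylFiber.hbarCoeff l ((assemble F).eval x) = FormalFunctions.ofComponents
      (fun k => hcomp k (WeylFiber.hbarCoeff l ((F k l).eval x)))
      (fun _ => contDiff_hcomp _ _) fun _ _ _ => hcomp_smul _ _ _ _ :=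
    hbarCoeff_eval_ofCoeff (σ := σ) (fun l x => FormalFunctions.ofComponents
      (fun k => hcomp k (WeylFiber.hbarCoeff l ((F k l).eval x)))
      (fun _ => contDiff_hcomp _ _) fun _ _ _ => hcomp_smul _ _ _ _) _ l x
  rw [component, h, FormalFunctions.hcomp_ofComponents]
  rfl

theorem component_C_smul (z : ℂ) (a : WeylSections σ) (k l : ℕ) (x : M)
    (v : TangentSpace 𝓘(ℝ, Model m) x) :
    ((PowerSeries.C z : PowerSeries ℂ) • a).component k l x v = z * a.component k l x v := by
  have h : ((PowerSeries.C z : PowerSeries ℂ) • a).eval x =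
      (PowerSeries.C z : PowerSeries ℂ) • a.eval x := rfl
  rw [component, h, WeylFiber.hbarCoeff_C_smul, hcomp_csmul]
  rfl

end WeylSections
end Components

/-! ### Tensoriality and the Euler contraction -/

section LocalFields
variable {m : ℕ} {M : Type*} [TopologicalSpace M] [ChartedSpace (Model m) M]
  [IsManifold 𝓘(ℝ, Model m) ∞ M]

/-- A bump function around `x₀`, equal to `1` near `x₀` and supported in the chart at `x₀`. -/
noncomputable def cutoff (x₀ : M) : SmoothBumpFunction 𝓘(ℝ, Model m) x₀ :=
  Classical.arbitrary _

theorem cutoff_eq_zero {x₀ x : M}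
    (hx : x ∉ (trivializationAt (Model m) (TangentSpace 𝓘(ℝ, Model m)) x₀).baseSet) :
    (cutoff (m := m) x₀) x = 0 := by
  rw [TangentBundle.trivializationAt_baseSet] at hx
  by_contra h
  exact hx ((cutoff (m := m) x₀).support_subset_source h)

/-- The vector field `frameMap x₀ x v`, cut off outside of the chart at `x₀`. -/
noncomputable def localField [T2Space M] (x₀ : M) (v : Model m) : VField m M :=
  ⟨(cutoff (m := m) x₀ : M → ℝ) • fun x => (frameMap x₀ x v : TangentSpace 𝓘(ℝ, Model m) x), by
    let e := trivializationAt (Model m) (TangentSpace 𝓘(ℝ, Model m)) x₀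
    refine ContMDiffOn.smul_section_of_tsupport (u := e.baseSet)
      (cutoff (m := m) x₀).contMDiff.contMDiffOn e.open_baseSet ?_ ?_
    · rw [TangentBundle.trivializationAt_baseSet]
      exact (cutoff (m := m) x₀).tsupport_subset_chartAt_source
    · have h1 : ContMDiffOn 𝓘(ℝ, Model m) (𝓘(ℝ, Model m).prod 𝓘(ℝ, Model m)) ∞
          (fun x : M => (x, v)) e.baseSet := contMDiffOn_id.prodMk contMDiffOn_const
      have h2 := (e.contMDiffOn_symm (IB := 𝓘(ℝ, Model m)) (n := ∞)).comp h1
        (fun x hx => e.mem_target.2 hx)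
      refine h2.congr fun x hx => ?_
      have := e.mk_symm hx v
      rw [← e.symmL_apply (R := ℝ) hx] at this
      exact this⟩

theorem localField_apply [T2Space M] (x₀ : M) (v : Model m) (x : M) :
    localField x₀ v x = (cutoff (m := m) x₀) x • frameMap x₀ x v := rfl

/-- Every tangent vector extends to a smooth vector field. -/
theorem exists_vField_apply_eq [T2Space M] (x : M) (v : TangentSpace 𝓘(ℝ, Model m) x) :
    ∃ X : VField m M, X x = v := by
  refine ⟨localField x (coframeMap x x v), ?_⟩
  rw [localField_apply, SmoothBumpFunction.eq_one, one_smul]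
  exact DFunLike.congr_fun (frameMap_comp_coframeMap
    (FiberBundle.mem_baseSet_trivializationAt' x)) v

/-- The coordinates of a tangent vector in the local frame are smooth functions on `TM`. -/
theorem contMDiffAt_coframeMap (x₀ : M) (p : TangentBundle 𝓘(ℝ, Model m) M)
    (hp : p.1 ∈ (trivializationAt (Model m) (TangentSpace 𝓘(ℝ, Model m)) x₀).baseSet) (i : Fin m) :
    ContMDiffAt (𝓘(ℝ, Model m).tangent) 𝓘(ℝ, ℝ) ∞
      (fun q : TangentBundle 𝓘(ℝ, Model m) M => coframeMap x₀ q.1 q.2 i) p := by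
  let e := trivializationAt (Model m) (TangentSpace 𝓘(ℝ, Model m)) x₀
  have h0 : p ∈ e.source := e.mem_source.2 hp
  have h1 : ContMDiffAt (𝓘(ℝ, Model m).tangent) (𝓘(ℝ, Model m).prod 𝓘(ℝ, Model m)) ∞ e p :=
    (e.contMDiffOn (IB := 𝓘(ℝ, Model m)) (n := ∞)).contMDiffAt (e.open_source.mem_nhds h0)
  have h2 : ContMDiffAt (𝓘(ℝ, Model m).tangent) 𝓘(ℝ, ℝ) ∞ (fun q => (e q).2 i) p :=
    ((EuclideanSpace.proj (𝕜 := ℝ) i).contMDiff.contMDiffAt).comp p h1.snd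
  refine h2.congr_of_eventuallyEq ?_
  filter_upwards [e.open_source.mem_nhds h0] with q hq
  have hq' : q.1 ∈ e.baseSet := e.mem_source.1 hq
  have h5 : coframeMap x₀ q.1 q.2 = (e q).2 :=
    e.continuousLinearMapAt_apply_of_mem (R := ℝ) hq' q.2
  rw [h5]

/-- The coordinates of a vector field in the local frame around `x₀`, cut off. -/
noncomputable def localCoordinate [T2Space M] (x₀ : M) (X : VField m M) (i : Fin m) :
    C^∞⟮𝓘(ℝ, Model m), M; ℝ⟯ :=
  ⟨(cutoff (m := m) x₀ : M → ℝ) • fun x => coframeMap x₀ x (X x) i, by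
    refine (cutoff (m := m) x₀).contMDiff_smul fun x hx => ContMDiffAt.contMDiffWithinAt ?_
    rw [← TangentBundle.trivializationAt_baseSet (I := 𝓘(ℝ, Model m))] at hx
    exact (contMDiffAt_coframeMap x₀ ⟨x, X x⟩ hx i).comp x (X.contMDiff x)⟩

theorem localCoordinate_apply [T2Space M] (x₀ : M) (X : VField m M) (i : Fin m) (x : M) :
    localCoordinate x₀ X i x = (cutoff (m := m) x₀) x * coframeMap x₀ x (X x) i := rfl

/-- The square of the cut-off function around `x₀`. -/
noncomputable def cutoffSq [T2Space M] (x₀ : M) : C^∞⟮𝓘(ℝ, Model m), M; ℝ⟯ :=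
  ⟨fun x => (cutoff (m := m) x₀) x * (cutoff (m := m) x₀) x,
    (cutoff (m := m) x₀).contMDiff.mul (cutoff (m := m) x₀).contMDiff⟩

/-- A vector field, multiplied by the square of the cut-off function, is globally a combination of
local frame fields; one factor makes the frame global, the other one the coordinates. -/
theorem smulField_cutoffSq [T2Space M] (x₀ : M) (X : VField m M) :
    smulField (cutoffSq x₀) X =
      ∑ i, smulField (localCoordinate x₀ X i) (localField x₀ (stdVec i)) := by
  refine ContMDiffSection.ext fun x => ?_
  have h : ∀ s : Finset (Fin m),
      (∑ i ∈ s, smulField (localCoordinate x₀ X i) (localField x₀ (stdVec i))) x =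
      ∑ i ∈ s, localCoordinate x₀ X i x • localField x₀ (stdVec i) x := by
    intro s
    induction s using Finset.cons_induction with
    | empty => rfl
    | cons a s ha ih => rw [Finset.sum_cons, Finset.sum_cons, ← ih]; rfl
  rw [h]
  change ((cutoff (m := m) x₀) x * (cutoff (m := m) x₀) x) • X x = _
  by_cases hx : x ∈ (trivializationAt (Model m) (TangentSpace 𝓘(ℝ, Model m)) x₀).baseSet
  · exact mul_self_smul_eq_sum_of_comp_eq_id (frameMap_comp_coframeMap hx) _ _
  · rw [cutoff_eq_zero hx, zero_mul, zero_smul]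
    symm
    refine Finset.sum_eq_zero fun i _ => ?_
    rw [localCoordinate_apply, cutoff_eq_zero hx, zero_mul, zero_smul]

variable {σ : SymplecticForm m M}

namespace WeylOneForm

theorem map_sum (T : WeylOneForm σ) {ι : Type*} (s : Finset ι) (X : ι → VField m M) :
    T.toFun (∑ i ∈ s, X i) = ∑ i ∈ s, T.toFun (X i) :=
  _root_.map_sum (AddMonoidHom.mk' T.toFun T.map_add) X s

variable [T2Space M]

/-- A one-form is determined near `x₀` by its values on the local frame. -/
theorem component_eq_sum (T : WeylOneForm σ) {x₀ x : M} (hx : (cutoff (m := m) x₀) x = 1)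
    (X : VField m M) (k l : ℕ) (v : TangentSpace 𝓘(ℝ, Model m) x) :
    (T.toFun X).component k l x v =
      ∑ i, (coframeMap x₀ x (X x) i : ℂ) *
        (T.toFun (localField x₀ (stdVec i))).component k l x v := by
  have h := congrArg (fun a => WeylSections.component (T.toFun a) k l x v)
    (smulField_cutoffSq x₀ X)
  simp only [T.map_sum, T.map_smul, WeylSections.component_sum,
    WeylSections.component_ofRealFunction_mul, localCoordinate_apply] at h
  have h1 : cutoffSq x₀ x = (cutoff (m := m) x₀) x * (cutoff (m := m) x₀) x := rfl
  simpa [h1, hx] using h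

theorem eulerContraction_isSmoothFamily (T : WeylOneForm σ) (l : ℕ) :
    IsSmoothFamily fun x : M => ∑ i, FormalFunctions.ofLinear
      ((EuclideanSpace.proj (𝕜 := ℝ) i).comp (coframeMap x x)) *
      WeylFiber.hbarCoeff l ((T.toFun (localField x (stdVec i))).eval x) := by
  intro k p₀
  obtain _ | k := k
  · refine (contMDiffAt_const (c := (0 : ℂ))).congr_of_eventuallyEq
      (Filter.Eventually.of_forall fun p => ?_)
    exact FormalFunctions.hcomp_sum_ofLinear_mul_zero _ _ p.2
  have h1 : ContMDiffAt (𝓘(ℝ, Model m).tangent) 𝓘(ℝ, ℂ) ∞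
      (fun p : TangentBundle 𝓘(ℝ, Model m) M => ∑ i, (coframeMap p₀.1 p.1 p.2 i : ℂ) *
        (T.toFun (localField p₀.1 (stdVec i))).component k l p.1 p.2) p₀ := by
    refine contMDiffAt_finsetSum fun i _ => contMDiffAt_mul_complex ?_
      (WeylSections.contMDiff_component _ k l p₀)
    exact (Complex.ofRealCLM.contMDiff.contMDiffAt).comp p₀ (contMDiffAt_coframeMap p₀.1 p₀
      (FiberBundle.mem_baseSet_trivializationAt' p₀.1) i)
  refine h1.congr_of_eventuallyEq ?_
  have h2 : ∀ᶠ p : TangentBundle 𝓘(ℝ, Model m) M in nhds p₀,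
      (cutoff (m := m) p₀.1) p.1 = 1 :=
    (FiberBundle.continuous_proj (Model m)
      (TangentSpace 𝓘(ℝ, Model m))).continuousAt.eventually
      (cutoff (m := m) p₀.1).eventuallyEq_one
  filter_upwards [h2] with p hp
  obtain ⟨X, hX⟩ := exists_vField_apply_eq p.1 p.2
  have h3 := T.component_eq_sum hp X k l p.2
  have h4 := T.component_eq_sum (cutoff (m := m) p.1).eq_one X k l p.2
  rw [hX] at h3 h4
  rw [← h3, h4]
  exact FormalFunctions.hcomp_sum_ofLinear_mul_succ _ _ k p.2

/-- The contraction of a one-form with the tautological vector field: its value on the tangent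
vector `v` is the value on `v` of the one-form applied to `v`. It raises the degree on the tangent
spaces by one. -/
noncomputable def eulerContraction (T : WeylOneForm σ) : WeylSections σ :=
  WeylSections.ofCoeff (fun l x => ∑ i, FormalFunctions.ofLinear
      ((EuclideanSpace.proj (𝕜 := ℝ) i).comp (coframeMap x x)) *
      WeylFiber.hbarCoeff l ((T.toFun (localField x (stdVec i))).eval x))
    T.eulerContraction_isSmoothFamily

/-- The Euler contraction at `x`, in the frame around `x` itself, where the cut-off is `1`. -/
theorem component_eulerContraction_succ (T : WeylOneForm σ) (k l : ℕ) (x : M)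
    (v : TangentSpace 𝓘(ℝ, Model m) x) :
    T.eulerContraction.component (k + 1) l x v =
      ∑ i, (coframeMap x x v i : ℂ) * (T.toFun (localField x (stdVec i))).component k l x v := by
  have h := WeylSections.hbarCoeff_eval_ofCoeff (σ := σ)
    (fun l x => ∑ i, FormalFunctions.ofLinear
      ((EuclideanSpace.proj (𝕜 := ℝ) i).comp (coframeMap x x)) *
      WeylFiber.hbarCoeff l ((T.toFun (localField x (stdVec i))).eval x))
    T.eulerContraction_isSmoothFamily l x
  refine (congrArg (fun f => hcomp (E := Model m) (k + 1) f v) h).trans ?_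
  exact FormalFunctions.hcomp_sum_ofLinear_mul_succ _ _ k v

end WeylOneForm
end LocalFields

/-! ### Flat sections of a Fedosov connection -/

theorem fderiv_apply_eq_zero_of_forall_eq {E : Type*} [NormedAddCommGroup E] [NormedSpace ℝ E]
    {F : E → ℂ} {c : ℂ} (h : ∀ u, F u = c) (v w : E) : fderiv ℝ F v w = 0 := by
  rw [show F = fun _ => c from funext h]
  simp

section FlatSections
variable {m : ℕ} {M : Type*} [TopologicalSpace M] [ChartedSpace (Model m) M]
  [IsManifold 𝓘(ℝ, Model m) ∞ M] {σ : SymplecticForm m M}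

namespace WeylSections

/-- The sections of the Weyl bundle all of whose terms have degree at least `N`, where covectors
have degree `1` and `ħ` has degree `2`. -/
noncomputable def filtration (σ : SymplecticForm m M) (N : ℕ) : AddSubgroup (WeylSections σ) where
  carrier := {a | ∀ k l, k + 2 * l < N → ∀ x v, a.component k l x v = 0}
  zero_mem' := fun k l _ x v => component_zero k l x v
  add_mem' := fun ha hb k l h x v => by
    rw [component_add, ha k l h x v, hb k l h x v, add_zero]
  neg_mem' := fun {a} ha k l h x v => by
    rw [← zero_sub, component_sub, ha k l h x v, component_zero, sub_zero]

theorem filtration_anti {N N' : ℕ} (h : N ≤ N') : filtration σ N' ≤ filtration σ N :=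
  fun _ ha k l hkl => ha k l (by omega)

theorem eval_mem_filtration {a : WeylSections σ} {N : ℕ} (ha : a ∈ filtration σ N) (x : M) :
    a.eval x ∈ WeylFiber.filtration (σ.at x) N :=
  fun k l h => funext fun v => ha k l h x v

theorem eq_zero_of_mem_filtration {a : WeylSections σ} (ha : ∀ N, a ∈ filtration σ N) : a = 0 :=
  ext_component fun k l x v => by
    rw [component_zero]
    exact ha (k + 2 * l + 1) k l (by omega) x v

end WeylSections

namespace WeylConnection

/-- The covariant derivative of a section, as a one-form. -/
noncomputable def oneForm (D : WeylConnection σ) (a : WeylSections σ) : WeylOneForm σ :=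
  ⟨fun X => D.toFun X a, fun X Y => D.map_add X Y a, fun f X => D.map_smul f X a⟩

variable {D : WeylConnection σ} [T2Space M]

/-- A Fedosov connection lowers the degree by at most one, and its part of degree `-1` is the
derivative along the fibres: `∇_X a = -∂_X a + ⋯`. -/
theorem IsFedosov.component_toFun (hD : D.IsFedosov) {a : WeylSections σ} {k l : ℕ}
    (ha : a ∈ WeylSections.filtration σ (k + 2 * l + 1)) (X : VField m M) (x : M)
    (v : TangentSpace 𝓘(ℝ, Model m) x) :
    (D.toFun X a).component k l x v =
      -fderiv ℝ (E := Model m) (a.component (k + 1) l x) v (X x) := by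
  obtain ⟨-, D₁, D₀, B, -, hD₀, hB1, hB0, -, hB⟩ := hD
  -- The induced connection preserves both degrees, so it does not contribute in degree `k + 2l`.
  have h0 : (D₀ X a).component k l x v = 0 := by
    obtain ⟨Y, hY⟩ := exists_vField_apply_eq x v
    have h1 : ∀ y u, a.component k l y u = 0 := ha k l (by omega)
    have h2 := hD₀ X Y a k l x
    have h3 : fderiv ℝ (E := Model m) (a.component k l x) (Y x) (D₁ Y x (X x)) = 0 :=
      fderiv_apply_eq_zero_of_forall_eq (E := Model m) (h1 x) _ _
    rw [h3, sub_zero, hY] at h2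
    rw [h2]
    simp only [h1]
    rw [mvfderiv_const]
    rfl
  have h1 : WeylFiber.hbarCoeff (l + 1)
      ((PowerSeries.C Complex.I * PowerSeries.X : PowerSeries ℂ) • (D.toFun X a - D₀ X a).eval x) =
      WeylFiber.hbarCoeff (l + 1) ((B.toFun X).eval x * a.eval x - a.eval x * (B.toFun X).eval x) :=
    congrArg (fun c : WeylSections σ => WeylFiber.hbarCoeff (l + 1) (c.eval x)) (hB X a)
  have h2 : (B.toFun X).eval x ∈ WeylFiber.filtration (σ.at x) 1 := fun k l h =>
    funext fun v => hB0 X k l x v (Or.inl (by omega))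
  have h3 := (σ.isSymplectic_at x).hcomp_commutator (w := X x) h2 (fun v => hB1 X x v)
    (WeylSections.eval_mem_filtration ha x)
  rw [← h1, WeylFiber.hbarCoeff_succ_smul] at h3
  have h4 := congrFun h3 v
  rw [hcomp_csmul] at h4
  have h5 : Complex.I * (D.toFun X a - D₀ X a).component k l x v =
      -(Complex.I * fderiv ℝ (E := Model m) (a.component (k + 1) l x) v (X x)) := by
    refine h4.trans ?_
    exact congrArg (fun z => -(Complex.I * z)) (hcomp_pd _ _ _ _)
  rw [WeylSections.component_sub, h0, sub_zero, ← mul_neg] at h5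
  exact mul_left_cancel₀ Complex.I_ne_zero h5

theorem IsFedosov.toFun_mem_filtration (hD : D.IsFedosov) {a : WeylSections σ} {N : ℕ}
    (ha : a ∈ WeylSections.filtration σ (N + 1)) (X : VField m M) :
    D.toFun X a ∈ WeylSections.filtration σ N := by
  intro k l h x v
  rw [hD.component_toFun (WeylSections.filtration_anti (by omega) ha)]
  exact neg_eq_zero.2
    (fderiv_apply_eq_zero_of_forall_eq (E := Model m) (ha (k + 1) l (by omega) x) _ _)

/-- Flatness makes the leading term of `∇a` closed along the fibres. -/
theorem IsFedosov.fderiv_component_swap (hD : D.IsFedosov) {a : WeylSections σ} {k l : ℕ}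
    (ha : ∀ X, D.toFun X a ∈ WeylSections.filtration σ (k + 2 * l)) (X Y : VField m M) (x : M)
    (v : TangentSpace 𝓘(ℝ, Model m) x) :
    fderiv ℝ (E := Model m) ((D.toFun Y a).component k l x) v (X x) =
      fderiv ℝ (E := Model m) ((D.toFun X a).component k l x) v (Y x) := by
  obtain _ | k := k
  · have h : ∀ Z W : VField m M,
        fderiv ℝ (E := Model m) ((D.toFun Z a).component 0 l x) v (W x) = 0 := fun Z W =>
      fderiv_apply_eq_zero_of_forall_eq (hcomp_degree_zero _) _ _
    rw [h, h]
  · -- In this degree the curvature identity only involves the leading terms, as `∇_[X, Y] a` starts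
    -- one degree higher.
    have h1 := congrArg (fun c => WeylSections.component c k l x v) (hD.1 X Y a)
    have ha' : ∀ X, D.toFun X a ∈ WeylSections.filtration σ (k + 2 * l + 1) := fun X =>
      WeylSections.filtration_anti (by omega) (ha X)
    simp only [WeylSections.component_sub] at h1
    rw [hD.component_toFun (ha' Y), hD.component_toFun (ha' X), ha' _ k l (by omega)] at h1
    linear_combination -h1

end WeylConnection

/-- The Poincaré lemma for homogeneous polynomial one-forms `∑ᵢ fᵢ dAᵢ`: contraction with the Euler
field inverts the differential up to the degree. -/
theorem fderiv_sum_mul_hcomp (A : Model m →L[ℝ] Model m) (f : Fin m → FormalFunctions (Model m))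
    (g : FormalFunctions (Model m)) (e : Fin m → Model m) (k : ℕ) (v w : Model m)
    (hsymm : ∀ i, fderiv ℝ (hcomp k (f i)) v w = fderiv ℝ (hcomp k g) v (e i))
    (hv : ∑ i, A v i • e i = v) (hw : ∑ i, (A w i : ℂ) * hcomp k (f i) v = hcomp k g v) :
    fderiv ℝ (fun u => ((k : ℂ) + 1)⁻¹ * ∑ i, (A u i : ℂ) * hcomp k (f i) u) v w = hcomp k g v := by
  have hA : ∀ i, HasFDerivAt (fun u => (A u i : ℂ))
      (Complex.ofRealCLM.comp ((EuclideanSpace.proj (𝕜 := ℝ) i).comp A)) v := fun i =>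
    (Complex.ofRealCLM.comp ((EuclideanSpace.proj (𝕜 := ℝ) i).comp A)).hasFDerivAt
  have h1 := HasFDerivAt.fun_sum (u := Finset.univ) fun i _ =>
    (hA i).mul (differentiableAt_hcomp k (f i) v).hasFDerivAt
  have h2 : fderiv ℝ (fun u => ((k : ℂ) + 1)⁻¹ * ∑ i, (A u i : ℂ) * hcomp k (f i) u) v w =
      ((k : ℂ) + 1)⁻¹ * ∑ i, (((A v i : ℝ) : ℂ) * fderiv ℝ (hcomp k (f i)) v w +
        hcomp k (f i) v * ((A w i : ℝ) : ℂ)) := by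
    refine (DFunLike.congr_fun (h1.const_mul ((k : ℂ) + 1)⁻¹).fderiv w).trans ?_
    rw [smul_apply, sum_apply]
    rfl
  have h3 : ∑ i, ((A v i : ℝ) : ℂ) * fderiv ℝ (hcomp k (f i)) v w = (k : ℂ) * hcomp k g v := by
    simp only [hsymm]
    rw [← fderiv_hcomp_self]
    conv_rhs => rw [show fderiv ℝ (hcomp k g) v v =
      fderiv ℝ (hcomp k g) v (∑ i, A v i • e i) by rw [hv]]
    rw [map_sum]
    exact Finset.sum_congr rfl fun i _ => by rw [map_smul, Complex.real_smul]
  rw [h2, Finset.sum_add_distrib, h3]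
  simp only [mul_comm (hcomp k (f _) v)]
  rw [hw, ← add_one_mul, inv_mul_cancel_left₀ (by exact_mod_cast k.succ_ne_zero)]

theorem sum_coframeMap_smul_localField [T2Space M] (x : M) (v : Model m) :
    ∑ i, coframeMap x x v i • (localField x (stdVec i) x : Model m) = v := by
  have h := mul_self_smul_eq_sum_of_comp_eq_id (frameMap_comp_coframeMap (m := m) (x₀ := x)
    (FiberBundle.mem_baseSet_trivializationAt' x)) 1 v
  simp only [one_mul, one_smul] at h
  conv_rhs => rw [h]
  refine Finset.sum_congr rfl fun i _ => congrArg _ ?_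
  rw [localField_apply, SmoothBumpFunction.eq_one, one_smul]

namespace WeylConnection
variable {D : WeylConnection σ} [T2Space M]

/-- One step of Fedosov's iteration: a section that is flat up to terms of degree `N` can be
corrected in degree `N + 1` so that it is flat up to terms of degree `N + 1`. -/
theorem IsFedosov.exists_correction (hD : D.IsFedosov) (N : ℕ) (a : WeylSections σ)
    (ha : ∀ X, D.toFun X a ∈ WeylSections.filtration σ N) :
    ∃ a', a' - a ∈ WeylSections.filtration σ (N + 1) ∧
      ∀ X, D.toFun X a' ∈ WeylSections.filtration σ (N + 1) := by
  -- The homogeneous part of degree `N + 1` of the Euler contraction of `∇a`, divided by the degree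
  -- on the tangent spaces; the components with `k = 0` vanish whatever the factor.
  let b : WeylSections σ := WeylSections.assemble fun k l => if k + 2 * l = N + 1 then
    (PowerSeries.C (k : ℂ)⁻¹ : PowerSeries ℂ) • (D.oneForm a).eulerContraction else 0
  have hb : b ∈ WeylSections.filtration σ (N + 1) := by
    intro k l h x v
    rw [WeylSections.component_assemble, if_neg (by omega), WeylSections.component_zero]
  refine ⟨a + b, by rwa [add_sub_cancel_left], fun X k l h x v => ?_⟩
  rw [LinearMap.map_add, WeylSections.component_add]
  rcases Nat.lt_or_ge (k + 2 * l) N with h1 | h1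
  · rw [ha X k l h1, hD.toFun_mem_filtration hb X k l h1, add_zero]
  · obtain rfl : N = k + 2 * l := by omega
    rw [hD.component_toFun hb]
    have h2 : b.component (k + 1) l x = fun u => ((k : ℂ) + 1)⁻¹ *
        ∑ i, (coframeMap x x u i : ℂ) *
          hcomp k (WeylFiber.hbarCoeff l ((D.toFun (localField x (stdVec i)) a).eval x)) u := by
      funext u
      rw [WeylSections.component_assemble, if_pos (by omega), WeylSections.component_C_smul,
        WeylOneForm.component_eulerContraction_succ]
      push_cast
      rfl
    have h3 := fderiv_sum_mul_hcomp (coframeMap x x)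
      (fun i => WeylFiber.hbarCoeff l ((D.toFun (localField x (stdVec i)) a).eval x))
      (WeylFiber.hbarCoeff l ((D.toFun X a).eval x)) (fun i => localField x (stdVec i) x) k v (X x)
      (fun i => hD.fderiv_component_swap ha X _ x v) (sum_coframeMap_smul_localField x v)
      ((D.oneForm a).component_eq_sum (cutoff (m := m) x).eq_one X k l v).symm
    rw [h2]
    exact (congrArg (fun z => (D.toFun X a).component k l x v + -z) h3).trans (add_neg_cancel _)

/-- Every section is congruent to a flat one modulo terms of positive degree: Fedosov's iteration
converges for the degree filtration. -/
theorem IsFedosov.exists_flat (hD : D.IsFedosov) (a₀ : WeylSections σ) :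
    ∃ a ∈ D.ker, a - a₀ ∈ WeylSections.filtration σ 1 := by
  choose! c hc hc' using hD.exists_correction
  let s : ℕ → WeylSections σ := fun N => Nat.rec a₀ (fun N a => c N a) N
  have hs : ∀ N X, D.toFun X (s N) ∈ WeylSections.filtration σ N := by
    intro N
    induction N with
    | zero => exact fun X k l h => absurd h (by omega)
    | succ N ih => exact hc' N (s N) ih
  have hs' : ∀ N j, s (N + j) - s N ∈ WeylSections.filtration σ (N + 1) := by
    intro N j
    induction j with
    | zero => rw [add_zero, sub_self]; exact zero_mem _
    | succ j ih =>
      have h := WeylSections.filtration_anti (by omega : N + 1 ≤ N + j + 1)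
        (hc (N + j) (s (N + j)) (hs (N + j)))
      have h2 := add_mem h ih
      rwa [sub_add_sub_cancel] at h2
  -- The components of degree `N` are stationary from the `N`-th approximation on.
  let a : WeylSections σ := WeylSections.assemble fun k l => s (k + 2 * l)
  have ha : ∀ N, a - s N ∈ WeylSections.filtration σ (N + 1) := by
    intro N k l h x v
    have h1 := hs' (k + 2 * l) (N - (k + 2 * l)) k l (by omega) x v
    rw [Nat.add_sub_cancel' (by omega), WeylSections.component_sub] at h1
    rw [WeylSections.component_sub, WeylSections.component_assemble]
    linear_combination -h1
  refine ⟨a, fun X => WeylSections.eq_zero_of_mem_filtration fun N => ?_, ha 0⟩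
  have h := add_mem (hD.toFun_mem_filtration (ha N) X) (hs N X)
  rwa [← LinearMap.map_add, sub_add_cancel] at h

/-- The quantum Taylor expansion of a function starts with its differential. -/
theorem IsFedosov.component_one_zero_of_flat (hD : D.IsFedosov) {a : WeylSections σ}
    (ha : a ∈ D.ker) {f : C^∞⟮𝓘(ℝ, Model m), M; 𝓘(ℝ, ℂ), ℂ⟯}
    (haf : a - WeylSections.ofFunction f ∈ WeylSections.filtration σ 1) (x : M)
    (v : TangentSpace 𝓘(ℝ, Model m) x) :
    (a - WeylSections.ofFunction f).component 1 0 x v = mvfderiv 𝓘(ℝ, Model m) f x v := by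
  obtain ⟨X, rfl⟩ := exists_vField_apply_eq x v
  have h1 := hD.component_toFun (k := 0) (l := 0) haf X x (X x)
  rw [map_sub, ha X, zero_sub, ← zero_sub, WeylSections.component_sub, WeylSections.component_zero,
    D.apply_function, if_pos ⟨rfl, rfl⟩, zero_sub, neg_inj] at h1
  rw [h1]
  have h2 := fderiv_hcomp_self (E := Model m) 1
    (WeylFiber.hbarCoeff 0 ((a - WeylSections.ofFunction f).eval x)) (X x)
  rw [Nat.cast_one, one_mul] at h2
  exact h2.symm

end WeylConnection

/-! ### The centralizer of the flat sections -/

/-- If `u` commutes with an element whose part of degree one is the covector `σ(w, -)`, then the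
leading nonconstant term of `u` vanishes on `w`. -/
theorem WeylFiber.IsSymplectic.hcomp_eq_zero_of_commute {τ : Model m →L[ℝ] Model m →L[ℝ] ℝ}
    (hτ : WeylFiber.IsSymplectic τ) {u b : WeylFiber τ} {w : Model m} {k l : ℕ}
    (hb : b ∈ WeylFiber.filtration τ 1)
    (h1 : ∀ v, hcomp 1 (WeylFiber.hbarCoeff 0 b) v = (τ w v : ℂ)) (hcomm : b * u = u * b)
    (hu : ∀ j i, j + 2 * i < k + 2 * l → ∀ v, hcomp (j + 1) (WeylFiber.hbarCoeff i u) v = 0) :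
    hcomp (k + 1) (WeylFiber.hbarCoeff l u) w = 0 := by
  -- Only the part of `u` that is constant along the fibre can have lower degree; it is central.
  let z : PowerSeries ℂ := PowerSeries.mk fun l => hcomp 0 (WeylFiber.hbarCoeff l u) 0
  have hz : ∀ j i v, hcomp j (WeylFiber.hbarCoeff i (u - WeylFiber.scalar z)) v =
      if j = 0 then 0 else hcomp j (WeylFiber.hbarCoeff i u) v := by
    intro j i v
    have h1 : hcomp j (WeylFiber.hbarCoeff i (u - WeylFiber.scalar z)) v =
        hcomp j (WeylFiber.hbarCoeff i u) v -
          hcomp j (WeylFiber.hbarCoeff i (WeylFiber.scalar z : WeylFiber τ)) v := by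
      rw [map_sub]
      rfl
    rw [h1, WeylFiber.scalar, WeylFiber.hbarCoeff_ofCoeff, hcomp_algebraMap, PowerSeries.coeff_mk]
    split_ifs with hj
    · subst hj
      rw [hcomp_degree_zero _ v, sub_self]
    · rw [sub_zero]
  have hz' : u - WeylFiber.scalar z ∈ WeylFiber.filtration τ (k + 2 * l + 1) := by
    intro j i hji
    funext v
    rw [hz]
    obtain _ | j := j
    · rfl
    · rw [if_neg j.succ_ne_zero, hu j i (by omega) v]
      rfl
  have hc : b * (u - WeylFiber.scalar z) - (u - WeylFiber.scalar z) * b = 0 := by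
    rw [mul_sub, sub_mul, hcomm, WeylFiber.scalar_mul_comm z b, sub_self]
  have h2 := hτ.hcomp_commutator hb h1 hz'
  rw [hc, map_zero, hcomp_zero] at h2
  have h3 : Complex.I * hcomp k (pd w (WeylFiber.hbarCoeff l (u - WeylFiber.scalar z))) w = 0 :=
    neg_eq_zero.1 (congrFun h2 w).symm
  rw [hcomp_pd, fderiv_hcomp_self, hz, if_neg k.succ_ne_zero] at h3
  have hk : ((k + 1 : ℕ) : ℂ) ≠ 0 := by exact_mod_cast k.succ_ne_zero
  exact (mul_eq_zero.1 ((mul_eq_zero.1 h3).resolve_left Complex.I_ne_zero)).resolve_left hk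

/-- Every covector is the differential of a smooth function. -/
theorem exists_mvfderiv_eq [T2Space M] (x : M) (φ : Model m →L[ℝ] ℝ) :
    ∃ f : C^∞⟮𝓘(ℝ, Model m), M; 𝓘(ℝ, ℂ), ℂ⟯,
      ∀ v : TangentSpace 𝓘(ℝ, Model m) x, mvfderiv 𝓘(ℝ, Model m) f x v = (φ v : ℂ) := by
  let F : M → ℂ := fun y => (cutoff (m := m) x) y • (φ (extChartAt 𝓘(ℝ, Model m) x y) : ℂ)
  let ψ : Model m →L[ℝ] ℂ := Complex.ofRealCLM.comp φ
  have hF : ContMDiff 𝓘(ℝ, Model m) 𝓘(ℝ, ℂ) ∞ F := by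
    refine (cutoff (m := m) x).contMDiff_smul ?_
    exact ψ.contMDiff.comp_contMDiffOn contMDiffOn_extChartAt
  refine ⟨⟨F, hF⟩, fun v => ?_⟩
  have h1 : F =ᶠ[nhds x] ψ ∘ extChartAt 𝓘(ℝ, Model m) x := by
    filter_upwards [(cutoff (m := m) x).eventuallyEq_one] with y hy
    change (cutoff (m := m) x) y • (φ (extChartAt 𝓘(ℝ, Model m) x y) : ℂ) = _
    rw [hy]
    exact one_smul ℝ _
  have h2 : mfderiv 𝓘(ℝ, Model m) 𝓘(ℝ, ℂ) (ψ ∘ extChartAt 𝓘(ℝ, Model m) x) x =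
      (mfderiv 𝓘(ℝ, Model m) 𝓘(ℝ, ℂ) ψ (extChartAt 𝓘(ℝ, Model m) x x)).comp
        (mfderiv 𝓘(ℝ, Model m) 𝓘(ℝ, Model m) (extChartAt 𝓘(ℝ, Model m) x) x) :=
    mfderiv_comp x ψ.differentiableAt.mdifferentiableAt
      (mdifferentiableAt_extChartAt (mem_chart_source _ x))
  have h3 : mfderiv 𝓘(ℝ, Model m) 𝓘(ℝ, ℂ) F x v = ψ v := by
    rw [h1.mfderiv_eq, h2, mfderiv_extChartAt_self, mfderiv_eq_fderiv, ψ.fderiv]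
    rfl
  exact h3

namespace WeylSections

theorem mem_center_of_component_eq_zero {u : WeylSections σ}
    (hu : ∀ k l x v, u.component (k + 1) l x v = 0) : u ∈ Subring.center (WeylSections σ) := by
  refine Subring.mem_center_iff.2 fun a => Subtype.ext (funext fun x => ?_)
  have h : u.eval x = WeylFiber.scalar
      (PowerSeries.mk fun l => hcomp 0 (WeylFiber.hbarCoeff l (u.eval x)) 0) := by
    refine WeylFiber.ext fun l => FormalFunctions.ext fun k v => ?_
    refine Eq.trans ?_ (congrArg (fun g => hcomp k g v) (WeylFiber.hbarCoeff_ofCoeff _ l).symm)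
    rw [hcomp_algebraMap, PowerSeries.coeff_mk]
    obtain _ | k := k
    · exact hcomp_degree_zero _ v
    · exact hu k l x v
  change a.eval x * u.eval x = u.eval x * a.eval x
  rw [h, WeylFiber.scalar_mul_comm]

theorem ofFunction_mul_comm (f : C^∞⟮𝓘(ℝ, Model m), M; 𝓘(ℝ, ℂ), ℂ⟯) (a : WeylSections σ) :
    ofFunction f * a = a * ofFunction f := by
  refine (Subring.mem_center_iff.1 (mem_center_of_component_eq_zero fun k l x v => ?_) a).symm
  rw [component_ofFunction, if_neg (by simp)]

end WeylSections

/-- A section commuting with all the flat sections is central: flat sections realize all covectors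
at a point in degree one, and the commutator with a covector is a derivative along the fibre. -/
theorem WeylConnection.IsFedosov.mem_center_of_commute [T2Space M] {D : WeylConnection σ}
    (hD : D.IsFedosov) {u : WeylSections σ} (hu : ∀ a ∈ D.ker, u * a = a * u) :
    u ∈ Subring.center (WeylSections σ) := by
  refine WeylSections.mem_center_of_component_eq_zero ?_
  suffices h : ∀ d k l, k + 2 * l < d → ∀ x v, u.component (k + 1) l x v = 0 from
    fun k l x v => h _ k l (Nat.lt_succ_self _) x v
  intro d
  induction d with
  | zero => exact fun k l h => absurd h (by omega)
  | succ d ih =>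
    intro k l hkl x w
    obtain ⟨f, hf⟩ := exists_mvfderiv_eq x (σ.at x w)
    obtain ⟨a, ha, haf⟩ := hD.exists_flat (WeylSections.ofFunction f)
    have h1 : (a - WeylSections.ofFunction f) * u = u * (a - WeylSections.ofFunction f) := by
      rw [sub_mul, mul_sub, hu a ha, WeylSections.ofFunction_mul_comm]
    exact (σ.isSymplectic_at x).hcomp_eq_zero_of_commute (WeylSections.eval_mem_filtration haf x)
      (fun v => (hD.component_one_zero_of_flat ha haf x v).trans (hf v))
      (congrArg (fun c : WeylSections σ => c.eval x) h1) (fun j i h v => ih j i (by omega) x v)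

end FlatSections

/-! ### Twisting a homomorphism by a cocycle -/

section Twisting
variable {G N Q : Type*} [Group G] [Group N] [Group Q] {ι : N →* Q} {α : G →* Q}

/-- If conjugation by the image of `α` preserves the image of an injective `ι`, then it lifts to an
action of `G` on `N`. -/
theorem exists_action_of_conj_mem (hι : Function.Injective ι)
    (h : ∀ g n, ∃ n', ι n' = α g * ι n * (α g)⁻¹) :
    ∃ φ : G →* MulAut N, ∀ g n, ι (φ g n) = α g * ι n * (α g)⁻¹ := by
  choose c hc using h
  have hmul : ∀ g n n', c g (n * n') = c g n * c g n' := fun g n n' => hι (by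
    simp only [map_mul, hc]
    group)
  have hcomp : ∀ g g' n, c (g * g') n = c g (c g' n) := fun g g' n => hι (by
    simp only [map_mul, hc]
    group)
  have hone : ∀ n, c 1 n = n := fun n => hι (by
    simp [hc])
  let e : G → MulAut N := fun g =>
    { toFun := c g
      invFun := c g⁻¹
      left_inv := fun n => by rw [← hcomp, inv_mul_cancel, hone]
      right_inv := fun n => by rw [← hcomp, mul_inv_cancel, hone]
      map_mul' := hmul g }
  exact ⟨MonoidHom.mk' e fun g g' => MulEquiv.ext fun n => hcomp g g' n, hc⟩

variable {φ : G →* MulAut N}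

/-- The homomorphism `g ↦ ι (s g) * α g` for a cocycle `s`. -/
def Cocycle₁.twist (hφ : ∀ g n, ι (φ g n) = α g * ι n * (α g)⁻¹) (s : Cocycle₁ φ) : G →* Q :=
  MonoidHom.mk' (fun g => ι (s.1 g) * α g) fun g g' => by
    rw [s.2, map_mul, map_mul, hφ]
    group

theorem Cocycle₁.twist_apply (hφ : ∀ g n, ι (φ g n) = α g * ι n * (α g)⁻¹) (s : Cocycle₁ φ)
    (g : G) : s.twist hφ g = ι (s.1 g) * α g := rfl

theorem Cocycle₁.twist_injective (hι : Function.Injective ι)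
    (hφ : ∀ g n, ι (φ g n) = α g * ι n * (α g)⁻¹) :
    Function.Injective (Cocycle₁.twist hφ) := fun _ _ h =>
  Subtype.ext (funext fun g => hι (mul_right_cancel (DFunLike.congr_fun h g)))

theorem Cocycle₁.exists_twist_eq (hι : Function.Injective ι)
    (hφ : ∀ g n, ι (φ g n) = α g * ι n * (α g)⁻¹) (β : G →* Q)
    (hβ : ∀ g, ∃ n, β g = ι n * α g) : ∃ s : Cocycle₁ φ, s.twist hφ = β := by
  choose s hs using hβ
  refine ⟨⟨s, fun g g' => hι ?_⟩, MonoidHom.ext fun g => (hs g).symm⟩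
  have h := hs (g * g')
  rw [map_mul, hs, hs, map_mul] at h
  rw [map_mul, hφ, eq_mul_inv_of_mul_eq h.symm]
  group

theorem cohomologous_iff_twist_conj (hι : Function.Injective ι)
    (hφ : ∀ g n, ι (φ g n) = α g * ι n * (α g)⁻¹) (s t : Cocycle₁ φ) :
    Cohomologous φ s t ↔ ∃ c : N, ∀ g, t.twist hφ g = ι c * s.twist hφ g * (ι c)⁻¹ := by
  refine exists_congr fun c => forall_congr' fun g => ?_
  rw [← hι.eq_iff, Cocycle₁.twist_apply, Cocycle₁.twist_apply, map_mul, map_mul, hφ, map_inv]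
  constructor
  · intro h
    rw [h]
    group
  · intro h
    rw [eq_mul_inv_of_mul_eq h]
    group

end Twisting

section PullbackOfSections
variable {m : ℕ} {M : Type*} [TopologicalSpace M] [ChartedSpace (Model m) M]
  [IsManifold 𝓘(ℝ, Model m) ∞ M] {σ : SymplecticForm m M} {Γ : Type*} [Group Γ] [MulAction Γ M]

/-! ### Pull-back of sections by symplectomorphisms -/

namespace WeylFiber

/-- Precomposition with a linear map, on formal Weyl algebras. -/
noncomputable def linPullback (τ τ' : Model m →L[ℝ] Model m →L[ℝ] ℝ) (A : Model m →L[ℝ] Model m)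
    (a : WeylFiber τ) : WeylFiber τ' :=
  ofCoeff fun l => _root_.linPullback A (hbarCoeff l a)

theorem linPullback_one (τ τ' : Model m →L[ℝ] Model m →L[ℝ] ℝ) (A : Model m →L[ℝ] Model m) :
    linPullback τ τ' A 1 = 1 := by
  have h : ∀ (τ : Model m →L[ℝ] Model m →L[ℝ] ℝ) l, hbarCoeff l (1 : WeylFiber τ) =
      algebraMap ℂ (FormalFunctions (Model m)) (PowerSeries.coeff l 1) := fun τ l =>
    hbarCoeff_ofCoeff (fun l => algebraMap ℂ (FormalFunctions (Model m)) (PowerSeries.coeff l 1)) l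
  refine ext fun l => ?_
  rw [linPullback, hbarCoeff_ofCoeff, h, h]
  exact FormalFunctions.ext fun k v => by rw [hcomp_linPullback, hcomp_algebraMap]

theorem linPullback_mul (τ : Model m →L[ℝ] Model m →L[ℝ] ℝ) {τ' : Model m →L[ℝ] Model m →L[ℝ] ℝ}
    {A B : Model m →L[ℝ] Model m} (hAB : A.comp B = ContinuousLinearMap.id ℝ (Model m))
    (h : τ.bilinearComp A A = τ') (a b : WeylFiber τ) :
    linPullback τ τ' A (a * b) = linPullback τ τ' A a * linPullback τ τ' A b := by
  subst h
  refine ext fun l => ?_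
  rw [hbarCoeff_mul, linPullback, hbarCoeff_ofCoeff, hbarCoeff_mul, linPullback_sum]
  refine Finset.sum_congr rfl fun p _ => ?_
  rw [linPullback_sum]
  refine Finset.sum_congr rfl fun q _ => ?_
  rw [linPullback_smul, poissonContraction_linPullback τ A B hAB, linPullback, linPullback,
    hbarCoeff_ofCoeff, hbarCoeff_ofCoeff]

end WeylFiber

/-- The derivative of a self-map of `M`, as an endomorphism of the model space. -/
noncomputable def modelDeriv (φ : M → M) (x : M) : Model m →L[ℝ] Model m :=
  mfderiv 𝓘(ℝ, Model m) 𝓘(ℝ, Model m) φ x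

theorem IsSymplecticAction.modelDeriv_comp_modelDeriv_inv (hΓ : IsSymplecticAction Γ σ) (γ : Γ)
    (x : M) : (modelDeriv (m := m) (fun y : M => γ • y) x).comp
      (modelDeriv (fun y : M => γ⁻¹ • y) (γ • x)) = ContinuousLinearMap.id ℝ (Model m) := by
  have h1 : ∀ (γ : Γ) (x : M), MDifferentiableAt 𝓘(ℝ, Model m) 𝓘(ℝ, Model m)
      (fun y : M => γ • y) x := fun γ x => (hΓ.contMDiff γ).mdifferentiableAt (by simp)
  have h2 := mfderiv_comp (γ • x) (h1 γ (γ⁻¹ • γ • x)) (h1 γ⁻¹ (γ • x))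
  have h3 : ((fun y : M => γ • y) ∘ fun y : M => γ⁻¹ • y) = id := by
    funext y
    exact smul_inv_smul γ y
  rw [h3, mfderiv_id] at h2
  have h4 : (modelDeriv (m := m) (fun y : M => γ • y) (γ⁻¹ • γ • x)).comp
      (modelDeriv (fun y : M => γ⁻¹ • y) (γ • x)) = ContinuousLinearMap.id ℝ (Model m) := h2.symm
  rwa [inv_smul_smul] at h4

theorem IsSymplecticAction.bilinearComp_modelDeriv (hΓ : IsSymplecticAction Γ σ) (γ : Γ) (x : M) :
    (σ.at (γ • x)).bilinearComp (modelDeriv (fun y : M => γ • y) x)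
      (modelDeriv (fun y : M => γ • y) x) = σ.at x :=
  ContinuousLinearMap.ext fun v => ContinuousLinearMap.ext fun w => hΓ.preserves γ x v w

/-- The pull-back of sections along a symplectomorphism is multiplicative. -/
noncomputable def pullbackHom (hΓ : IsSymplecticAction Γ σ) (γ : Γ) :
    WeylSections σ →* WeylSections σ where
  toFun := WeylSections.pullback (fun x : M => γ • x) (hΓ.contMDiff γ)
  map_one' := Subtype.ext (funext fun _ => WeylFiber.linPullback_one _ _ _)
  map_mul' a b := Subtype.ext (funext fun x => WeylFiber.linPullback_mul (σ.at (γ • x))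
    (hΓ.modelDeriv_comp_modelDeriv_inv γ x) (hΓ.bilinearComp_modelDeriv γ x)
    (a.eval (γ • x)) (b.eval (γ • x)))

/-- The unit `Ad U (γ^* g)` for a unit `g`. -/
noncomputable def twistedPullbackUnit (hΓ : IsSymplecticAction Γ σ) (γ : Γ)
    (U g : (WeylSections σ)ˣ) : (WeylSections σ)ˣ :=
  U * Units.map (pullbackHom hΓ γ) g * U⁻¹

theorem twistedPullback_mul (hΓ : IsSymplecticAction Γ σ) (γ : Γ) (U : (WeylSections σ)ˣ)
    (a b : WeylSections σ) : twistedPullback hΓ γ U (a * b) =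
      twistedPullback hΓ γ U a * twistedPullback hΓ γ U b := by
  have h := map_mul (pullbackHom hΓ γ) a b
  change (U : WeylSections σ) * pullbackHom hΓ γ (a * b) * _ =
    (U * pullbackHom hΓ γ a * (U⁻¹ : (WeylSections σ)ˣ)) *
      (U * pullbackHom hΓ γ b * (U⁻¹ : (WeylSections σ)ˣ))
  simp only [h, mul_assoc, Units.inv_mul_cancel_left]

theorem val_twistedPullbackUnit (hΓ : IsSymplecticAction Γ σ) (γ : Γ) (U g : (WeylSections σ)ˣ) :
    (twistedPullbackUnit hΓ γ U g : WeylSections σ) = twistedPullback hΓ γ U g := rfl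

theorem val_inv_twistedPullbackUnit (hΓ : IsSymplecticAction Γ σ) (γ : Γ)
    (U g : (WeylSections σ)ˣ) :
    ((twistedPullbackUnit hΓ γ U g)⁻¹ : (WeylSections σ)ˣ) =
      twistedPullback hΓ γ U (g⁻¹ : (WeylSections σ)ˣ) := by
  rw [← val_twistedPullbackUnit]
  congr 1
  simp only [twistedPullbackUnit, mul_inv_rev, inv_inv, map_inv, mul_assoc]

end PullbackOfSections

/-! ### Inner automorphisms of the algebra of flat sections -/

section InnerAutomorphisms
variable {m : ℕ} {M : Type*} [TopologicalSpace M] [ChartedSpace (Model m) M]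
  [IsManifold 𝓘(ℝ, Model m) ∞ M] {σ : SymplecticForm m M}

namespace WeylConnection
variable {D : WeylConnection σ}

theorem toFun_units_val (D : WeylConnection σ) (U : (WeylSections σ)ˣ) (X : VField m M) :
    D.toFun X U = -(U * (D.toFun X (U⁻¹ : (WeylSections σ)ˣ) * U)) := by
  have h := congrArg (fun a => (U : WeylSections σ) * a)
    (eq_neg_of_add_eq_zero_right (D.leibniz_inv U X))
  simp only [mul_neg] at h
  rwa [← mul_assoc, Units.mul_inv, one_mul] at h

/-- The covariant derivative of `Ad U a`, for a flat section `a`, is `Ad U [a, ∇(U⁻¹) U]`. -/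
theorem toFun_conj (D : WeylConnection σ) (U : (WeylSections σ)ˣ) (X : VField m M)
    {a : WeylSections σ} (ha : a ∈ D.ker) :
    D.toFun X (U * a * (U⁻¹ : (WeylSections σ)ˣ)) =
      U * (a * (D.toFun X (U⁻¹ : (WeylSections σ)ˣ) * U) -
        (D.toFun X (U⁻¹ : (WeylSections σ)ˣ) * U) * a) * (U⁻¹ : (WeylSections σ)ˣ) := by
  rw [D.leibniz, D.leibniz, ha X, mul_zero, add_zero, toFun_units_val]
  simp only [mul_sub, sub_mul, neg_mul, mul_assoc, Units.mul_inv, mul_one]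
  abel

theorem conj_mem_ker {U : (WeylSections σ)ˣ} (hU : U ∈ D.equivarianceGroup) {a : WeylSections σ}
    (ha : a ∈ D.ker) : U * a * (U⁻¹ : (WeylSections σ)ˣ) ∈ D.ker := fun X => by
  rw [D.toFun_conj U X ha, Subring.mem_center_iff.1 (hU X) a, sub_self, mul_zero, zero_mul]

/-- Conversely, a unit whose conjugation preserves the flat sections lies in the Fedosov
equivariance group, because the centralizer of the flat sections is the centre. -/
theorem IsFedosov.mem_equivarianceGroup [T2Space M] (hD : D.IsFedosov) {U : (WeylSections σ)ˣ}
    (hU : ∀ a ∈ D.ker, U * a * (U⁻¹ : (WeylSections σ)ˣ) ∈ D.ker) : U ∈ D.equivarianceGroup := by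
  refine fun X => hD.mem_center_of_commute fun a ha => ?_
  have h := (D.toFun_conj U X ha).symm.trans (hU a ha X)
  rw [Units.mul_left_eq_zero, Units.mul_right_eq_zero] at h
  exact (sub_eq_zero.1 h).symm

/-- Conjugation by an element of the Fedosov equivariance group, as an automorphism of the algebra
of flat sections. -/
noncomputable def innerAut (D : WeylConnection σ) :
    D.equivarianceGroup →* (D.ker ≃ₐ[PowerSeries ℂ] D.ker) where
  toFun U :=
    { toFun := fun a => ⟨_, conj_mem_ker U.2 a.2⟩
      invFun := fun a => ⟨_, conj_mem_ker (D.equivarianceGroup.inv_mem U.2) a.2⟩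
      left_inv := fun a => Subtype.ext (by simp [mul_assoc])
      right_inv := fun a => Subtype.ext (by simp [mul_assoc])
      map_mul' := fun a b => Subtype.ext (by simp [mul_assoc])
      map_add' := fun a b => Subtype.ext (by simp [mul_add, add_mul])
      commutes' := fun z => Subtype.ext (by
        change (U.1 : WeylSections σ) * algebraMap (PowerSeries ℂ) (WeylSections σ) z * _ = _
        rw [← Algebra.commutes, mul_assoc, Units.mul_inv, mul_one]
        rfl) }
  map_one' := AlgEquiv.ext fun a => Subtype.ext (by simp)
  map_mul' U V := AlgEquiv.ext fun a => Subtype.ext (by simp [mul_assoc])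

theorem innerAut_apply (U : D.equivarianceGroup) (a : D.ker) :
    (D.innerAut U a : WeylSections σ) =
      (U : (WeylSections σ)ˣ) * a * ((U : (WeylSections σ)ˣ)⁻¹ : (WeylSections σ)ˣ) := rfl

theorem centralSubgroup_le_ker_innerAut : D.centralSubgroup ≤ D.innerAut.ker := by
  intro U hU
  have hU' : ((U : (WeylSections σ)ˣ) : WeylSections σ) ∈ Subring.center (WeylSections σ) := hU
  refine AlgEquiv.ext fun a => Subtype.ext ?_
  rw [innerAut_apply, ← Subring.mem_center_iff.1 hU', mul_assoc, Units.mul_inv, mul_one]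
  rfl

/-- The reduced equivariance group acts on the algebra of flat sections by conjugation. -/
noncomputable def reducedInnerAut (D : WeylConnection σ) :
    D.reducedEquivarianceGroup →* (D.ker ≃ₐ[PowerSeries ℂ] D.ker) :=
  QuotientGroup.lift D.centralSubgroup D.innerAut centralSubgroup_le_ker_innerAut

theorem reducedInnerAut_mk (U : D.equivarianceGroup) :
    D.reducedInnerAut (U : D.reducedEquivarianceGroup) = D.innerAut U := rfl

/-- An element of the equivariance group acting trivially on the flat sections centralizes them. -/
theorem IsFedosov.reducedInnerAut_injective [T2Space M] (hD : D.IsFedosov) :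
    Function.Injective D.reducedInnerAut := by
  refine (injective_iff_map_eq_one _).2 fun n => ?_
  induction n using QuotientGroup.induction_on with
  | H U =>
    intro h
    refine (QuotientGroup.eq_one_iff U).2 ?_
    change ((U : (WeylSections σ)ˣ) : WeylSections σ) ∈ Subring.center (WeylSections σ)
    refine hD.mem_center_of_commute fun a ha => ?_
    have h1 := congrArg Subtype.val (DFunLike.congr_fun h ⟨a, ha⟩)
    exact (Units.mul_inv_eq_iff_eq_mul _).1 h1

theorem IsFedosov.isInnerForSections_iff [T2Space M] (hD : D.IsFedosov)
    (c : D.ker ≃ₐ[PowerSeries ℂ] D.ker) :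
    IsInnerForSections D c ↔ ∃ n, D.reducedInnerAut n = c := by
  constructor
  · rintro ⟨C, hC⟩
    have h : C ∈ D.equivarianceGroup := hD.mem_equivarianceGroup fun a ha => by
      rw [← hC ⟨a, ha⟩]
      exact (c ⟨a, ha⟩).2
    exact ⟨((⟨C, h⟩ : D.equivarianceGroup) : D.reducedEquivarianceGroup),
      AlgEquiv.ext fun a => Subtype.ext (hC a).symm⟩
  · rintro ⟨n, rfl⟩
    induction n using QuotientGroup.induction_on with
    | H U => exact ⟨U, fun k => rfl⟩

variable {Γ : Type*} [Group Γ] [MulAction Γ M] {hΓ : IsSymplecticAction Γ σ} {γ : Γ}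

/-- Conjugation by `Ad U (γ^* g)` on flat sections is conjugation by `g`, transported by
`Ad U ∘ γ^*`. -/
theorem IsFedosov.exists_twistedPullback [T2Space M] (hD : D.IsFedosov)
    {f : D.ker ≃ₐ[PowerSeries ℂ] D.ker} {U : (WeylSections σ)ˣ} (hU : Represents D hΓ γ f U)
    (g : D.equivarianceGroup) :
    ∃ h : D.equivarianceGroup, ((h : (WeylSections σ)ˣ) : WeylSections σ) =
        twistedPullback hΓ γ U ((g : (WeylSections σ)ˣ) : WeylSections σ) ∧
      D.innerAut h = f * D.innerAut g * f⁻¹ := by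
  have key : ∀ a : D.ker, (twistedPullbackUnit hΓ γ U g : WeylSections σ) * (a : WeylSections σ) *
      ((twistedPullbackUnit hΓ γ U g)⁻¹ : (WeylSections σ)ˣ) =
      ((f * D.innerAut g * f⁻¹) a : D.ker) := by
    intro a
    have h1 : (a : WeylSections σ) = twistedPullback hΓ γ U (f⁻¹ a : D.ker) := by
      rw [← hU]
      exact congrArg Subtype.val (AlgEquiv.apply_symm_apply f a).symm
    rw [AlgEquiv.mul_apply, AlgEquiv.mul_apply, hU, innerAut_apply, twistedPullback_mul,
      twistedPullback_mul, val_twistedPullbackUnit, val_inv_twistedPullbackUnit, ← h1]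
  refine ⟨⟨twistedPullbackUnit hΓ γ U g, hD.mem_equivarianceGroup fun a ha => ?_⟩, rfl,
    AlgEquiv.ext fun a => Subtype.ext (key a)⟩
  rw [key ⟨a, ha⟩]
  exact Subtype.property _

/-- Two automorphisms of the flat sections that lift the same symplectomorphism differ by an inner
one; conversely inner automorphisms do not change the lifting property. -/
theorem IsFedosov.exists_represents_iff [T2Space M] (hD : D.IsFedosov)
    {f f' : D.ker ≃ₐ[PowerSeries ℂ] D.ker} {U : (WeylSections σ)ˣ} (hU : Represents D hΓ γ f U) :
    (∃ V, Represents D hΓ γ f' V) ↔ ∃ n, f' = D.reducedInnerAut n * f := by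
  constructor
  · rintro ⟨V, hV⟩
    have key : ∀ k : D.ker,
        ((V * U⁻¹ : (WeylSections σ)ˣ) : WeylSections σ) * (f k : WeylSections σ) *
        ((V * U⁻¹)⁻¹ : (WeylSections σ)ˣ) = (f' k : WeylSections σ) := by
      intro k
      rw [hU, hV]
      simp [twistedPullback, mul_assoc]
    have h : V * U⁻¹ ∈ D.equivarianceGroup := hD.mem_equivarianceGroup fun a ha => by
      have h1 := key (f⁻¹ ⟨a, ha⟩)
      rw [show f (f⁻¹ ⟨a, ha⟩) = ⟨a, ha⟩ from AlgEquiv.apply_symm_apply f _] at h1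
      rw [h1]
      exact Subtype.property _
    exact ⟨((⟨_, h⟩ : D.equivarianceGroup) : D.reducedEquivarianceGroup),
      AlgEquiv.ext fun k => Subtype.ext (key k).symm⟩
  · rintro ⟨n, rfl⟩
    induction n using QuotientGroup.induction_on with
    | H s =>
      refine ⟨s * U, fun k => ?_⟩
      rw [reducedInnerAut_mk, AlgEquiv.mul_apply, innerAut_apply, hU]
      simp [twistedPullback, mul_assoc]

end WeylConnection
end InnerAutomorphisms

/-! ### Extensions of the action and nonabelian cohomology -/

theorem mainTheorem1 {n : ℕ} {M : Type*} [TopologicalSpace M] [T2Space M]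
    [SecondCountableTopology M] [ChartedSpace (Model (2 * n)) M]
    [IsManifold 𝓘(ℝ, Model (2 * n)) ∞ M] (σ : SymplecticForm (2 * n) M)
    {Γ : Type*} [Group Γ] [MulAction Γ M] (hΓ : IsSymplecticAction Γ σ)
    (D : WeylConnection σ) (hD : D.IsFedosov) (A : ExtendedAction D hΓ) :
    ∃ act : Γᵐᵒᵖ →* MulAut D.reducedEquivarianceGroup,
      (∀ (γ : Γ) (U : (WeylSections σ)ˣ), Represents D hΓ γ (A.aut γ) U →
        ∀ g : D.equivarianceGroup, ∃ h : D.equivarianceGroup,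
          ((h : (WeylSections σ)ˣ) : WeylSections σ) =
            twistedPullback hΓ γ U ((g : (WeylSections σ)ˣ) : WeylSections σ) ∧
          act (MulOpposite.op γ) (g : D.reducedEquivarianceGroup) = (h : D.reducedEquivarianceGroup)) ∧
      ∃ Ψ : Cocycle₁ act ≃ ExtendedAction D hΓ,
        (∀ (S : Cocycle₁ act) (γ : Γ) (s : D.equivarianceGroup),
          (s : D.reducedEquivarianceGroup) = S.1 (MulOpposite.op γ) →
          ∀ k : D.ker, (((Ψ S).aut γ k : D.ker) : WeylSections σ) =
            ((s : (WeylSections σ)ˣ) : WeylSections σ) * (A.aut γ k : WeylSections σ) *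
              (((s : (WeylSections σ)ˣ)⁻¹ : (WeylSections σ)ˣ) : WeylSections σ)) ∧
        Ψ (trivialCocycle act) = A ∧
        (∀ S S' : Cocycle₁ act, Cohomologous act S S' ↔ (Ψ S).Equivalent (Ψ S')) ∧
        ∃ Φ : GroupH1 act ≃ Quotient (extendedActionSetoid D hΓ),
          (∀ S, Φ (cocycleClass act S) = Quotient.mk _ (Ψ S)) ∧
          Φ (cocycleClass act (trivialCocycle act)) = Quotient.mk _ A := by
  have hι := hD.reducedInnerAut_injective
  choose U hU using A.2
  obtain ⟨act, hact⟩ := exists_action_of_conj_mem (ι := D.reducedInnerAut) (α := A.1) hι (by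
    intro g n
    induction n using QuotientGroup.induction_on with
    | H V =>
      obtain ⟨h, -, hh⟩ := hD.exists_twistedPullback (hU g.unop) V
      exact ⟨(h : D.reducedEquivarianceGroup), hh⟩)
  -- Modifying `A_γ` by an inner automorphism keeps it of the form `Ad V ∘ γ^*`.
  have hext : ∀ (S : Cocycle₁ act) (γ : Γ), ∃ V,
      Represents D hΓ γ (S.twist hact (MulOpposite.op γ)) V := fun S γ =>
    (hD.exists_represents_iff (hU γ)).2 ⟨_, rfl⟩
  let Ψ : Cocycle₁ act ≃ ExtendedAction D hΓ :=
    Equiv.ofBijective (fun S => ⟨S.twist hact, hext S⟩)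
      ⟨fun S S' h => Cocycle₁.twist_injective hι hact (congrArg Subtype.val h), fun B => by
        obtain ⟨S, hS⟩ := Cocycle₁.exists_twist_eq hι hact B.1 fun g =>
          (hD.exists_represents_iff (hU g.unop)).1 (B.2 g.unop)
        exact ⟨S, Subtype.ext hS⟩⟩
  have hΨ : ∀ S γ, (Ψ S).aut γ = D.reducedInnerAut (S.1 (MulOpposite.op γ)) * A.aut γ :=
    fun S γ => rfl
  have htriv : Ψ (trivialCocycle act) = A := Subtype.ext (MonoidHom.ext fun g => by
    change D.reducedInnerAut 1 * A.1 g = A.1 g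
    rw [map_one, one_mul])
  have hequiv : ∀ S S' : Cocycle₁ act, Cohomologous act S S' ↔ (Ψ S).Equivalent (Ψ S') := by
    intro S S'
    rw [cohomologous_iff_twist_conj hι hact]
    constructor
    · rintro ⟨c, hc⟩
      exact ⟨_, (hD.isInnerForSections_iff _).2 ⟨c, rfl⟩, fun γ => hc (MulOpposite.op γ)⟩
    · rintro ⟨_, hc, h⟩
      obtain ⟨c, rfl⟩ := (hD.isInnerForSections_iff _).1 hc
      exact ⟨c, fun g => h g.unop⟩
  refine ⟨act, fun γ V hV g => ?_, Ψ, fun S γ s hs k => ?_, htriv, hequiv,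
    Quotient.congr Ψ hequiv, fun S => rfl, ?_⟩
  · obtain ⟨h, hh, hconj⟩ := hD.exists_twistedPullback hV g
    exact ⟨h, hh, hι ((hact _ _).trans hconj.symm)⟩
  · rw [hΨ, ← hs]
    rfl
  · exact congrArg (Quotient.mk _) htriv
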